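/- **Setting.** Let $M$ be a Polish space and $\lambda\neq 0$ a $\sigma$-finite Borel measure on $M$ (for instance a $\sigma$-finite Radon measure). Let $\mathbb M$ and $\mathscr P$ be the sets of finite Borel measures and of Borel probability measures on $M$, with the topology of weak convergence. Let $\mathbb M^{ac}=\{\mu\in\mathbb M:\mu\ll\lambda\}$ and $\mathscr P^{ac}=\{\mu\in\mathscr P:\mu\ll\lambda\}$, with the total variation distance $\rho_{var}(\mu,\nu)=\lambda(|h_\mu-h_\nu|)$, $h_\mu=d\mu/d\lambda$, and its Borel $\sigma$-algebra. For $u:\mathbb M\to\mathbb R$ put $D^Eu(\mu)(x)=\lim_{\varepsilon\downarrow0}\varepsilon^{-1}\big(u(\mu+\varepsilon\delta_x)-u(\mu)\big)$, and for $u:\mathscr P\to\mathbb R$ put $\tilde D^Eu(\mu)(x)=\lim_{\varepsilon\downarrow0}\varepsilon^{-1}\big(u((1-\varepsilon)\mu+\varepsilon\delta_x)-u(\mu)\big)$. Let $C_b^{E,1}(\mathbb M)$ be the set of continuous $u$ on $\mathbb M$ such that $D^Eu$ exists everywhere and is continuous on $\mathbb M\times M$, and $|u|+|D^Eu|$ is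 bounded; define $C_b^{E,1}(\mathscr P)$ in the same way with $\mathscr P,\tilde D^E$. Let $C_{b,2}^{E,1}(\mathbb M)$ be the set of $u\in C_b^{E,1}(\mathbb M)$ with $\sup_{\mu\in\mathbb M^{ac}}\|D^Eu(\mu)\|_{L^2(\mu)}<\infty$. Let $H=L^2(M,\lambda)$, $H_0=H\setminus\{0\}$, and let $\Lambda_0$ be a Borel probability measure on $H$ with $\Lambda_0(\{0\})=0$. Put $\Psi_{\mathbb M}(h)=h^2\lambda$ for $h\in H$ and $\Psi_{\mathscr P}(h)=h^2\lambda/\lambda(h^2)$ for $h\in H_0$, and let $\Lambda_{\mathbb M}=\Lambda_0\circ\Psi_{\mathbb M}^{-1}$, $\Lambda_{\mathscr P}=\Lambda_0\circ\Psi_{\mathscr P}^{-1}$ be the image measures on $\mathbb M^{ac}$ and $\mathscr P^{ac}$. For $(S,\Lambda)=(\mathbb M^{ac},\Lambda_{\mathbb M})$ or $(\mathscr P^{ac},\Lambda_{\mathscr P})$: * a *diffusion coefficient* on $S$ is a family $\{A(\mu)\}_{\mu\in S}$ of bounded symmetric nonnegative definite operators on $L^2(M,\mu)$ such that for every bounded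 continuous $\eta$ on $S\times M$ the function $(\mu,x)\mapsto A(\mu)\eta(\mu,\cdot)(x)$ has a jointly measurable version, and $\int_S\|A(\mu)\|\,d\Lambda(\mu)<\infty$; * a *jump measure* on $S$ is a $\sigma$-finite measure $J$ on $S\times S$ with $J\ll\Lambda\times\Lambda$ and $\int_{S\times S}[1\wedge\rho_{var}(\gamma,\eta)^2]\,dJ(\gamma,\eta)<\infty$. Let $C_b^1(H)$ be the set of bounded continuously Fréchet differentiable $f:H\to\mathbb R$ with $\|\nabla f\|_H$ bounded, and $C_{b,0}^1(H)$ the set of those bounded continuously Fréchet differentiable $f$ with $h\mapsto\|h\|_H\|\nabla f(h)\|_H$ bounded. For $h\in H_0$, $h'\in H$ put $A_h^{\mathbb M}h'=h\,A(\Psi_{\mathbb M}(h))(h'/h)$ and $A_h^{\mathscr P}h'=h\,A(\Psi_{\mathscr P}(h))(h'/h)$, and define $$\mathscr E^{0,A}_{\mathbb M}(f,g)=\int_H\langle A_h^{\mathbb M}\nabla f(h),\nabla g(h)\rangle_H\,d\Lambda_0(h),\quad f,g\in C_b^1(H),$$ $$\mathscr E^{0,A}_{\mathscr P}(f,g)=\int_H\langle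 A_h^{\mathscr P}\nabla f(h),\nabla g(h)\rangle_H\|h\|_H^2\,d\Lambda_0(h),\quad f,g\in C_{b,0}^1(H).$$ A symmetric Dirichlet form on $L^2(X,\Lambda)$ is a densely defined, closed, nonnegative symmetric bilinear form $(\mathscr E,\mathscr D(\mathscr E))$ such that $u\in\mathscr D(\mathscr E)$ implies $u^+\wedge1\in\mathscr D(\mathscr E)$ and $\mathscr E(u+u^+\wedge1,u-u^+\wedge1)\ge0$. Let $\mathscr E_1=\mathscr E+\langle\cdot,\cdot\rangle_{L^2}$; let $\mathrm{Cap}_1(O)=\inf\{\mathscr E_1(u,u):u\in\mathscr D(\mathscr E),\,u\ge1\ \Lambda\text{-a.e. on }O\}$ for open $O$, and $\mathrm{Cap}_1(B)=\inf\{\mathrm{Cap}_1(O):O\supseteq B\text{ open}\}$ for arbitrary $B$. A nest is a sequence of closed sets $K_n$ with $\mathrm{Cap}_1(X\setminus K_n)\to0$; a measurable function is quasi-continuous if its restriction to each set of some nest is continuous. The form is quasi-regular if there is a nest of compact sets, some $\mathscr E_1^{1/2}$-dense subspace of $\mathscr D(\mathscr E)$ consists of functions with quasi-continuous versions, and some sequence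 of quasi-continuous functions from $\mathscr D(\mathscr E)$ separates the points outside a set of capacity zero. **Corollary 3.7.** (1) Let $A$ be a diffusion coefficient on $\mathbb M^{ac}$ such that $(\mathscr E^{0,A}_{\mathbb M},C_b^1(H))$ is closable in $L^2(H,\Lambda_0)$. Then for every nonnegative $V\in L^1(\mathbb M^{ac},\Lambda_{\mathbb M})$ and every jump measure $J$ on $\mathbb M^{ac}$, the bilinear form $$\mathscr E(u,v)=\int(u(\gamma)-u(\eta))(v(\gamma)-v(\eta))\,dJ(\gamma,\eta)+\int uvV\,d\Lambda_{\mathbb M}+\int\langle A(\mu)D^Eu(\mu),D^Ev(\mu)\rangle_{L^2(\mu)}\,d\Lambda_{\mathbb M}(\mu),\quad u,v\in C_{b,2}^{E,1}(\mathbb M),$$ is closable in $L^2(\mathbb M^{ac},\Lambda_{\mathbb M})$, and its closure is a quasi-regular symmetric Dirichlet form. (2) Let $A$ be a diffusion coefficient on $\mathscr P^{ac}$ such that $(\mathscr E^{0,A}_{\mathscr P},C_{b,0}^1(H))$ is closable in $L^2(H,\Lambda_0)$. Then for every nonnegative $V\in L^1(\mathscr P^{ac},\Lambda_{\mathscr P})$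 and every jump measure $J$ on $\mathscr P^{ac}$, the bilinear form $$\mathscr E(u,v)=\int(u(\gamma)-u(\eta))(v(\gamma)-v(\eta))\,dJ(\gamma,\eta)+\int uvV\,d\Lambda_{\mathscr P}+\int\langle A(\mu)\tilde D^Eu(\mu),\tilde D^Ev(\mu)\rangle_{L^2(\mu)}\,d\Lambda_{\mathscr P}(\mu),\quad u,v\in C_b^{E,1}(\mathscr P),$$ is closable in $L^2(\mathscr P^{ac},\Lambda_{\mathscr P})$, and its closure is a quasi-regular symmetric Dirichlet form. The same holds in $L^2(\mathbb M^{ac},\Lambda_{\mathscr P})$, where $\Lambda_{\mathscr P}$ is regarded as a measure on $\mathbb M^{ac}$ carried by $\mathscr P^{ac}$. -/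

import Mathlib

open MeasureTheory Filter Topology
open scoped ENNReal NNReal

noncomputable section

namespace ExtrinsicForm

/-! ### Bilinear forms on an `L²` space -/

section AbstractForms

variable {X : Type*} [MeasurableSpace X] {F : Type*} [AddCommGroup F]

/-- A pre-form is a bilinear map `q` on a linear space `D` of objects `u`, each of which has a
realization `ι u : X → ℝ` that is regarded as an element of `L²(X, Λ)`. It is closable if
`u n → 0` in `L²` and `q (u n - u m) (u n - u m) → 0` imply `q (u n) (u n) → 0`. -/
def IsClosable (Λ : Measure X) (D : Set F) (ι : F → X → ℝ) (q : F → F → ℝ) : Prop :=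
  ∀ u : ℕ → F, (∀ n, u n ∈ D) →
    Tendsto (fun n => eLpNorm (ι (u n)) 2 Λ) atTop (𝓝 0) →
    Tendsto (fun p : ℕ × ℕ => q (u p.1 - u p.2) (u p.1 - u p.2)) atTop (𝓝 0) →
    Tendsto (fun n => q (u n) (u n)) atTop (𝓝 0)

/-- A bilinear form on `L²(X, Λ)` with its domain. -/
structure L2Form (Λ : Measure X) where
  domain : Submodule ℝ (Lp ℝ 2 Λ)
  form : domain →ₗ[ℝ] domain →ₗ[ℝ] ℝ

namespace L2Form

variable {Λ : Measure X} (E : L2Form Λ)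

/-- `E₁(u, v) = E(u, v) + ⟨u, v⟩` in `L²(X, Λ)`. -/
def form1 (u v : E.domain) : ℝ :=
  E.form u v + inner ℝ (u : Lp ℝ 2 Λ) (v : Lp ℝ 2 Λ)

/-- The form is closed: its domain is complete for the norm `E₁(u, u)^(1/2)`. -/
def IsClosed : Prop :=
  ∀ u : ℕ → E.domain,
    Tendsto (fun p : ℕ × ℕ => E.form1 (u p.1 - u p.2) (u p.1 - u p.2)) atTop (𝓝 0) →
    ∃ w : E.domain, Tendsto (fun n => E.form1 (u n - w) (u n - w)) atTop (𝓝 0)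

/-- Symmetric Dirichlet forms. In the Markov property, `w` is the element `1 ∧ u⁺`. -/
structure IsDirichletForm : Prop where
  dense : Dense (E.domain : Set (Lp ℝ 2 Λ))
  symm : ∀ u v, E.form u v = E.form v u
  nonneg : ∀ u, 0 ≤ E.form u u
  coercive : ∃ K : ℝ, 0 < K ∧
    ∀ u v, |E.form1 u v| ≤ K * Real.sqrt (E.form1 u u * E.form1 v v)
  closed : E.IsClosed
  markov : ∀ u : E.domain, ∃ w : E.domain,
    (w : Lp ℝ 2 Λ) =ᵐ[Λ] (fun z => min 1 (max ((u : Lp ℝ 2 Λ) z) 0)) ∧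
    0 ≤ E.form (u + w) (u - w) ∧ 0 ≤ E.form (u - w) (u + w)

/-- `E` is the closure of the pre-form `(D, ι, q)`: it is closed, it extends `q`, and `D` is
dense in its domain for the `E₁`-norm. -/
structure IsClosureOf (D : Set F) (ι : F → X → ℝ) (q : F → F → ℝ) : Prop where
  closed : E.IsClosed
  mem_domain : ∀ u ∈ D, ∃ f : E.domain, (f : Lp ℝ 2 Λ) =ᵐ[Λ] ι u
  form_eq : ∀ u ∈ D, ∀ v ∈ D, ∀ f g : E.domain,
    (f : Lp ℝ 2 Λ) =ᵐ[Λ] ι u → (g : Lp ℝ 2 Λ) =ᵐ[Λ] ι v → E.form f g = q u v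
  dense : ∀ f : E.domain, ∀ ε : ℝ, 0 < ε →
    ∃ u ∈ D, ∃ g : E.domain, (g : Lp ℝ 2 Λ) =ᵐ[Λ] ι u ∧ E.form1 (f - g) (f - g) < ε

variable [TopologicalSpace X]

/-- The `1`-capacity of an open set (the infimum over the empty set is `∞`). -/
def capOpen (O : Set X) : ℝ≥0∞ :=
  ⨅ (u : E.domain) (_ : ∀ᵐ z ∂Λ, z ∈ O → 1 ≤ (u : Lp ℝ 2 Λ) z), ENNReal.ofReal (E.form1 u u)

/-- The `1`-capacity of an arbitrary set. -/
def cap (B : Set X) : ℝ≥0∞ :=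
  ⨅ (O : Set X) (_ : IsOpen O) (_ : B ⊆ O), E.capOpen O

/-- Nests of closed sets. -/
def IsNest (K : ℕ → Set X) : Prop :=
  (∀ n, _root_.IsClosed (K n)) ∧ Tendsto (fun n => E.cap (K n)ᶜ) atTop (𝓝 0)

/-- Quasi-continuous functions. -/
def IsQuasiContinuous (u : X → ℝ) : Prop :=
  Measurable u ∧ ∃ K : ℕ → Set X, E.IsNest K ∧ ∀ n, ContinuousOn u (K n)

/-- Quasi-regularity: there is a nest of compact sets; there is an `E₁`-dense subspace of the
domain whose elements have quasi-continuous versions; countably many quasi-continuous functions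
from the domain separate the points outside a set of capacity zero. -/
structure IsQuasiRegular : Prop where
  tight : ∃ K : ℕ → Set X, E.IsNest K ∧ ∀ n, IsCompact (K n)
  dense_quasiContinuous : ∃ S : Submodule ℝ E.domain,
    (∀ f ∈ S, ∃ u : X → ℝ, E.IsQuasiContinuous u ∧ ((f : E.domain) : Lp ℝ 2 Λ) =ᵐ[Λ] u) ∧
    ∀ f : E.domain, ∀ ε : ℝ, 0 < ε → ∃ g ∈ S, E.form1 (f - g) (f - g) < ε
  separating : ∃ (N : Set X) (u : ℕ → X → ℝ), E.cap N = 0 ∧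
    (∀ n, E.IsQuasiContinuous (u n) ∧ ∃ f : E.domain, (f : Lp ℝ 2 Λ) =ᵐ[Λ] u n) ∧
    ∀ y ∉ N, ∀ z ∉ N, y ≠ z → ∃ n, u n y ≠ u n z

end L2Form

/-- The pre-form `(D, ι, q)` is closable in `L²(X, Λ)`, and its closure is a quasi-regular
(symmetric) Dirichlet form. -/
def HasQuasiRegularClosure [TopologicalSpace X] (Λ : Measure X)
    (D : Set F) (ι : F → X → ℝ) (q : F → F → ℝ) : Prop :=
  IsClosable Λ D ι q ∧
    ∃ E : L2Form Λ, E.IsClosureOf D ι q ∧ E.IsDirichletForm ∧ E.IsQuasiRegular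

end AbstractForms

variable {M : Type*} [MeasurableSpace M]

/-- The class in `L²(ν)` of a function (and `0` if the function is not square integrable). -/
def toL2 (ν : Measure M) (f : M → ℝ) : Lp ℝ 2 ν :=
  open Classical in if hf : MemLp f 2 ν then hf.toLp f else 0

/-! ### Absolutely continuous finite and probability measures, with total variation distance -/

/-- Finite measures that are absolutely continuous with respect to `lam`. -/
def Mac (lam : Measure M) : Type _ :=
  {μ : FiniteMeasure M // (μ : Measure M) ≪ lam}

/-- Probability measures that are absolutely continuous with respect to `lam`. -/
def Pac (lam : Measure M) : Type _ :=
  {μ : ProbabilityMeasure M // (μ : Measure M) ≪ lam}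

variable {lam : Measure M}

/-- The underlying measure. -/
abbrev Mac.meas (μ : Mac lam) : Measure M := (μ.1 : Measure M)

/-- The underlying measure. -/
abbrev Pac.meas (μ : Pac lam) : Measure M := (μ.1 : Measure M)

/-- The inclusion of probability measures into finite measures. -/
def Pac.toMac (μ : Pac lam) : Mac lam := ⟨ProbabilityMeasure.toFiniteMeasure μ.1, μ.2⟩

instance (μ : Mac lam) : IsFiniteMeasure μ.meas := FiniteMeasure.isFiniteMeasure μ.1

instance (μ : Pac lam) : IsProbabilityMeasure μ.meas := μ.1.2

/-- The density `h_μ = dμ/dλ` as an element of `L¹(λ)`. -/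
def density (lam ν : Measure M) [IsFiniteMeasure ν] : Lp ℝ 1 lam :=
  (memLp_one_iff_integrable.2 (Measure.integrable_toReal_rnDeriv (μ := ν) (ν := lam))).toLp
    (fun x => (ν.rnDeriv lam x).toReal)

theorem density_inj [SigmaFinite lam] {ν₁ ν₂ : Measure M} [IsFiniteMeasure ν₁]
    [IsFiniteMeasure ν₂] (h₁ : ν₁ ≪ lam) (h₂ : ν₂ ≪ lam)
    (h : density lam ν₁ = density lam ν₂) : ν₁ = ν₂ := by
  have h3 := (MemLp.toLp_eq_toLp_iff _ _).1 h
  rw [← Measure.withDensity_rnDeriv_eq ν₁ lam h₁, ← Measure.withDensity_rnDeriv_eq ν₂ lam h₂]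
  apply withDensity_congr_ae
  filter_upwards [h3, Measure.rnDeriv_lt_top ν₁ lam, Measure.rnDeriv_lt_top ν₂ lam]
    with x hx hx1 hx2
  exact (ENNReal.toReal_eq_toReal_iff' hx1.ne hx2.ne).1 hx

/-- The total variation distance `λ(|h_μ - h_ν|)`. -/
instance [SigmaFinite lam] : MetricSpace (Mac lam) :=
  MetricSpace.induced (fun μ => density lam μ.meas)
    (fun μ ν h => Subtype.ext (Subtype.ext (density_inj (ν₁ := μ.meas) (ν₂ := ν.meas) μ.2 ν.2 h)))
    inferInstance

/-- The total variation distance `λ(|h_μ - h_ν|)`. -/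
instance [SigmaFinite lam] : MetricSpace (Pac lam) :=
  MetricSpace.induced (fun μ => density lam μ.meas)
    (fun μ ν h => Subtype.ext (Subtype.ext (density_inj (ν₁ := μ.meas) (ν₂ := ν.meas) μ.2 ν.2 h)))
    inferInstance

theorem Mac.dist_eq [SigmaFinite lam] (μ ν : Mac lam) : dist μ ν =
    ∫ x, |(μ.meas.rnDeriv lam x).toReal - (ν.meas.rnDeriv lam x).toReal| ∂lam := by
  change dist (density lam μ.meas) (density lam ν.meas) = _
  rw [dist_eq_norm, L1.norm_eq_integral_norm]
  apply integral_congr_ae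
  filter_upwards [Lp.coeFn_sub (density lam μ.meas) (density lam ν.meas),
    MemLp.coeFn_toLp (memLp_one_iff_integrable.2
      (Measure.integrable_toReal_rnDeriv (μ := μ.meas) (ν := lam))),
    MemLp.coeFn_toLp (memLp_one_iff_integrable.2
      (Measure.integrable_toReal_rnDeriv (μ := ν.meas) (ν := lam)))] with x h1 h2 h3
  rw [h1, Pi.sub_apply, density, density, h2, h3, Real.norm_eq_abs]

instance [SigmaFinite lam] : MeasurableSpace (Mac lam) := borel _
instance [SigmaFinite lam] : BorelSpace (Mac lam) := ⟨rfl⟩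
instance [SigmaFinite lam] : MeasurableSpace (Pac lam) := borel _
instance [SigmaFinite lam] : BorelSpace (Pac lam) := ⟨rfl⟩

/-! ### Extrinsic derivatives

`FiniteMeasure M` and `ProbabilityMeasure M` carry the topology of weak convergence. -/

/-- The Dirac measure as a finite measure. -/
def diracFinite (x : M) : FiniteMeasure M := ⟨Measure.dirac x, inferInstance⟩

/-- The difference quotient `(u(μ + ε δ_x) - u(μ)) / ε`. -/
def extrinsicQuot (u : FiniteMeasure M → ℝ) (μ : FiniteMeasure M) (x : M) (ε : ℝ≥0) : ℝ :=
  (u (μ + ε • diracFinite x) - u μ) / ε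

/-- The extrinsic derivative `D^E u(μ)(x)`. -/
def extrinsicDeriv (u : FiniteMeasure M → ℝ) (μ : FiniteMeasure M) (x : M) : ℝ :=
  limUnder (𝓝[>] (0 : ℝ≥0)) (extrinsicQuot u μ x)

/-- The mixture `(1 - ε) μ + ε δ_x`. -/
def mixDirac (μ : ProbabilityMeasure M) (x : M) (ε : unitInterval) : ProbabilityMeasure M :=
  ⟨ENNReal.ofReal (1 - ε) • (μ : Measure M) + ENNReal.ofReal ε • Measure.dirac x, ⟨by
    simp only [Measure.coe_add, Measure.coe_smul, Pi.add_apply, Pi.smul_apply, smul_eq_mul,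
      measure_univ, mul_one]
    rw [← ENNReal.ofReal_add (by linarith [ε.2.2]) ε.2.1]
    simp⟩⟩

/-- The difference quotient `(u((1 - ε) μ + ε δ_x) - u(μ)) / ε`. -/
def convExtrinsicQuot (u : ProbabilityMeasure M → ℝ) (μ : ProbabilityMeasure M) (x : M)
    (ε : unitInterval) : ℝ :=
  (u (mixDirac μ x ε) - u μ) / ε

/-- The convexity extrinsic derivative of `u` at `μ` and `x`. -/
def convExtrinsicDeriv (u : ProbabilityMeasure M → ℝ) (μ : ProbabilityMeasure M) (x : M) : ℝ :=
  limUnder (𝓝[>] (0 : unitInterval)) (convExtrinsicQuot u μ x)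

section Classes

variable [TopologicalSpace M] [OpensMeasurableSpace M]

/-- Bounded continuous functions of finite measures with a bounded, jointly continuous extrinsic
derivative. -/
def CE1b (M : Type*) [MeasurableSpace M] [TopologicalSpace M] [OpensMeasurableSpace M] :
    Set (FiniteMeasure M → ℝ) :=
  {u | Continuous u ∧
    (∀ μ x, ∃ d : ℝ, Tendsto (extrinsicQuot u μ x) (𝓝[>] (0 : ℝ≥0)) (𝓝 d)) ∧
    Continuous (fun p : FiniteMeasure M × M => extrinsicDeriv u p.1 p.2) ∧
    ∃ C : ℝ, ∀ μ x, |u μ| + |extrinsicDeriv u μ x| ≤ C}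

/-- The functions in `CE1b M` for which the `L²(μ)`-norm of `D^E u(μ)` is bounded over all
absolutely continuous finite measures `μ`. -/
def CE1b2 (lam : Measure M) : Set (FiniteMeasure M → ℝ) :=
  {u | u ∈ CE1b M ∧ ∃ C : ℝ≥0, ∀ μ : Mac lam, eLpNorm (extrinsicDeriv u μ.1) 2 μ.meas ≤ C}

/-- Bounded continuous functions of probability measures with a bounded, jointly continuous
convexity extrinsic derivative. -/
def PCE1b (M : Type*) [MeasurableSpace M] [TopologicalSpace M] [OpensMeasurableSpace M] :
    Set (ProbabilityMeasure M → ℝ) :=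
  {u | Continuous u ∧
    (∀ μ x, ∃ d : ℝ, Tendsto (convExtrinsicQuot u μ x) (𝓝[>] (0 : unitInterval)) (𝓝 d)) ∧
    Continuous (fun p : ProbabilityMeasure M × M => convExtrinsicDeriv u p.1 p.2) ∧
    ∃ C : ℝ, ∀ μ x, |u μ| + |convExtrinsicDeriv u μ x| ≤ C}

end Classes

/-! ### The Hilbert space `H = L²(λ)` and the maps into the spaces of measures -/

/-- The Hilbert space `H = L²(M, λ)`. -/
abbrev H (lam : Measure M) : Type _ := Lp ℝ 2 lam

instance : MeasurableSpace (H lam) := borel _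
instance : BorelSpace (H lam) := ⟨rfl⟩

/-- `H` without the origin. -/
abbrev H0 (lam : Measure M) : Type _ := {h : H lam // h ≠ 0}

theorem integrable_sq (h : H lam) : Integrable (fun x => h x ^ 2) lam :=
  (Lp.memLp h).integrable_sq

/-- The measure `h² λ`. -/
def sqMeasure (h : H lam) : Measure M := lam.withDensity (fun x => ENNReal.ofReal (h x ^ 2))

instance (h : H lam) : IsFiniteMeasure (sqMeasure h) :=
  isFiniteMeasure_withDensity_ofReal (integrable_sq h).2

theorem sqMeasure_univ (h : H lam) :
    sqMeasure h Set.univ = ENNReal.ofReal (∫ x, h x ^ 2 ∂lam) := by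
  rw [sqMeasure, withDensity_apply _ MeasurableSet.univ, Measure.restrict_univ,
    ofReal_integral_eq_lintegral_ofReal (integrable_sq h) (ae_of_all _ fun x => sq_nonneg _)]

theorem integral_sq_pos (h : H0 lam) : 0 < ∫ x, h.1 x ^ 2 ∂lam := by
  refine lt_of_le_of_ne (integral_nonneg fun x => sq_nonneg _) fun h0 => h.2 ?_
  have h1 := (integral_eq_zero_iff_of_nonneg (fun x => sq_nonneg (h.1 x))
    (integrable_sq h.1)).1 h0.symm
  rw [Lp.eq_zero_iff_ae_eq_zero]
  filter_upwards [h1] with x hx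
  simpa using hx

/-- The map `h ↦ h² λ`. -/
def PsiM (h : H lam) : Mac lam :=
  ⟨⟨sqMeasure h, inferInstance⟩, withDensity_absolutelyContinuous _ _⟩

/-- The map `h ↦ h² λ / λ(h²)`, for `h ≠ 0`. -/
def PsiP (h : H0 lam) : Pac lam :=
  ⟨⟨(ENNReal.ofReal (∫ x, h.1 x ^ 2 ∂lam))⁻¹ • sqMeasure h.1, ⟨by
    rw [Measure.smul_apply, sqMeasure_univ, smul_eq_mul]
    exact ENNReal.inv_mul_cancel (by simpa using integral_sq_pos h) ENNReal.ofReal_ne_top⟩⟩,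
  (withDensity_absolutelyContinuous _ _).smul_left _⟩

/-- The restriction of a measure on `H` to `H` without the origin. -/
def restrictH0 (Λ0 : Measure (H lam)) : Measure (H0 lam) := Λ0.comap Subtype.val

section Images

variable [SigmaFinite lam]

/-- The image of `Λ0` under `PsiM`. -/
def LamM (Λ0 : Measure (H lam)) : Measure (Mac lam) := Λ0.map PsiM

/-- The image of `Λ0` under `PsiP` (used when `Λ0` does not charge the origin). -/
def LamP (Λ0 : Measure (H lam)) : Measure (Pac lam) := (restrictH0 Λ0).map PsiP

end Images

/-! ### Diffusion coefficients -/

/-- A family of bounded linear operators `A(μ)` on `L²(μ)`, for `μ` in `Mac`. -/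
abbrev CoeffM (lam : Measure M) : Type _ := ∀ μ : Mac lam, Lp ℝ 2 μ.meas →L[ℝ] Lp ℝ 2 μ.meas

/-- A family of bounded linear operators `A(μ)` on `L²(μ)`, for `μ` in `Pac`. -/
abbrev CoeffP (lam : Measure M) : Type _ := ∀ μ : Pac lam, Lp ℝ 2 μ.meas →L[ℝ] Lp ℝ 2 μ.meas

section Coefficients

variable [TopologicalSpace M] [SigmaFinite lam]

/-- The assumption on the diffusion coefficient over `Mac`: each `A(μ)` is symmetric and
nonnegative, `(μ, x) ↦ (A(μ) η(μ, ·))(x)` is (has a version which is) jointly measurable for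
every bounded continuous `η`, and the operator norm of `A(μ)` is integrable. -/
structure AdmissibleM (Λ : Measure (Mac lam)) (A : CoeffM lam) : Prop where
  positive : ∀ μ, (A μ).IsPositive
  measurable : ∀ η : BoundedContinuousFunction (Mac lam × M) ℝ,
    ∃ G : Mac lam × M → ℝ, Measurable G ∧
      ∀ μ, A μ (toL2 μ.meas (fun x => η (μ, x))) =ᵐ[μ.meas] (fun x => G (μ, x))
  integrable_norm : Integrable (fun μ => ‖A μ‖) Λ

/-- The assumption on the diffusion coefficient over `Pac`. -/
structure AdmissibleP (Λ : Measure (Pac lam)) (A : CoeffP lam) : Prop where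
  positive : ∀ μ, (A μ).IsPositive
  measurable : ∀ η : BoundedContinuousFunction (Pac lam × M) ℝ,
    ∃ G : Pac lam × M → ℝ, Measurable G ∧
      ∀ μ, A μ (toL2 μ.meas (fun x => η (μ, x))) =ᵐ[μ.meas] (fun x => G (μ, x))
  integrable_norm : Integrable (fun μ => ‖A μ‖) Λ

end Coefficients

/-- The operator `h' ↦ h A(h' / h)` on `H`, for an operator `A` on `L²(ν)`, where `ν` is
`h² λ` or `h² λ / λ(h²)`. -/
def liftOp {ν : Measure M} (A : Lp ℝ 2 ν →L[ℝ] Lp ℝ 2 ν) (h h' : H lam) : H lam :=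
  toL2 lam (fun x => h x * (A (toL2 ν (fun y => h' y / h y))) x)

/-! ### The forms on `H` -/

/-- Bounded continuously Fréchet differentiable functions on `H` with bounded gradient. -/
def C1b (lam : Measure M) : Set (H lam → ℝ) :=
  {f | ContDiff ℝ 1 f ∧ (∃ C : ℝ, ∀ h, |f h| ≤ C) ∧ ∃ C : ℝ, ∀ h, ‖gradient f h‖ ≤ C}

/-- Bounded continuously Fréchet differentiable functions on `H` for which
`‖h‖ ‖∇ f(h)‖` is bounded. -/
def C1b0 (lam : Measure M) : Set (H lam → ℝ) :=
  {f | ContDiff ℝ 1 f ∧ (∃ C : ℝ, ∀ h, |f h| ≤ C) ∧ ∃ C : ℝ, ∀ h, ‖h‖ * ‖gradient f h‖ ≤ C}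

/-- `∫ ⟨A_h ∇f(h), ∇g(h)⟩ dΛ0(h)`, where `A_h h' = h A(PsiM h)(h' / h)`. -/
def form0M (Λ0 : Measure (H lam)) (A : CoeffM lam) (f g : H lam → ℝ) : ℝ :=
  ∫ h, inner ℝ (liftOp (A (PsiM h)) h (gradient f h)) (gradient g h) ∂Λ0

/-- `∫ ⟨A_h ∇f(h), ∇g(h)⟩ ‖h‖² dΛ0(h)`, where `A_h h' = h A(PsiP h)(h' / h)`. -/
def form0P (Λ0 : Measure (H lam)) (A : CoeffP lam) (f g : H lam → ℝ) : ℝ :=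
  ∫ h : H0 lam, inner ℝ (liftOp (A (PsiP h)) h.1 (gradient f h.1)) (gradient g h.1) * ‖h.1‖ ^ 2
    ∂(restrictH0 Λ0)

/-! ### The forms with jump, killing and diffusion parts -/

section Forms

variable [SigmaFinite lam]

/-- The assumption on the jump measure over `Mac`. -/
structure IsJumpM (Λ : Measure (Mac lam)) (J : Measure (Mac lam × Mac lam)) : Prop where
  sigmaFinite : SigmaFinite J
  lintegral_lt_top : ∫⁻ p, ENNReal.ofReal (min 1 (dist p.1 p.2 ^ 2)) ∂J < ∞
  absolutelyContinuous : J ≪ Λ.prod Λ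

/-- The assumption on the jump measure over `Pac`. -/
structure IsJumpP (Λ : Measure (Pac lam)) (J : Measure (Pac lam × Pac lam)) : Prop where
  sigmaFinite : SigmaFinite J
  lintegral_lt_top : ∫⁻ p, ENNReal.ofReal (min 1 (dist p.1 p.2 ^ 2)) ∂J < ∞
  absolutelyContinuous : J ≪ Λ.prod Λ

/-- The sum of the jump, killing and diffusion forms over `Mac`. -/
def formM (Λ : Measure (Mac lam)) (J : Measure (Mac lam × Mac lam)) (V : Mac lam → ℝ)
    (A : CoeffM lam) (u v : FiniteMeasure M → ℝ) : ℝ :=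
  (∫ p, (u p.1.1 - u p.2.1) * (v p.1.1 - v p.2.1) ∂J)
    + (∫ μ, u μ.1 * v μ.1 * V μ ∂Λ)
    + ∫ μ, inner ℝ (A μ (toL2 μ.meas (extrinsicDeriv u μ.1))) (toL2 μ.meas (extrinsicDeriv v μ.1)) ∂Λ

/-- The sum of the jump, killing and diffusion forms over `Pac`. -/
def formP (Λ : Measure (Pac lam)) (J : Measure (Pac lam × Pac lam)) (V : Pac lam → ℝ)
    (A : CoeffP lam) (u v : ProbabilityMeasure M → ℝ) : ℝ :=
  (∫ p, (u p.1.1 - u p.2.1) * (v p.1.1 - v p.2.1) ∂J)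
    + (∫ μ, u μ.1 * v μ.1 * V μ ∂Λ)
    + ∫ μ, inner ℝ (A μ (toL2 μ.meas (convExtrinsicDeriv u μ.1)))
        (toL2 μ.meas (convExtrinsicDeriv v μ.1)) ∂Λ

end Forms

/-- A function of finite measures as a function on `Mac`. -/
def onMac (lam : Measure M) (u : FiniteMeasure M → ℝ) : Mac lam → ℝ := fun μ => u μ.1

/-- A function of probability measures as a function on `Pac`. -/
def onPac (lam : Measure M) (u : ProbabilityMeasure M → ℝ) : Pac lam → ℝ := fun μ => u μ.1

/-- A function of probability measures as a function on `Mac`, extended by zero. -/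
def extendToMac (lam : Measure M) (u : ProbabilityMeasure M → ℝ) : Mac lam → ℝ :=
  Function.extend Pac.toMac (onPac lam u) 0

end ExtrinsicForm

end

open ExtrinsicForm

set_option linter.unusedSectionVars false

/-! Closability of the diffusion part is inherited from the Hilbert space `H`. If `U` is a function
of finite measures with extrinsic derivative `D`, then `h ↦ U(h²λ)` is continuously differentiable
with gradient `2hD(h²λ)` (`hasGradientAt_lift`). The factor `h` cancels in `A_h`, so the form of the
lift on `H` is four times the diffusion form (`inner_liftOp`, `form0M_lift`), and a sequence
violating closability downstairs would violate it upstairs. The differentiability rests on a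
fundamental theorem of calculus: the derivative is given only in Dirac directions, but joint
continuity extends it to finite sums of Dirac measures, and weak approximation then gives the
integrated formula along every finite measure (`sub_eq_integral`).

For probability measures the lift through `h²λ/λ(h²)` is singular at `h = 0`. It is replaced by the
lift of `χ(m) u(μ/m)`, where `m` is the mass of `μ` and `χ = cutoff n` vanishes near zero. Since
`tχ'(t)` is bounded uniformly in `n`, this lift lies in `C1b0`, and the cutoff changes the energy by
an amount that tends to zero by dominated convergence, because `Λ0` does not charge the origin.
Choosing `n` separately for each member of a sequence makes the errors vanish
(`isClosable_diffForm_pac`).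

The jump and killing parts are squared `L²` norms for measures controlled by `Λ × Λ` and `Λ`. A
Cauchy sequence for such a norm with an almost everywhere null subsequence tends to zero, so the sum
is closable (`IsFormCore.isClosable`). The closure is modelled on the Hilbert completion `K` of the
pre-form, which closability embeds in `L²` (`exists_hilbert_completion`). The chain rule lets smooth
approximations of the unit contraction decrease the form, and weak compactness in `K` passes to the
contraction itself.

All functions of the domain are continuous in total variation and countably many separate points, so
the substance of quasi-regularity is a nest of compact sets. The `L¹` distance of a suitably scaled
density to a fixed function is a countable supremum of normalized integrals of continuous functions.
These lie in a class `pathBall` with uniformly bounded energy that is stable under approximate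
maxima and minima. Minima of the distances to a dense sequence, combined with a function controlling
the mass, decrease to zero, and their small sublevel sets intersect in compact sets
(`exists_compact_exhaustion`). Mazur's lemma turns this bounded decreasing sequence into dominating
functions of small norm, which bound the capacities of the complements (`exists_compact_nest`). -/

namespace ExtrinsicForm

/-! ### Completion of a closable pre-form and weak compactness in Hilbert spaces. -/

section HilbertSpace

universe u

variable {L : Type*} [NormedAddCommGroup L] [InnerProductSpace ℝ L] [CompleteSpace L]

/-- `K` is the completion of `E` for the seminorm `(q(u,u) + ‖j u‖²)^(1/2)`, and `T` extends the
contraction `j`. Injectivity of `T` is closability in disguise: an element of its kernel is a limit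
of vectors `u n` with `j (u n) → 0` that are Cauchy for `q`, so its norm is zero. -/
theorem exists_hilbert_completion {E : Type u} [AddCommGroup E] [Module ℝ E]
    (q : E →ₗ[ℝ] E →ₗ[ℝ] ℝ) (j : E →ₗ[ℝ] L)
    (symm : ∀ u v, q u v = q v u) (nonneg : ∀ u, 0 ≤ q u u)
    (closable : ∀ u : ℕ → E, Tendsto (fun n => j (u n)) atTop (𝓝 0) →
      Tendsto (fun p : ℕ × ℕ => q (u p.1 - u p.2) (u p.1 - u p.2)) atTop (𝓝 0) →
      Tendsto (fun n => q (u n) (u n)) atTop (𝓝 0)) :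
    ∃ (K : Type u) (_ : NormedAddCommGroup K) (_ : InnerProductSpace ℝ K) (_ : CompleteSpace K)
      (i : E →ₗ[ℝ] K) (T : K →L[ℝ] L), DenseRange i ∧ Function.Injective T ∧
      (∀ u, T (i u) = j u) ∧ ∀ u v, inner ℝ (i u) (i v) = q u v + inner ℝ (j u) (j v) := by
  let core : PreInnerProductSpace.Core ℝ E :=
    { inner := fun u v => q u v + inner ℝ (j u) (j v)
      conj_inner_symm := fun u v => by
        simp only [conj_trivial]
        rw [symm v u, real_inner_comm]
      re_inner_nonneg := fun u => add_nonneg (nonneg u) real_inner_self_nonneg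
      add_left := fun u v w => by
        simp only [map_add, LinearMap.add_apply, inner_add_left]
        ring
      smul_left := fun u v r => by
        simp only [map_smul, LinearMap.smul_apply, smul_eq_mul, conj_trivial, inner_smul_left]
        ring }
  let _ : SeminormedAddCommGroup E :=
    @InnerProductSpace.Core.toSeminormedAddCommGroup ℝ E _ _ _ core
  let _ : InnerProductSpace ℝ E := InnerProductSpace.ofCore core
  have hinner : ∀ u v : E, inner ℝ u v = q u v + inner ℝ (j u) (j v) := fun u v => rfl
  let i : E →ₗ[ℝ] UniformSpace.Completion E :=
    (UniformSpace.Completion.toComplL : E →L[ℝ] UniformSpace.Completion E)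
  have hi : ∀ u : E, i u = (u : UniformSpace.Completion E) := fun u => rfl
  have hdense : DenseRange i := UniformSpace.Completion.denseRange_coe
  have hii : ∀ u v, inner ℝ (i u) (i v) = q u v + inner ℝ (j u) (j v) := fun u v => by
    rw [hi, hi, UniformSpace.Completion.inner_coe, hinner]
  have hsq : ∀ u, ‖i u‖ ^ 2 = q u u + ‖j u‖ ^ 2 := fun u => by
    rw [← real_inner_self_eq_norm_sq, hii, real_inner_self_eq_norm_sq]
  have hnorm : ∀ u, ‖j u‖ ≤ 1 * ‖i u‖ := fun u => by
    rw [one_mul]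
    refine abs_le_of_sq_le_sq' ?_ (norm_nonneg _) |>.2
    rw [hsq]
    linarith [nonneg u]
  let T : UniformSpace.Completion E →L[ℝ] L := j.extendOfNorm i
  have hT : ∀ u, T (i u) = j u := fun u => LinearMap.extendOfNorm_eq hdense ⟨1, hnorm⟩ u
  refine ⟨UniformSpace.Completion E, inferInstance, inferInstance, inferInstance, i, T, hdense,
    ?_, hT, hii⟩
  rw [injective_iff_map_eq_zero]
  intro x hx
  have hx' : x ∈ closure (Set.range i) := hdense x
  obtain ⟨y, hy, hyx⟩ := mem_closure_iff_seq_limit.1 hx'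
  choose u hu using hy
  have hux : Tendsto (fun n => i (u n)) atTop (𝓝 x) := by simpa only [hu] using hyx
  have h1 : Tendsto (fun n => j (u n)) atTop (𝓝 0) := by
    have := (T.continuous.tendsto x).comp hux
    rw [hx] at this
    simpa only [Function.comp_def, hT] using this
  have h2 : Tendsto (fun p : ℕ × ℕ => q (u p.1 - u p.2) (u p.1 - u p.2)) atTop (𝓝 0) := by
    have h3 : Tendsto (fun p : ℕ × ℕ => ‖i (u p.1) - i (u p.2)‖ ^ 2) atTop (𝓝 0) := by
      rw [← prod_atTop_atTop_eq]
      have := (((hux.comp tendsto_fst).sub (hux.comp tendsto_snd)).norm).pow 2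
      simpa using this
    refine squeeze_zero (fun p => nonneg _) (fun p => ?_) h3
    rw [← map_sub, hsq]
    nlinarith [norm_nonneg (j (u p.1 - u p.2))]
  have h4 := closable u h1 h2
  have h5 : Tendsto (fun n => ‖i (u n)‖ ^ 2) atTop (𝓝 0) := by
    simp only [hsq]
    simpa using h4.add (h1.norm.pow 2)
  have h6 := tendsto_nhds_unique h5 (hux.norm.pow 2)
  exact norm_eq_zero.1 (pow_eq_zero_iff (two_ne_zero) |>.1 h6.symm)

variable {K : Type*} [NormedAddCommGroup K] [InnerProductSpace ℝ K] [CompleteSpace K]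

/-- A bounded sequence in a Hilbert space has a weak limit along an ultrafilter. -/
theorem exists_weak_limit (x : ℕ → K) {c : ℝ} (hx : ∀ n, ‖x n‖ ≤ c) :
    ∃ y : K, ‖y‖ ≤ c ∧ ∃ U : Ultrafilter ℕ, (U : Filter ℕ) ≤ atTop ∧
      ∀ z, Tendsto (fun n => inner ℝ (x n) z) U (𝓝 (inner ℝ y z)) := by
  let f : ℕ → WeakDual ℝ K := fun n => StrongDual.toWeakDual (InnerProductSpace.toDual ℝ K (x n))
  -- Banach–Alaoglu after the Riesz identification. An ultrafilter finer than `atTop` replaces a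
  -- subsequence, so separability of `K` plays no role.
  have hK := WeakDual.isCompact_closedBall (𝕜 := ℝ) (E := K) 0 c
  let U : Ultrafilter ℕ := Ultrafilter.of atTop
  obtain ⟨φ, hφ, hlim⟩ := hK.ultrafilter_le_nhds (U.map f) (by
    rw [le_principal_iff, Ultrafilter.coe_map, mem_map]
    refine univ_mem' fun n => ?_
    simp only [Set.mem_preimage, Metric.mem_closedBall, dist_zero_right, f]
    exact ((InnerProductSpace.toDual ℝ K).norm_map (x n)).le.trans (hx n))
  refine ⟨(InnerProductSpace.toDual ℝ K).symm (WeakDual.toStrongDual φ), ?_, U,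
    Ultrafilter.of_le _, fun z => ?_⟩
  · rw [LinearIsometryEquiv.norm_map]
    simpa using hφ
  · have h1 : Tendsto f U (𝓝 φ) := hlim
    have h2 := ((WeakDual.eval_continuous (𝕜 := ℝ) z).tendsto φ).comp h1
    have h3 : inner ℝ ((InnerProductSpace.toDual ℝ K).symm (WeakDual.toStrongDual φ)) z = φ z :=
      InnerProductSpace.toDual_symm_apply
    rw [h3]
    exact h2

/-- The weak limit in `K` is identified through the adjoint: `⟨T x n, g⟩ = ⟨x n, T* g⟩`, and the
left side has the strong limit `⟨w, g⟩`. -/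
theorem exists_weak_limit_of_tendsto_map (T : K →L[ℝ] L) (x : ℕ → K) {c : ℝ}
    (hx : ∀ n, ‖x n‖ ≤ c) {w : L} (hw : Tendsto (fun n => T (x n)) atTop (𝓝 w)) :
    ∃ y : K, T y = w ∧ ‖y‖ ≤ c ∧ ∃ U : Ultrafilter ℕ, (U : Filter ℕ) ≤ atTop ∧
      ∀ z, Tendsto (fun n => inner ℝ (x n) z) U (𝓝 (inner ℝ y z)) := by
  obtain ⟨y, hy, U, hU, hlim⟩ := exists_weak_limit x hx
  refine ⟨y, ?_, hy, U, hU, hlim⟩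
  refine ext_inner_right ℝ fun g => ?_
  have h1 := hlim (ContinuousLinearMap.adjoint T g)
  simp only [ContinuousLinearMap.adjoint_inner_right] at h1
  exact tendsto_nhds_unique h1 ((hw.mono_left hU).inner tendsto_const_nhds)

/-- Weak compactness in the form of lower semicontinuity of the norm. -/
theorem exists_norm_le_of_tendsto_map (T : K →L[ℝ] L) (x : ℕ → K) {b : ℕ → ℝ} {c : ℝ}
    (hx : ∀ n, ‖x n‖ ≤ b n) (hb : Tendsto b atTop (𝓝 c)) {w : L}
    (hw : Tendsto (fun n => T (x n)) atTop (𝓝 w)) :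
    ∃ y : K, T y = w ∧ ‖y‖ ≤ c := by
  obtain ⟨C, hC⟩ := hb.bddAbove_range
  obtain ⟨y, hy, -, U, hU, hlim⟩ := exists_weak_limit_of_tendsto_map T x
    (fun n => (hx n).trans (hC ⟨n, rfl⟩)) hw
  refine ⟨y, hy, ?_⟩
  -- Testing the weak convergence against the limit `y` itself gives lower semicontinuity of the
  -- norm.
  have h1 : ‖y‖ * ‖y‖ ≤ c * ‖y‖ := by
    rw [← real_inner_self_eq_norm_mul_norm]
    refine le_of_tendsto_of_tendsto (hlim y) ((hb.mono_left hU).mul_const ‖y‖)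
      (Eventually.of_forall fun n => ?_)
    exact (real_inner_le_norm _ _).trans (mul_le_mul_of_nonneg_right (hx n) (norm_nonneg _))
  have hc : 0 ≤ c := ge_of_tendsto' hb fun n => (norm_nonneg _).trans (hx n)
  rcases (norm_nonneg y).eq_or_lt with h | h
  · rw [← h]; exact hc
  · exact le_of_mul_le_mul_right h1 h

/-- Mazur's lemma: convex combinations of a bounded sequence tend to zero if its image under an
injective operator does. -/
theorem zero_mem_closure_convexHull (T : K →L[ℝ] L) (hT : Function.Injective T) (x : ℕ → K)
    {c : ℝ} (hx : ∀ n, ‖x n‖ ≤ c) (hw : Tendsto (fun n => T (x n)) atTop (𝓝 0)) :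
    (0 : K) ∈ closure (convexHull ℝ (Set.range x)) := by
  by_contra h0
  obtain ⟨y, hy, -, U, hU, hlim⟩ := exists_weak_limit_of_tendsto_map T x hx hw
  have hy0 : y = 0 := hT (by rw [hy, map_zero])
  -- A functional separating zero from the closed convex hull would stay above a positive level
  -- along `x n`, while weak convergence to zero sends it to zero.
  obtain ⟨f, r, hr0, hr⟩ := geometric_hahn_banach_point_closed
    (convex_convexHull ℝ (Set.range x)).closure isClosed_closure h0
  have h1 := hlim ((InnerProductSpace.toDual ℝ K).symm f)
  rw [hy0, inner_zero_left] at h1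
  rw [map_zero] at hr0
  have h2 : r ≤ 0 := ge_of_tendsto h1 (Eventually.of_forall fun n => by
    rw [real_inner_comm, InnerProductSpace.toDual_symm_apply]
    exact (hr _ (subset_closure (subset_convexHull ℝ _ ⟨n, rfl⟩))).le)
  linarith

end HilbertSpace

theorem tendsto_eLpNorm_two_of_bounded {X : Type*} [MeasurableSpace X] {Λ : Measure X}
    [IsFiniteMeasure Λ] {f : ℕ → X → ℝ} {c : ℝ} (hf : ∀ n, AEStronglyMeasurable (f n) Λ)
    (hc : ∀ n, ∀ᵐ x ∂Λ, |f n x| ≤ c)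
    (h0 : ∀ᵐ x ∂Λ, Tendsto (fun n => f n x) atTop (𝓝 0)) :
    Tendsto (fun n => eLpNorm (f n) 2 Λ) atTop (𝓝 0) := by
  have h1 : Tendsto (fun n => ∫⁻ x, ‖f n x‖ₑ ^ (2 : ℝ) ∂Λ) atTop (𝓝 (∫⁻ _, 0 ∂Λ)) := by
    refine tendsto_lintegral_of_dominated_convergence' (fun _ => ENNReal.ofReal c ^ (2 : ℝ))
      (fun n => (hf n).enorm.pow_const _) (fun n => ?_) ?_ ?_
    · filter_upwards [hc n] with x hx
      gcongr
      rw [← ofReal_norm, Real.norm_eq_abs]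
      exact ENNReal.ofReal_le_ofReal hx
    · simp only [lintegral_const]
      exact ENNReal.mul_ne_top (by simp) (measure_ne_top _ _)
    · filter_upwards [h0] with x hx
      have := (ENNReal.continuous_rpow_const (y := 2)).tendsto _ |>.comp
        (hx.enorm)
      simpa [Function.comp_def] using this
  have h2 := ((ENNReal.continuous_rpow_const (y := 1 / 2)).tendsto _).comp h1
  simp only [lintegral_zero] at h2
  rw [ENNReal.zero_rpow_of_pos (by norm_num)] at h2
  refine h2.congr fun n => ?_
  rw [eLpNorm_eq_lintegral_rpow_enorm_toReal (by norm_num) (by norm_num)]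
  simp

/-! ### Forms given by an injective operator into `L²`; capacities and nests. -/

section Forms

variable {X : Type*} [MeasurableSpace X] {Λ : Measure X}
variable {K : Type*} [NormedAddCommGroup K] [InnerProductSpace ℝ K]

theorem posSMulMono_Lp : PosSMulMono ℝ (Lp ℝ 2 Λ) := by
  refine ⟨fun a ha f g hfg => ?_⟩
  rw [← Lp.coeFn_le] at hfg ⊢
  filter_upwards [hfg, Lp.coeFn_smul a f, Lp.coeFn_smul a g] with x h1 h2 h3
  rw [h2, h3]
  exact mul_le_mul_of_nonneg_left h1 ha

attribute [local instance] posSMulMono_Lp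

namespace L2Form

/-- The form whose domain is the image of a Hilbert space `K` under an injective operator `T`, and
whose `1`-form is the inner product of `K`. -/
noncomputable def ofHilbert (T : K →L[ℝ] Lp ℝ 2 Λ) (hT : Function.Injective T) : L2Form Λ where
  domain := LinearMap.range (T : K →ₗ[ℝ] Lp ℝ 2 Λ)
  form := (innerₗ K).compl₁₂
      ((LinearEquiv.ofInjective (T : K →ₗ[ℝ] Lp ℝ 2 Λ) hT).symm : _ →ₗ[ℝ] K)
      ((LinearEquiv.ofInjective (T : K →ₗ[ℝ] Lp ℝ 2 Λ) hT).symm : _ →ₗ[ℝ] K)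
    - (innerₗ (Lp ℝ 2 Λ)).compl₁₂ (Submodule.subtype _) (Submodule.subtype _)

variable (T : K →L[ℝ] Lp ℝ 2 Λ) (hT : Function.Injective T)

/-- The identification of `K` with the domain of `ofHilbert T`. -/
noncomputable def toDomain : K ≃ₗ[ℝ] (ofHilbert T hT).domain :=
  LinearEquiv.ofInjective (T : K →ₗ[ℝ] Lp ℝ 2 Λ) hT

@[simp] theorem coe_toDomain (x : K) : ((toDomain T hT x : (ofHilbert T hT).domain) : Lp ℝ 2 Λ) = T x :=
  rfl

theorem form1_toDomain (x y : K) :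
    (ofHilbert T hT).form1 (toDomain T hT x) (toDomain T hT y) = inner ℝ x y := by
  have h : ∀ x, (LinearEquiv.ofInjective (T : K →ₗ[ℝ] Lp ℝ 2 Λ) hT).symm (toDomain T hT x) = x :=
    fun x => LinearEquiv.symm_apply_apply _ x
  change inner ℝ ((LinearEquiv.ofInjective (T : K →ₗ[ℝ] Lp ℝ 2 Λ) hT).symm (toDomain T hT x))
    ((LinearEquiv.ofInjective (T : K →ₗ[ℝ] Lp ℝ 2 Λ) hT).symm (toDomain T hT y))
    - inner ℝ (T x) (T y) + inner ℝ (T x) (T y) = _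
  rw [sub_add_cancel]
  exact congrArg₂ _ (h x) (h y)

theorem form_toDomain (x y : K) :
    (ofHilbert T hT).form (toDomain T hT x) (toDomain T hT y)
      = inner ℝ x y - inner ℝ (T x) (T y) := by
  rw [← form1_toDomain T hT, form1, coe_toDomain, coe_toDomain, add_sub_cancel_right]

theorem ofHilbert_isClosed [CompleteSpace K] : (ofHilbert T hT).IsClosed := by
  intro u hu
  obtain ⟨x, rfl⟩ : ∃ x : ℕ → K, u = fun n => toDomain T hT (x n) :=
    ⟨fun n => (toDomain T hT).symm (u n), by simp⟩
  simp only [← map_sub, form1_toDomain, real_inner_self_eq_norm_sq] at hu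
  have h1 : CauchySeq x := by
    rw [Metric.cauchySeq_iff]
    intro ε hε
    have h2 := (tendsto_order.1 hu).2 (ε ^ 2) (by positivity)
    rw [← prod_atTop_atTop_eq, eventually_prod_iff] at h2
    obtain ⟨p, hp, r, hr, hpr⟩ := h2
    obtain ⟨N, hN⟩ := eventually_atTop.1 (hp.and hr)
    refine ⟨N, fun m hm n hn => ?_⟩
    rw [dist_eq_norm]
    exact lt_of_pow_lt_pow_left₀ 2 hε.le (hpr (hN m hm).1 (hN n hn).2)
  obtain ⟨y, hy⟩ := cauchySeq_tendsto_of_complete h1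
  refine ⟨toDomain T hT y, ?_⟩
  simp only [← map_sub, form1_toDomain, real_inner_self_eq_norm_sq]
  have := ((tendsto_iff_norm_sub_tendsto_zero.1 hy)).pow 2
  simpa using this

theorem capOpen_le [TopologicalSpace X] {O : Set X} (z : K)
    (hz : ∀ᵐ x ∂Λ, x ∈ O → 1 ≤ T z x) :
    (ofHilbert T hT).capOpen O ≤ ENNReal.ofReal (‖z‖ ^ 2) := by
  refine (iInf₂_le (toDomain T hT z) hz).trans ?_
  rw [form1_toDomain, real_inner_self_eq_norm_sq]

theorem cap_le_of_isOpen [TopologicalSpace X] (E : L2Form Λ) {O : Set X} (hO : IsOpen O) :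
    E.cap O ≤ E.capOpen O :=
  (iInf_le _ O).trans ((iInf_le _ hO).trans (iInf_le _ subset_rfl))

/-- The zero function is admissible for a null open set. This allows any closed set of full measure
to be used as a constant nest. -/
theorem cap_eq_zero_of_isOpen [TopologicalSpace X] {O : Set X} (hO : IsOpen O) (h0 : Λ O = 0) :
    (ofHilbert T hT).cap O = 0 := by
  refine le_antisymm ((cap_le_of_isOpen _ hO).trans ?_) zero_le
  refine (capOpen_le T hT 0 ?_).trans (by simp)
  filter_upwards [measure_eq_zero_iff_ae_notMem.1 h0] with x hx h using absurd h hx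

theorem isQuasiContinuous_of_continuousOn [TopologicalSpace X] {X0 : Set X}
    (hX0 : _root_.IsClosed X0) (h0 : Λ X0ᶜ = 0) {u : X → ℝ} (hm : Measurable u)
    (hc : ContinuousOn u X0) : (ofHilbert T hT).IsQuasiContinuous u := by
  refine ⟨hm, fun _ => X0, ⟨fun _ => hX0, ?_⟩, fun _ => hc⟩
  simp only [cap_eq_zero_of_isOpen T hT hX0.isOpen_compl h0]
  exact tendsto_const_nhds

/-- A decreasing sequence in the domain which is bounded for the form norm and tends to zero is
dominated by elements of small norm. -/
theorem exists_norm_lt_of_antitone [CompleteSpace K] (x : ℕ → K) {c : ℝ} (hx : ∀ n, ‖x n‖ ≤ c)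
    (hmono : ∀ n, T (x (n + 1)) ≤ T (x n)) (hlim : Tendsto (fun n => T (x n)) atTop (𝓝 0))
    (hT : Function.Injective T) {ε : ℝ} (hε : 0 < ε) :
    ∃ (N : ℕ) (z : K), ‖z‖ < ε ∧ T (x N) ≤ T z := by
  have hanti : Antitone fun n => T (x n) := antitone_nat_of_succ_le hmono
  have h1 := zero_mem_closure_convexHull T hT x hx hlim
  rw [Metric.mem_closure_iff] at h1
  obtain ⟨z, hz, hzε⟩ := h1 ε hε
  rw [dist_comm, dist_zero_right] at hzε
  -- The elements eventually dominating the decreasing sequence form a convex set containing every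
  -- `x k`, hence the whole convex hull. Mazur's lemma finds elements of small norm in that hull.
  let S : Set K := {z | ∃ N, ∀ n ≥ N, T (x n) ≤ T z}
  have hS : convexHull ℝ (Set.range x) ⊆ S := by
    refine convexHull_min ?_ ?_
    · rintro _ ⟨k, rfl⟩
      exact ⟨k, fun n hn => hanti hn⟩
    · rintro y ⟨N, hN⟩ y' ⟨N', hN'⟩ a b ha hb hab
      refine ⟨max N N', fun n hn => ?_⟩
      have e1 := hN n ((le_max_left _ _).trans hn)
      have e2 := hN' n ((le_max_right _ _).trans hn)
      rw [map_add, map_smul, map_smul]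
      calc T (x n) = a • T (x n) + b • T (x n) := by rw [← add_smul, hab, one_smul]
        _ ≤ _ := add_le_add (smul_le_smul_of_nonneg_left e1 ha)
          (smul_le_smul_of_nonneg_left e2 hb)
  obtain ⟨N, hN⟩ := hS hz
  exact ⟨N, z, hzε, hN N le_rfl⟩

/-- For each `j` choose `z j` of norm below `2⁻ʲ/(j+1)` dominating `v (N j)`. Outside the `n`-th set
some `(j+1) v (N j)` with `j ≥ n` exceeds `1`, or the point lies in the null set off `X0`. Hence
`∑_{j ≥ n} (j+1) z j` is admissible for the capacity of the complement, and its norm is at most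
`2·2⁻ⁿ`. -/
theorem exists_compact_nest [CompleteSpace K] [TopologicalSpace X] {X0 : Set X}
    (hX0 : _root_.IsClosed X0) (h0 : Λ X0ᶜ = 0) (v : ℕ → X → ℝ) (hv : ∀ n, Continuous (v n))
    (hv0 : ∀ n x, 0 ≤ v n x) (hanti : ∀ n x, v (n + 1) x ≤ v n x)
    (x : ℕ → K) {c : ℝ} (hx : ∀ n, ‖x n‖ ≤ c) (hTx : ∀ n, T (x n) =ᵐ[Λ] v n)
    (hlim : Tendsto (fun n => T (x n)) atTop (𝓝 0))
    (hcomp : ∀ (N : ℕ → ℕ) (n : ℕ),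
      IsCompact (X0 ∩ {y | ∀ j ≥ n, v (N j) y ≤ 1 / ((j : ℝ) + 1)})) :
    ∃ C : ℕ → Set X, (ofHilbert T hT).IsNest C ∧ ∀ n, IsCompact (C n) := by
  have hmono : ∀ n, T (x (n + 1)) ≤ T (x n) := fun n => by
    rw [← Lp.coeFn_le]
    filter_upwards [hTx n, hTx (n + 1)] with y h1 h2
    rw [h1, h2]
    exact hanti n y
  have hex := fun j : ℕ => exists_norm_lt_of_antitone T x hx hmono hlim hT
    (show (0 : ℝ) < (1 / 2) ^ j / ((j : ℝ) + 1) by positivity)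
  choose N z hz hNz using hex
  let C : ℕ → Set X := fun n => X0 ∩ {y | ∀ j ≥ n, v (N j) y ≤ 1 / ((j : ℝ) + 1)}
  have hclosed : ∀ n, _root_.IsClosed (C n) := fun n => by
    refine hX0.inter ?_
    simp only [Set.ofPred_forall]
    exact isClosed_iInter fun j => isClosed_iInter fun _ =>
      isClosed_le (hv (N j)) continuous_const
  refine ⟨C, ⟨hclosed, ?_⟩, hcomp N⟩
  have hnorm : ∀ j : ℕ, ‖((j : ℝ) + 1) • z j‖ ≤ (1 / 2 : ℝ) ^ j := fun j => by
    rw [norm_smul, Real.norm_of_nonneg (by positivity)]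
    have := (hz j).le
    rw [le_div_iff₀ (by positivity)] at this
    linarith
  have hsum : ∀ n : ℕ, Summable fun j : ℕ => (((j + n : ℕ) : ℝ) + 1) • z (j + n) := fun n => by
    refine Summable.of_norm_bounded (g := fun j => (1 / 2 : ℝ) ^ (j + n)) ?_
      (fun j => hnorm (j + n))
    exact (summable_nat_add_iff n).2 summable_geometric_two
  have hznonneg : ∀ j, 0 ≤ T (z j) := fun j => by
    refine le_trans ?_ (hNz j)
    rw [← Lp.coeFn_nonneg]
    filter_upwards [hTx (N j)] with y h1
    rw [h1]
    exact hv0 _ y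
  let Z : ℕ → K := fun n => ∑' j : ℕ, (((j + n : ℕ) : ℝ) + 1) • z (j + n)
  have hZ : ∀ n j : ℕ, n ≤ j → ((j : ℝ) + 1) • T (z j) ≤ T (Z n) := fun n j hj => by
    obtain ⟨k, rfl⟩ := Nat.exists_eq_add_of_le' hj
    have h1 : T (Z n) = ∑' j : ℕ, (((j + n : ℕ) : ℝ) + 1) • T (z (j + n)) := by
      rw [T.map_tsum (hsum n)]
      simp only [map_smul]
    have h2 : Summable fun j : ℕ => (((j + n : ℕ) : ℝ) + 1) • T (z (j + n)) := by
      have := T.summable (hsum n)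
      simpa only [map_smul] using this
    rw [h1]
    -- One term is bounded by the sum because all `T (z j)` are nonnegative, as they dominate the
    -- nonnegative `v (N j)`.
    exact h2.le_tsum k fun i _ => smul_nonneg (by positivity) (hznonneg _)
  have hZnorm : ∀ n, ‖Z n‖ ≤ 2 * (1 / 2 : ℝ) ^ n := fun n => by
    refine tsum_of_norm_bounded ?_ (fun j => hnorm (j + n))
    have := (hasSum_geometric_two).mul_right ((1 / 2 : ℝ) ^ n)
    simpa only [← pow_add] using this
  have hle : ∀ n, (ofHilbert T hT).cap (C n)ᶜ ≤ ENNReal.ofReal ((2 * (1 / 2 : ℝ) ^ n) ^ 2) := by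
    intro n
    refine (cap_le_of_isOpen _ (hclosed n).isOpen_compl).trans
      ((capOpen_le T hT (Z n) ?_).trans ?_)
    · have hall : ∀ᵐ y ∂Λ, ∀ j, n ≤ j → ((j : ℝ) + 1) * v (N j) y ≤ T (Z n) y := by
        rw [ae_all_iff]
        intro j
        by_cases hj : n ≤ j
        · have h3 : ((j : ℝ) + 1) • T (x (N j)) ≤ T (Z n) :=
            (smul_le_smul_of_nonneg_left (hNz j) (by positivity)).trans (hZ n j hj)
          filter_upwards [(Lp.coeFn_le _ _).2 h3, hTx (N j),
            Lp.coeFn_smul ((j : ℝ) + 1) (T (x (N j)))] with y h4 h5 h6 _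
          rw [h6, Pi.smul_apply, h5, smul_eq_mul] at h4
          exact h4
        · exact Eventually.of_forall fun y h => absurd h hj
      filter_upwards [hall, measure_eq_zero_iff_ae_notMem.1 h0] with y h1 h2 h3
      have h4 : ∃ j, n ≤ j ∧ 1 / ((j : ℝ) + 1) < v (N j) y := by
        by_contra hcon
        push Not at hcon
        exact h3 ⟨not_not.1 h2, hcon⟩
      obtain ⟨j, hj, hjv⟩ := h4
      rw [div_lt_iff₀ (by positivity)] at hjv
      linarith [h1 j hj]
    · exact ENNReal.ofReal_le_ofReal (pow_le_pow_left₀ (norm_nonneg _) (hZnorm n) 2)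
  refine tendsto_of_tendsto_of_tendsto_of_le_of_le tendsto_const_nhds ?_ (fun _ => zero_le) hle
  rw [← ENNReal.ofReal_zero]
  refine ENNReal.tendsto_ofReal ?_
  have : Tendsto (fun n : ℕ => (2 * (1 / 2 : ℝ) ^ n) ^ 2) atTop (𝓝 ((2 * 0) ^ 2)) :=
    ((tendsto_pow_atTop_nhds_zero_of_lt_one (by norm_num) (by norm_num)).const_mul 2).pow 2
  simpa using this

end L2Form

end Forms

/-! ### From a pre-form to a quasi-regular Dirichlet form. -/

section Closure

variable {X : Type*} [MeasurableSpace X] {Λ : Measure X} {F : Type*} [AddCommGroup F] [Module ℝ F]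

theorem toLp_eq_iff {u : X → ℝ} (hu : MemLp u 2 Λ) (f : Lp ℝ 2 Λ) :
    f =ᵐ[Λ] u ↔ f = hu.toLp u := by
  constructor
  · intro h
    exact Lp.ext (h.trans hu.coeFn_toLp.symm)
  · rintro rfl
    exact hu.coeFn_toLp

theorem norm_toLp_sub_le {u v : X → ℝ} (hu : MemLp u 2 Λ) (hv : MemLp v 2 Λ) {ε : ℝ} (hε : 0 ≤ ε)
    (h : eLpNorm (u - v) 2 Λ ≤ ENNReal.ofReal ε) : ‖hu.toLp u - hv.toLp v‖ ≤ ε := by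
  rw [← MemLp.toLp_sub, Lp.norm_toLp]
  exact ENNReal.toReal_le_of_le_ofReal hε h

/-- The unit contraction `t ↦ 1 ∧ t⁺`. -/
noncomputable def clamp (t : ℝ) : ℝ := min 1 (max t 0)

/-- A criterion for a pre-form to have a closure which is a quasi-regular Dirichlet form. -/
theorem hasQuasiRegularClosure_of [TopologicalSpace X] [BorelSpace X] [IsFiniteMeasure Λ]
    (D : Submodule ℝ F) (ι : F → X → ℝ) (q : F → F → ℝ)
    (hι_add : ∀ u v, ι (u + v) = ι u + ι v) (hι_smul : ∀ (c : ℝ) u, ι (c • u) = c • ι u)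
    (hq_add : ∀ u ∈ D, ∀ v ∈ D, ∀ w ∈ D, q (u + v) w = q u w + q v w)
    (hq_smul : ∀ (c : ℝ), ∀ u ∈ D, ∀ v ∈ D, q (c • u) v = c * q u v)
    (hq_symm : ∀ u ∈ D, ∀ v ∈ D, q u v = q v u) (hq_nonneg : ∀ u ∈ D, 0 ≤ q u u)
    (hL2 : ∀ u ∈ D, MemLp (ι u) 2 Λ)
    (hclos : IsClosable Λ (D : Set F) ι q)
    (hdense : ∀ f : X → ℝ, MemLp f 2 Λ → ∀ ε : ℝ, 0 < ε →
      ∃ u ∈ D, eLpNorm (f - ι u) 2 Λ ≤ ENNReal.ofReal ε)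
    (hmarkov : ∀ u ∈ D, ∀ ε : ℝ, 0 < ε → ∃ w ∈ D, q w w ≤ q u u ∧
      ∀ᵐ x ∂Λ, |ι w x - clamp (ι u x)| ≤ ε)
    {X0 : Set X} (hX0 : _root_.IsClosed X0) (h0 : Λ X0ᶜ = 0)
    (hmeas : ∀ u ∈ D, Measurable (ι u)) (hcont : ∀ u ∈ D, ContinuousOn (ι u) X0)
    (hsep : ∃ u : ℕ → F, (∀ n, u n ∈ D) ∧
      ∀ y ∈ X0, ∀ z ∈ X0, y ≠ z → ∃ n, ι (u n) y ≠ ι (u n) z)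
    (v : ℕ → X → ℝ) (hv : ∀ n, Continuous (v n)) (hv0 : ∀ n x, 0 ≤ v n x)
    (hanti : ∀ n x, v (n + 1) x ≤ v n x) {c : ℝ} (hvc : ∀ n x, v n x ≤ c)
    (hvlim : ∀ᵐ x ∂Λ, Tendsto (fun n => v n x) atTop (𝓝 0)) {C : ℝ}
    (hvD : ∀ n, ∀ ε : ℝ, 0 < ε →
      ∃ u ∈ D, q u u ≤ C ∧ eLpNorm (ι u - v n) 2 Λ ≤ ENNReal.ofReal ε)
    (hcomp : ∀ (N : ℕ → ℕ) (n : ℕ),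
      IsCompact (X0 ∩ {y | ∀ j ≥ n, v (N j) y ≤ 1 / ((j : ℝ) + 1)})) :
    HasQuasiRegularClosure Λ (D : Set F) ι q := by
  refine ⟨hclos, ?_⟩
  let qD : D →ₗ[ℝ] D →ₗ[ℝ] ℝ := LinearMap.mk₂ ℝ (fun u v => q u v)
    (fun u v w => hq_add u u.2 v v.2 w w.2) (fun a u w => hq_smul a u u.2 w w.2)
    (fun u v w => by
      change q u (v + w : F) = _
      rw [hq_symm _ u.2 _ (D.add_mem v.2 w.2), hq_add v v.2 w w.2 u u.2, hq_symm _ u.2 _ v.2,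
        hq_symm _ u.2 _ w.2])
    (fun a u w => by
      change q u (a • w : F) = _
      rw [hq_symm _ u.2 _ (D.smul_mem a w.2), hq_smul a w w.2 u u.2, hq_symm _ u.2 _ w.2,
        smul_eq_mul])
  have hqD : ∀ u v : D, qD u v = q u v := fun u v => rfl
  let j : D →ₗ[ℝ] Lp ℝ 2 Λ :=
    { toFun := fun u => (hL2 u u.2).toLp (ι u)
      map_add' := fun u v => by
        rw [← MemLp.toLp_add]
        exact (MemLp.toLp_eq_toLp_iff _ _).2 (by rw [Submodule.coe_add, hι_add])
      map_smul' := fun a u => by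
        rw [RingHom.id_apply, ← MemLp.toLp_const_smul]
        exact (MemLp.toLp_eq_toLp_iff _ _).2 (by rw [Submodule.coe_smul, hι_smul]) }
  have hj : ∀ u : D, j u = (hL2 u u.2).toLp (ι u) := fun u => rfl
  have hjnorm : ∀ u : D, ‖j u‖ = (eLpNorm (ι u) 2 Λ).toReal :=
    fun u => Lp.norm_toLp _ (hL2 u u.2)
  have hjae : ∀ u : D, j u =ᵐ[Λ] ι u := fun u => (hL2 u u.2).coeFn_toLp
  obtain ⟨K, _, _, _, i, T, hi, hT, hTi, hinner⟩ := exists_hilbert_completion qD j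
    (fun u v => hq_symm u u.2 v v.2) (fun u => hq_nonneg u u.2) (fun u h1 h2 =>
      hclos (fun n => u n) (fun n => (u n).2) (by
        have h3 := (tendsto_iff_norm_sub_tendsto_zero.1 h1)
        simp only [sub_zero, hjnorm] at h3
        rwa [ENNReal.tendsto_toReal_zero_iff
          (fun n => (hL2 _ (u n).2).eLpNorm_ne_top)] at h3) h2)
  have hnorm : ∀ u : D, ‖i u‖ ^ 2 = q u u + ‖j u‖ ^ 2 := fun u => by
    rw [← real_inner_self_eq_norm_sq, hinner, real_inner_self_eq_norm_sq, hqD]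
  set E := L2Form.ofHilbert T hT with hE
  have hcoe : ∀ (u : D) (f : E.domain), ((f : Lp ℝ 2 Λ) =ᵐ[Λ] ι u) →
      f = L2Form.toDomain T hT (i u) := fun u f hf => by
    refine Subtype.ext ?_
    rw [L2Form.coe_toDomain, hTi, hj]
    exact (toLp_eq_iff _ _).1 hf
  have hcoe' : ∀ u : D, ((L2Form.toDomain T hT (i u) : E.domain) : Lp ℝ 2 Λ) =ᵐ[Λ] ι u :=
    fun u => by rw [L2Form.coe_toDomain, hTi]; exact hjae u
  have hsurj : ∀ f : E.domain, ∃ x, f = L2Form.toDomain T hT x :=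
    fun f => ⟨(L2Form.toDomain T hT).symm f, by simp⟩
  have hclosed : E.IsClosed := L2Form.ofHilbert_isClosed T hT
  have hdenseK : ∀ (x : K) (ε : ℝ), 0 < ε → ∃ u : D, ‖x - i u‖ ^ 2 < ε := fun x ε hε => by
    obtain ⟨u, hu⟩ := (Metric.denseRange_iff.1 hi) x (√ε) (Real.sqrt_pos.2 hε)
    refine ⟨u, ?_⟩
    rw [dist_eq_norm] at hu
    exact (Real.lt_sqrt (norm_nonneg _)).1 hu
  have hform1 : ∀ x y, E.form1 (L2Form.toDomain T hT x - L2Form.toDomain T hT y)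
      (L2Form.toDomain T hT x - L2Form.toDomain T hT y) = ‖x - y‖ ^ 2 := fun x y => by
    rw [← map_sub, L2Form.form1_toDomain, real_inner_self_eq_norm_sq]
  have hsymm : ∀ f g, E.form f g = E.form g f := fun f g => by
    obtain ⟨x, rfl⟩ := hsurj f
    obtain ⟨y, rfl⟩ := hsurj g
    rw [L2Form.form_toDomain, L2Form.form_toDomain, real_inner_comm, real_inner_comm (T y)]
  -- The inequality is closed in `x` and is nonnegativity of `q` on the dense image of `D`.
  have hqn : ∀ x : K, 0 ≤ ‖x‖ ^ 2 - ‖T x‖ ^ 2 := fun x => by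
    refine hi.induction_on x ?_ ?_
    · exact isClosed_le continuous_const (by fun_prop)
    · intro u
      rw [hnorm, hTi]
      linarith [hq_nonneg u u.2]
  refine ⟨E, ⟨hclosed, ?_, ?_, ?_⟩, ⟨?_, hsymm, ?_, ⟨1, one_pos, ?_⟩, hclosed, ?_⟩, ?_, ?_, ?_⟩
  · exact fun u hu => ⟨L2Form.toDomain T hT (i ⟨u, hu⟩), hcoe' ⟨u, hu⟩⟩
  · intro u hu w hw f g hf hg
    rw [hcoe ⟨u, hu⟩ f hf, hcoe ⟨w, hw⟩ g hg, L2Form.form_toDomain, hinner, hTi, hTi,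
      add_sub_cancel_right, hqD]
  · intro f ε hε
    obtain ⟨x, rfl⟩ := hsurj f
    obtain ⟨u, hu⟩ := hdenseK x ε hε
    exact ⟨u, u.2, L2Form.toDomain T hT (i u), hcoe' u, by rw [hform1]; exact hu⟩
  · rw [Metric.dense_iff]
    intro f r hr
    obtain ⟨u, hu, hfu⟩ := hdense f (Lp.memLp f) (r / 2) (half_pos hr)
    refine ⟨j ⟨u, hu⟩, ?_, ?_⟩
    · rw [mem_ball_iff_norm, norm_sub_rev]
      have := norm_toLp_sub_le (Lp.memLp f) (hL2 u hu) (half_pos hr).le hfu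
      rw [Lp.toLp_coeFn] at this
      exact this.trans_lt (half_lt_self hr)
    · exact (hTi ⟨u, hu⟩) ▸ (L2Form.toDomain T hT (i ⟨u, hu⟩)).2
  · intro f
    obtain ⟨x, rfl⟩ := hsurj f
    rw [L2Form.form_toDomain, real_inner_self_eq_norm_sq, real_inner_self_eq_norm_sq]
    exact hqn x
  · intro f g
    obtain ⟨x, rfl⟩ := hsurj f
    obtain ⟨y, rfl⟩ := hsurj g
    rw [L2Form.form1_toDomain, L2Form.form1_toDomain, L2Form.form1_toDomain, one_mul,
      real_inner_self_eq_norm_sq, real_inner_self_eq_norm_sq, ← mul_pow,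
      Real.sqrt_sq (by positivity)]
    exact abs_real_inner_le_norm x y
  · intro f
    obtain ⟨x, rfl⟩ := hsurj f
    obtain ⟨y, hy, hyx⟩ := mem_closure_iff_seq_limit.1 (hi x)
    choose u hu using hy
    have hux : Tendsto (fun n => i (u n)) atTop (𝓝 x) := by simpa only [hu] using hyx
    have hjx : Tendsto (fun n => j (u n)) atTop (𝓝 (T x)) := by
      simpa only [Function.comp_def, hTi] using (T.continuous.tendsto x).comp hux
    -- The approximate contractions `w n` of `u n → x` converge in `L²` to the contraction of `T x`,
    -- and their energies are at most those of `u n`. A weak limit in `K` therefore represents the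
    -- contraction with no more energy than `x`.
    have hw := fun n : ℕ => hmarkov (u n) (u n).2 (1 / ((n : ℝ) + 1)) (by positivity)
    choose w hwD hwq hwc using hw
    let one : Lp ℝ 2 Λ := (memLp_const (1 : ℝ)).toLp _
    have hone : one =ᵐ[Λ] fun _ => 1 := (memLp_const (1 : ℝ)).coeFn_toLp
    let cl : Lp ℝ 2 Λ → Lp ℝ 2 Λ := fun f => one ⊓ (f ⊔ 0)
    have hcl : ∀ f : Lp ℝ 2 Λ, cl f =ᵐ[Λ] fun x => clamp (f x) := fun f => by
      filter_upwards [Lp.coeFn_inf one (f ⊔ 0), Lp.coeFn_sup f 0, hone,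
        Lp.coeFn_zero ℝ 2 Λ] with x h1 h2 h3 h4
      rw [h1, Pi.inf_apply, h2, Pi.sup_apply, h3, h4]
      rfl
    have hclc : Continuous cl := continuous_const.inf (continuous_id.sup continuous_const)
    have h1 : Tendsto (fun n => T (i ⟨w n, hwD n⟩)) atTop (𝓝 (cl (T x))) := by
      have h2 : Tendsto (fun n => cl (j (u n))) atTop (𝓝 (cl (T x))) :=
        (hclc.tendsto _).comp hjx
      refine tendsto_of_tendsto_of_dist h2 ?_
      have h3 : Tendsto (fun n : ℕ => (measureUnivNNReal Λ : ℝ) ^ (2 : ℝ≥0∞).toReal⁻¹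
          * (1 / ((n : ℝ) + 1))) atTop (𝓝 0) := by
        simpa using (tendsto_one_div_add_atTop_nhds_zero_nat (𝕜 := ℝ)).const_mul
          ((measureUnivNNReal Λ : ℝ) ^ (2 : ℝ≥0∞).toReal⁻¹)
      refine squeeze_zero (fun _ => dist_nonneg) (fun n => ?_) h3
      rw [dist_comm, dist_eq_norm, hTi]
      refine Lp.norm_le_of_ae_bound (by positivity) ?_
      filter_upwards [Lp.coeFn_sub (j ⟨w n, hwD n⟩) (cl (j (u n))), hjae ⟨w n, hwD n⟩,
        hcl (j (u n)), hjae (u n), hwc n] with y e1 e2 e3 e4 e5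
      rw [e1, Pi.sub_apply, e2, e3, e4, Real.norm_eq_abs]
      exact e5
    have h2 : Tendsto (fun n => √(q (u n) (u n) + ‖j ⟨w n, hwD n⟩‖ ^ 2)) atTop
        (𝓝 √(‖x‖ ^ 2 - ‖T x‖ ^ 2 + ‖cl (T x)‖ ^ 2)) := by
      refine (Real.continuous_sqrt.tendsto _).comp (Tendsto.add ?_ ?_)
      · have := (hux.norm.pow 2).sub (hjx.norm.pow 2)
        simpa only [hnorm, add_sub_cancel_right] using this
      · simpa only [hTi] using h1.norm.pow 2
    obtain ⟨y, hy, hyn⟩ := exists_norm_le_of_tendsto_map T (fun n => i ⟨w n, hwD n⟩) (fun n => by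
      refine Real.le_sqrt_of_sq_le ?_
      rw [hnorm]
      exact add_le_add (hwq n) le_rfl) h2 h1
    have hle : E.form (L2Form.toDomain T hT y) (L2Form.toDomain T hT y)
        ≤ E.form (L2Form.toDomain T hT x) (L2Form.toDomain T hT x) := by
      rw [L2Form.form_toDomain, L2Form.form_toDomain, real_inner_self_eq_norm_sq,
        real_inner_self_eq_norm_sq, real_inner_self_eq_norm_sq, real_inner_self_eq_norm_sq, hy]
      have h3 := pow_le_pow_left₀ (norm_nonneg _) hyn 2
      rw [Real.sq_sqrt (add_nonneg (hqn x) (sq_nonneg _))] at h3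
      linarith
    refine ⟨L2Form.toDomain T hT y, ?_, ?_, ?_⟩
    · rw [L2Form.coe_toDomain, L2Form.coe_toDomain, hy]
      exact hcl _
    -- By symmetry `E(x + y, x - y) = E(x, x) - E(y, y)`, so the Markov inequality is just the
    -- decrease of energy.
    · have h4 := hsymm (L2Form.toDomain T hT x) (L2Form.toDomain T hT y)
      simp only [map_add, map_sub, LinearMap.add_apply]
      linarith
    · have h4 := hsymm (L2Form.toDomain T hT x) (L2Form.toDomain T hT y)
      simp only [map_add, map_sub, LinearMap.sub_apply]
      linarith
  · have hvL : ∀ n, MemLp (v n) 2 Λ := fun n =>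
      MemLp.of_bound (hv n).measurable.aestronglyMeasurable c (Eventually.of_forall fun x => by
        rw [Real.norm_of_nonneg (hv0 n x)]; exact hvc n x)
    have hvto : Tendsto (fun n => (hvL n).toLp (v n)) atTop (𝓝 0) := by
      rw [tendsto_iff_norm_sub_tendsto_zero]
      simp only [sub_zero, Lp.norm_toLp]
      rw [ENNReal.tendsto_toReal_zero_iff (fun n => (hvL n).eLpNorm_ne_top)]
      exact tendsto_eLpNorm_two_of_bounded (fun n => (hvL n).aestronglyMeasurable)
        (fun n => Eventually.of_forall fun x => by
          rw [abs_of_nonneg (hv0 n x)]; exact hvc n x) hvlim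
    obtain ⟨b, hb⟩ := hvto.norm.bddAbove_range
    have hb' : ∀ n, ‖(hvL n).toLp (v n)‖ ≤ b := fun n => hb ⟨n, rfl⟩
    -- Each `v n` is an `L²` limit of elements with `q ≤ C`. Weak compactness puts it in the domain
    -- with a norm bound independent of `n`, as Mazur's lemma requires.
    have hex : ∀ n, ∃ x : K, T x = (hvL n).toLp (v n) ∧ ‖x‖ ≤ √(C + (b + 1) ^ 2) := fun n => by
      have hu := fun k : ℕ => hvD n (1 / ((k : ℝ) + 1)) (by positivity)
      choose u huD huq hu using hu
      have h1 : ∀ k, ‖j ⟨u k, huD k⟩ - (hvL n).toLp (v n)‖ ≤ 1 / ((k : ℝ) + 1) := fun k =>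
        norm_toLp_sub_le (hL2 _ (huD k)) (hvL n) (by positivity) (hu k)
      refine exists_norm_le_of_tendsto_map T (fun k => i ⟨u k, huD k⟩)
        (b := fun _ => √(C + (b + 1) ^ 2)) (fun k => ?_) tendsto_const_nhds ?_
      · refine Real.le_sqrt_of_sq_le ?_
        rw [hnorm]
        refine add_le_add (huq k) (pow_le_pow_left₀ (norm_nonneg _) ?_ 2)
        have h2 : 1 / ((k : ℝ) + 1) ≤ 1 := by
          rw [div_le_one (by positivity)]
          linarith [(Nat.cast_nonneg k : (0 : ℝ) ≤ k)]
        have h3 := norm_le_norm_add_norm_sub' (j ⟨u k, huD k⟩) ((hvL n).toLp (v n))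
        linarith [h1 k, hb' n]
      · rw [tendsto_iff_norm_sub_tendsto_zero]
        simp only [hTi]
        exact squeeze_zero (fun _ => norm_nonneg _) h1 tendsto_one_div_add_atTop_nhds_zero_nat
    choose x hxT hxn using hex
    refine L2Form.exists_compact_nest T hT hX0 h0 v hv hv0 hanti x hxn (fun n => ?_) ?_ hcomp
    · rw [hxT]
      exact (hvL n).coeFn_toLp
    · simpa only [hxT] using hvto
  · refine ⟨LinearMap.range ((L2Form.toDomain T hT).toLinearMap ∘ₗ i), ?_, ?_⟩
    · rintro _ ⟨u, rfl⟩
      exact ⟨ι u, L2Form.isQuasiContinuous_of_continuousOn T hT hX0 h0 (hmeas u u.2)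
        (hcont u u.2), hcoe' u⟩
    · intro f ε hε
      obtain ⟨x, rfl⟩ := hsurj f
      obtain ⟨u, hu⟩ := hdenseK x ε hε
      exact ⟨L2Form.toDomain T hT (i u), ⟨u, rfl⟩, by rw [hform1]; exact hu⟩
  · obtain ⟨u, huD, hu⟩ := hsep
    refine ⟨X0ᶜ, fun n => ι (u n), L2Form.cap_eq_zero_of_isOpen T hT hX0.isOpen_compl h0,
      fun n => ⟨L2Form.isQuasiContinuous_of_continuousOn T hT hX0 h0 (hmeas _ (huD n))
        (hcont _ (huD n)), L2Form.toDomain T hT (i ⟨u n, huD n⟩), hcoe' ⟨u n, huD n⟩⟩, ?_⟩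
    intro y hy z hz hyz
    exact hu y (not_not.1 hy) z (not_not.1 hz) hyz

end Closure

/-! ### Calculus of derivatives along paths, common to both kinds of extrinsic derivative. -/

section Paths

variable {Y N R : Type*} [TopologicalSpace Y] [TopologicalSpace N]

/-- `u` is a bounded continuous function which has the bounded and jointly continuous directional
derivative `D` along the paths `ε ↦ path y x ε`, as the parameter `c ε` tends to zero. -/
structure HasPathDeriv (l : Filter R) (c : R → ℝ) (path : Y → N → R → Y) (u : Y → ℝ)
    (D : Y → N → ℝ) : Prop where
  cont : Continuous u
  quot : ∀ y x, Tendsto (fun ε => (u (path y x ε) - u y) / c ε) l (𝓝 (D y x))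
  contD : Continuous fun p : Y × N => D p.1 p.2
  bdd : ∃ C : ℝ, ∀ y x, |u y| + |D y x| ≤ C

namespace HasPathDeriv

variable {l : Filter R} {c : R → ℝ} {path : Y → N → R → Y} {u v : Y → ℝ} {D D' : Y → N → ℝ}

theorem bddD (h : HasPathDeriv l c path u D) : ∃ C : ℝ, ∀ y x, |D y x| ≤ C := by
  obtain ⟨C, hC⟩ := h.bdd
  exact ⟨C, fun y x => (le_add_of_nonneg_left (abs_nonneg _)).trans (hC y x)⟩

theorem bddu [Nonempty N] (h : HasPathDeriv l c path u D) : ∃ C : ℝ, ∀ y, |u y| ≤ C := by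
  obtain ⟨C, hC⟩ := h.bdd
  exact ⟨C, fun y => (le_add_of_nonneg_right (abs_nonneg _)).trans (hC y (Classical.arbitrary N))⟩

/-- The convergent difference quotient is multiplied by `c ε → 0`. Continuity of the path itself is
not needed. -/
theorem tendsto_path (hc : Tendsto c l (𝓝[≠] 0)) (h : HasPathDeriv l c path u D) (y : Y) (x : N) :
    Tendsto (fun ε => u (path y x ε)) l (𝓝 (u y)) := by
  have h1 := ((h.quot y x).mul (hc.mono_right nhdsWithin_le_nhds)).add_const (u y)
  rw [mul_zero, zero_add] at h1
  refine h1.congr' ?_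
  filter_upwards [hc.eventually eventually_mem_nhdsWithin] with ε hε
  rw [div_mul_cancel₀ _ hε, sub_add_cancel]

theorem const (a : ℝ) : HasPathDeriv l c path (fun _ => a) fun _ _ => 0 where
  cont := continuous_const
  quot := fun y x => by simpa using tendsto_const_nhds
  contD := continuous_const
  bdd := ⟨|a|, by simp⟩

theorem add (h : HasPathDeriv l c path u D) (h' : HasPathDeriv l c path v D') :
    HasPathDeriv l c path (fun y => u y + v y) fun y x => D y x + D' y x where
  cont := h.cont.add h'.cont
  quot := fun y x => by
    refine ((h.quot y x).add (h'.quot y x)).congr fun ε => ?_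
    ring
  contD := h.contD.add h'.contD
  bdd := by
    obtain ⟨C, hC⟩ := h.bdd
    obtain ⟨C', hC'⟩ := h'.bdd
    refine ⟨C + C', fun y x => ?_⟩
    linarith [hC y x, hC' y x, abs_add_le (u y) (v y), abs_add_le (D y x) (D' y x)]

theorem mul (hc : Tendsto c l (𝓝[≠] 0)) (h : HasPathDeriv l c path u D)
    (h' : HasPathDeriv l c path v D') :
    HasPathDeriv l c path (fun y => u y * v y) fun y x => D y x * v y + u y * D' y x where
  cont := h.cont.mul h'.cont
  quot := fun y x => by
    refine (((h.quot y x).mul (h'.tendsto_path hc y x)).add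
      ((h'.quot y x).const_mul (u y))).congr fun ε => ?_
    ring
  contD := (h.contD.mul (h'.cont.comp continuous_fst)).add
    ((h.cont.comp continuous_fst).mul h'.contD)
  bdd := by
    obtain ⟨C, hC⟩ := h.bdd
    obtain ⟨C', hC'⟩ := h'.bdd
    refine ⟨C * C', fun y x => ?_⟩
    have h1 := mul_le_mul (hC y x) (hC' y x) (by positivity)
      ((by positivity : 0 ≤ |u y| + |D y x|).trans (hC y x))
    have h2 := abs_add_le (D y x * v y) (u y * D' y x)
    rw [abs_mul, abs_mul] at h2
    rw [abs_mul]
    nlinarith [mul_nonneg (abs_nonneg (D y x)) (abs_nonneg (D' y x))]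

theorem smul (a : ℝ) (h : HasPathDeriv l c path u D) :
    HasPathDeriv l c path (fun y => a * u y) fun y x => a * D y x where
  cont := h.cont.const_mul a
  quot := fun y x => by
    refine ((h.quot y x).const_mul a).congr fun ε => ?_
    ring
  contD := h.contD.const_mul a
  bdd := by
    obtain ⟨C, hC⟩ := h.bdd
    refine ⟨|a| * C, fun y x => ?_⟩
    rw [abs_mul, abs_mul, ← mul_add]
    exact mul_le_mul_of_nonneg_left (hC y x) (abs_nonneg a)

/-- The chain rule. -/
theorem comp (hc : Tendsto c l (𝓝[≠] 0)) (h : HasPathDeriv l c path u D) {φ : ℝ → ℝ}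
    (hφ : ContDiff ℝ 1 φ) :
    HasPathDeriv l c path (fun y => φ (u y)) fun y x => deriv φ (u y) * D y x where
  cont := hφ.continuous.comp h.cont
  quot := fun y x => by
    have hd : HasDerivAt φ (deriv φ (u y)) (u y) :=
      (hφ.differentiable (by norm_num) (u y)).hasDerivAt
    -- `dslope` extends the difference quotient of `φ` by the derivative, so parameters at which `u`
    -- does not move cause no division by zero.
    have h1 := (continuousAt_dslope_same.2 hd.differentiableAt).tendsto.comp
      (h.tendsto_path hc y x)
    rw [dslope_same] at h1
    refine (h1.mul (h.quot y x)).congr fun ε => ?_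
    have h2 := sub_smul_dslope φ (u y) (u (path y x ε))
    rw [smul_eq_mul] at h2
    rw [← h2, Function.comp_apply]
    ring
  contD := (((hφ.continuous_deriv le_rfl).comp h.cont).comp continuous_fst).mul h.contD
  bdd := by
    obtain ⟨C, hC⟩ := h.bdd
    -- Only the values of `φ` and its derivative on the compact range of `u` matter, so `φ` need not
    -- be bounded globally.
    obtain ⟨B, hB⟩ := (isCompact_Icc (a := -C) (b := C)).exists_bound_of_continuousOn
      hφ.continuous.continuousOn
    obtain ⟨B', hB'⟩ := (isCompact_Icc (a := -C) (b := C)).exists_bound_of_continuousOn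
      (hφ.continuous_deriv le_rfl).continuousOn
    refine ⟨B + B' * C, fun y x => ?_⟩
    have h1 := hC y x
    have hu : u y ∈ Set.Icc (-C) C := abs_le.1 (by linarith [abs_nonneg (D y x)])
    have h2 := hB _ hu
    have h3 := hB' _ hu
    rw [Real.norm_eq_abs] at h2 h3
    rw [abs_mul]
    have h4 : |D y x| ≤ C := by linarith [abs_nonneg (u y)]
    exact add_le_add h2 (mul_le_mul h3 h4 (abs_nonneg _) ((abs_nonneg _).trans h3))

end HasPathDeriv

theorem tendsto_quot_of_hasDerivAt {l : Filter R} {c : R → ℝ} (hc : Tendsto c l (𝓝[≠] 0))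
    {g : ℝ → ℝ} {d : ℝ} (hg : HasDerivAt g d 0) {w : R → ℝ} {w0 : ℝ}
    (hw : ∀ᶠ ε in l, w ε = g (c ε)) (hw0 : w0 = g 0) :
    Tendsto (fun ε => (w ε - w0) / c ε) l (𝓝 d) := by
  have h1 := (hasDerivAt_iff_tendsto_slope_zero.1 hg).comp hc
  refine h1.congr' ?_
  filter_upwards [hw] with ε hε
  rw [hε, hw0, Function.comp_apply, zero_add, smul_eq_mul]
  ring

end Paths

/-! ### The function classes of the theorem in terms of path derivatives. -/

section Classes

variable {M : Type*} [MeasurableSpace M] [TopologicalSpace M] [OpensMeasurableSpace M]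

/-- `D` is the extrinsic derivative of `u`. -/
abbrev HasExtrinsicDeriv (u : FiniteMeasure M → ℝ) (D : FiniteMeasure M → M → ℝ) : Prop :=
  HasPathDeriv (𝓝[>] (0 : ℝ≥0)) (fun ε => (ε : ℝ)) (fun μ x ε => μ + ε • diracFinite x) u D

/-- `D` is the convexity extrinsic derivative of `u`. -/
abbrev HasConvExtrinsicDeriv (u : ProbabilityMeasure M → ℝ) (D : ProbabilityMeasure M → M → ℝ) :
    Prop :=
  HasPathDeriv (𝓝[>] (0 : unitInterval)) (fun ε => (ε : ℝ)) mixDirac u D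

theorem tendsto_coe_nnreal : Tendsto (fun ε : ℝ≥0 => (ε : ℝ)) (𝓝[>] 0) (𝓝[≠] 0) := by
  refine tendsto_nhdsWithin_iff.2 ⟨?_, ?_⟩
  · exact (NNReal.continuous_coe.tendsto' 0 0 rfl).mono_left nhdsWithin_le_nhds
  · filter_upwards [self_mem_nhdsWithin] with ε hε
    simpa using (ne_of_gt hε)

theorem tendsto_coe_unitInterval :
    Tendsto (fun ε : unitInterval => (ε : ℝ)) (𝓝[>] 0) (𝓝[≠] 0) := by
  refine tendsto_nhdsWithin_iff.2 ⟨?_, ?_⟩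
  · exact (continuous_subtype_val.tendsto' (0 : unitInterval) 0 rfl).mono_left nhdsWithin_le_nhds
  · filter_upwards [self_mem_nhdsWithin] with ε hε
    have hε' : 0 < ε := hε
    exact fun h => hε'.ne' (Subtype.ext h)

/-- Limits as `ε ↓ 0` in the unit interval are then unique, which identifies `convExtrinsicDeriv`.
-/
instance : (𝓝[>] (0 : unitInterval)).NeBot :=
  nhdsGT_neBot_of_exists_gt ⟨1, zero_lt_one⟩

theorem HasPathDeriv.extrinsicDeriv_eq {u : FiniteMeasure M → ℝ} {D : FiniteMeasure M → M → ℝ}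
    (h : HasExtrinsicDeriv u D) : extrinsicDeriv u = D :=
  funext₂ fun μ x => (h.quot μ x).limUnder_eq

theorem HasPathDeriv.convExtrinsicDeriv_eq {u : ProbabilityMeasure M → ℝ}
    {D : ProbabilityMeasure M → M → ℝ} (h : HasConvExtrinsicDeriv u D) :
    convExtrinsicDeriv u = D :=
  funext₂ fun μ x => (h.quot μ x).limUnder_eq

theorem HasPathDeriv.mem_CE1b {u : FiniteMeasure M → ℝ} {D : FiniteMeasure M → M → ℝ}
    (h : HasExtrinsicDeriv u D) : u ∈ CE1b M :=
  ⟨h.cont, fun μ x => ⟨_, h.quot μ x⟩, by rw [h.extrinsicDeriv_eq]; exact h.contD,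
    by rw [h.extrinsicDeriv_eq]; exact h.bdd⟩

theorem HasPathDeriv.mem_PCE1b {u : ProbabilityMeasure M → ℝ} {D : ProbabilityMeasure M → M → ℝ}
    (h : HasConvExtrinsicDeriv u D) : u ∈ PCE1b M :=
  ⟨h.cont, fun μ x => ⟨_, h.quot μ x⟩, by rw [h.convExtrinsicDeriv_eq]; exact h.contD,
    by rw [h.convExtrinsicDeriv_eq]; exact h.bdd⟩

theorem hasExtrinsicDeriv_of_mem {u : FiniteMeasure M → ℝ} (h : u ∈ CE1b M) :
    HasExtrinsicDeriv u (extrinsicDeriv u) :=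
  ⟨h.1, fun μ x => tendsto_nhds_limUnder (h.2.1 μ x), h.2.2.1, h.2.2.2⟩

theorem hasConvExtrinsicDeriv_of_mem {u : ProbabilityMeasure M → ℝ} (h : u ∈ PCE1b M) :
    HasConvExtrinsicDeriv u (convExtrinsicDeriv u) :=
  ⟨h.1, fun μ x => tendsto_nhds_limUnder (h.2.1 μ x), h.2.2.1, h.2.2.2⟩

end Classes

/-! ### The fundamental theorem of calculus along arbitrary finite measures. -/

section Fundamental

variable {M : Type*} [MeasurableSpace M] [TopologicalSpace M] [OpensMeasurableSpace M]

/-- The one-sided derivative of `U` in the direction of the measure `ν` is `∫ D(μ) dν`. -/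
def HasDirectionalDeriv (U : FiniteMeasure M → ℝ) (D : FiniteMeasure M → M → ℝ)
    (ν : FiniteMeasure M) : Prop :=
  ∀ μ : FiniteMeasure M, Tendsto (fun s : ℝ => (U (μ + s.toNNReal • ν) - U μ) / s) (𝓝[>] 0)
    (𝓝 (∫ x, D μ x ∂(ν : Measure M)))

theorem continuous_ray (μ ν : FiniteMeasure M) : Continuous fun s : ℝ => μ + s.toNNReal • ν :=
  continuous_const.add (continuous_real_toNNReal.smul continuous_const)

namespace HasPathDeriv

variable {U : FiniteMeasure M → ℝ} {D : FiniteMeasure M → M → ℝ}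

theorem continuous_left (h : HasExtrinsicDeriv U D) (x : M) : Continuous fun μ => D μ x :=
  h.contD.comp (continuous_id.prodMk continuous_const)

theorem continuous_right (h : HasExtrinsicDeriv U D) (μ : FiniteMeasure M) : Continuous (D μ) :=
  h.contD.comp (continuous_const.prodMk continuous_id)

theorem integrable (h : HasExtrinsicDeriv U D) (μ : FiniteMeasure M) (ν : Measure M)
    [IsFiniteMeasure ν] : Integrable (D μ) ν := by
  obtain ⟨C, hC⟩ := h.bddD
  exact Integrable.of_bound (h.continuous_right μ).measurable.aestronglyMeasurable C
    (Eventually.of_forall (hC μ))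

theorem continuous_integral {Z : Type*} [TopologicalSpace Z] [FirstCountableTopology Z]
    (h : HasExtrinsicDeriv U D) {m : Z → FiniteMeasure M} (hm : Continuous m) (ν : Measure M)
    [IsFiniteMeasure ν] : Continuous fun z => ∫ x, D (m z) x ∂ν := by
  obtain ⟨C, hC⟩ := h.bddD
  exact continuous_of_dominated (bound := fun _ => C)
    (fun z => (h.continuous_right _).measurable.aestronglyMeasurable)
    (fun z => Eventually.of_forall (hC _)) (integrable_const _)
    (Eventually.of_forall fun x => (h.continuous_left x).comp hm)

/-- The directional derivative at each point of the ray `μ + sν` is a right derivative of `s ↦ U(μ +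
sν)`. It is continuous in `s`, and continuous right derivatives can be integrated. -/
theorem sub_eq_integral_of_hasDirectionalDeriv (h : HasExtrinsicDeriv U D) {ν : FiniteMeasure M}
    (hν : HasDirectionalDeriv U D ν) (μ : FiniteMeasure M) {s : ℝ} (hs : 0 ≤ s) :
    U (μ + s.toNNReal • ν) - U μ =
      ∫ r in 0..s, ∫ x, D (μ + r.toNNReal • ν) x ∂(ν : Measure M) := by
  have hk := h.continuous_integral (continuous_ray μ ν) (ν : Measure M)
  have h1 := intervalIntegral.integral_eq_sub_of_hasDeriv_right (a := 0) (b := s)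
    (f := fun r : ℝ => U (μ + r.toNNReal • ν))
    (f' := fun r : ℝ => ∫ x, D (μ + r.toNNReal • ν) x ∂(ν : Measure M))
    (h.cont.comp (continuous_ray μ ν)).continuousOn ?_ (hk.intervalIntegrable _ _)
  · rw [h1]
    simp
  · intro r hr
    rw [min_eq_left hs] at hr
    rw [hasDerivWithinAt_iff_tendsto_slope' (by simp)]
    have h2 : Tendsto (fun t : ℝ => t - r) (𝓝[>] r) (𝓝[>] 0) := by
      refine tendsto_nhdsWithin_iff.2 ⟨?_, ?_⟩
      · refine ((continuous_id.sub continuous_const).tendsto' r 0 ?_).mono_left nhdsWithin_le_nhds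
        simp
      · filter_upwards [self_mem_nhdsWithin] with t ht
        simpa using ht
    refine ((hν (μ + r.toNNReal • ν)).comp h2).congr' ?_
    filter_upwards [self_mem_nhdsWithin] with t ht
    have ht' : r < t := ht
    rw [slope_def_field, Function.comp_apply, add_assoc, ← add_smul,
      ← Real.toNNReal_add hr.1.le (sub_nonneg.2 ht'.le), add_sub_cancel]

theorem hasDirectionalDeriv_dirac (h : HasExtrinsicDeriv U D) (c : ℝ≥0) (x : M) :
    HasDirectionalDeriv U D (c • diracFinite x) := by
  intro μ
  have hint : ∫ y, D μ y ∂((c • diracFinite x : FiniteMeasure M) : Measure M) = c * D μ x := by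
    change ∫ y, D μ y ∂(c • Measure.dirac x) = _
    rw [integral_smul_nnreal_measure, integral_dirac' _ _
      (h.continuous_right μ).measurable.stronglyMeasurable]
    rfl
  rw [hint]
  rcases eq_or_ne c 0 with rfl | hc
  · simp
  · have hc0 : 0 < c := pos_iff_ne_zero.2 hc
    have h1 : Tendsto (fun s : ℝ => s.toNNReal * c) (𝓝[>] 0) (𝓝[>] 0) := by
      refine tendsto_nhdsWithin_iff.2 ⟨?_, ?_⟩
      · refine ((continuous_real_toNNReal.mul continuous_const).tendsto' 0 0 ?_).mono_left
          nhdsWithin_le_nhds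
        simp
      · filter_upwards [self_mem_nhdsWithin] with t ht
        exact mul_pos (Real.toNNReal_pos.2 ht) hc0
    refine (((h.quot μ x).comp h1).const_mul (c : ℝ)).congr' ?_
    filter_upwards [self_mem_nhdsWithin] with t ht
    have ht' : 0 < t := ht
    have hc' : (c : ℝ) ≠ 0 := by exact_mod_cast hc
    rw [Function.comp_apply, smul_smul]
    push_cast
    rw [Real.coe_toNNReal _ ht'.le]
    field_simp

/-- The increment is split into a step along `ν₁` and a step along `ν₂` from `μ + sν₁`. By the
integral formula the quotient of the second step is the average over `t ∈ [0,1]` of `∫ D(μ + sν₁ +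
stν₂) dν₂`, which tends to `∫ D(μ) dν₂` by joint continuity. -/
theorem hasDirectionalDeriv_add (h : HasExtrinsicDeriv U D) {ν₁ ν₂ : FiniteMeasure M}
    (h₁ : HasDirectionalDeriv U D ν₁) (h₂ : HasDirectionalDeriv U D ν₂) :
    HasDirectionalDeriv U D (ν₁ + ν₂) := by
  intro μ
  rw [FiniteMeasure.toMeasure_add, integral_add_measure (h.integrable _ _) (h.integrable _ _)]
  let k : ℝ → ℝ → ℝ := fun s t =>
    ∫ x, D (μ + s.toNNReal • ν₁ + (s * t).toNNReal • ν₂) x ∂(ν₂ : Measure M)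
  have hk : Continuous (Function.uncurry k) := by
    refine h.continuous_integral (Z := ℝ × ℝ)
      (m := fun p => μ + p.1.toNNReal • ν₁ + (p.1 * p.2).toNNReal • ν₂) ?_ _
    exact (continuous_const.add ((continuous_real_toNNReal.comp continuous_fst).smul
      continuous_const)).add ((continuous_real_toNNReal.comp
        (continuous_fst.mul continuous_snd)).smul continuous_const)
  have h3 := intervalIntegral.continuous_parametric_intervalIntegral_of_continuous'
    (μ := volume) hk 0 1
  have h4 : Tendsto (fun s : ℝ => ∫ t in (0 : ℝ)..1, k s t) (𝓝[>] 0)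
      (𝓝 (∫ x, D μ x ∂(ν₂ : Measure M))) := by
    refine (h3.tendsto' 0 _ ?_).mono_left nhdsWithin_le_nhds
    simp [k]
  refine ((h₁ μ).add h4).congr' ?_
  filter_upwards [self_mem_nhdsWithin] with s hs
  have hs' : 0 < s := hs
  have h5 := h.sub_eq_integral_of_hasDirectionalDeriv h₂ (μ + s.toNNReal • ν₁) hs'.le
  have h6 := intervalIntegral.mul_integral_comp_mul_left (a := 0) (b := 1)
    (f := fun r : ℝ => ∫ x, D (μ + s.toNNReal • ν₁ + r.toNNReal • ν₂) x ∂(ν₂ : Measure M)) s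
  rw [mul_zero, mul_one] at h6
  rw [← h6] at h5
  rw [smul_add, ← add_assoc]
  change _ = (U (μ + s.toNNReal • ν₁ + s.toNNReal • ν₂) - U μ) / s
  have h7 : ∫ t in (0 : ℝ)..1, k s t =
      (U (μ + s.toNNReal • ν₁ + s.toNNReal • ν₂) - U (μ + s.toNNReal • ν₁)) / s := by
    rw [h5, mul_div_cancel_left₀ _ hs'.ne']
  rw [h7]
  ring

theorem hasDirectionalDeriv_sum (h : HasExtrinsicDeriv U D) {ι : Type*} (S : Finset ι) (c : ι → ℝ≥0)
    (y : ι → M) : HasDirectionalDeriv U D (∑ i ∈ S, c i • diracFinite (y i)) := by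
  refine Finset.sum_induction _ (HasDirectionalDeriv U D)
    (fun _ _ h₁ h₂ => h.hasDirectionalDeriv_add h₁ h₂) ?_
    fun i _ => h.hasDirectionalDeriv_dirac (c i) (y i)
  intro μ
  simp

/-- Pushing forward by simple functions turns a finite measure into a finite combination of Dirac
measures, the directions accessible from the definition. -/
theorem _root_.ExtrinsicForm.map_simpleFunc_eq_sum (ν : FiniteMeasure M) (φ : SimpleFunc M M) :
    ν.map φ = ∑ y ∈ φ.range, ν (φ ⁻¹' {y}) • diracFinite y := by
  classical
  refine FiniteMeasure.toMeasure_injective (Measure.ext fun A hA => ?_)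
  rw [FiniteMeasure.toMeasure_map, Measure.map_apply φ.measurable hA,
    FiniteMeasure.toMeasure_sum, Measure.finsetSum_apply]
  have h1 : φ ⁻¹' A = ⋃ y ∈ φ.range.filter (· ∈ A), φ ⁻¹' {y} := by
    ext x
    simp
  have h2 : (ν : Measure M) (φ ⁻¹' A)
      = ∑ y ∈ φ.range.filter (· ∈ A), (ν : Measure M) (φ ⁻¹' {y}) := by
    rw [h1, measure_biUnion_finset]
    · intro y _ z _ hyz
      exact Disjoint.preimage _ (Set.disjoint_singleton.2 hyz)
    · exact fun y _ => φ.measurableSet_preimage _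
  rw [h2, Finset.sum_filter]
  refine Finset.sum_congr rfl fun y _ => ?_
  rw [FiniteMeasure.toMeasure_smul]
  change _ = (ν (φ ⁻¹' {y}) • Measure.dirac y) A
  rw [Measure.smul_apply, Measure.dirac_apply' _ hA]
  by_cases hy : y ∈ A
  · rw [if_pos hy, Set.indicator_of_mem hy, Pi.one_apply, ENNReal.smul_def, smul_eq_mul, mul_one,
      FiniteMeasure.ennreal_coeFn_eq_coeFn_toMeasure]
  · rw [if_neg hy, Set.indicator_of_notMem hy, smul_zero]

variable [TopologicalSpace.PseudoMetrizableSpace M] [SecondCountableTopology M] [BorelSpace M]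

/-- The fundamental theorem of calculus for the extrinsic derivative. -/
theorem sub_eq_integral (h : HasExtrinsicDeriv U D) (μ ν : FiniteMeasure M) {s : ℝ} (hs : 0 ≤ s) :
    U (μ + s.toNNReal • ν) - U μ =
      ∫ r in 0..s, ∫ x, D (μ + r.toNNReal • ν) x ∂(ν : Measure M) := by
  obtain ⟨C, hC⟩ := h.bddD
  let φ : ℕ → SimpleFunc M M := (stronglyMeasurable_id (α := M)).approx
  have hφ : ∀ x, Tendsto (fun n => φ n x) atTop (𝓝 x) :=
    (stronglyMeasurable_id (α := M)).tendsto_approx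
  -- Simple approximations of the identity push `ν` to discrete measures converging weakly to it.
  -- Since integrals against `νn` are integrals against the fixed `ν`, joint continuity of `D` and
  -- dominated convergence carry the formula to the limit.
  let νn : ℕ → FiniteMeasure M := fun n => ν.map (φ n)
  have hint : ∀ (n : ℕ) (f : M → ℝ), Measurable f →
      ∫ x, f x ∂(νn n : Measure M) = ∫ x, f (φ n x) ∂(ν : Measure M) := fun n f hf => by
    rw [FiniteMeasure.toMeasure_map, integral_map (φ n).measurable.aemeasurable
      hf.aestronglyMeasurable]
  have hνn : Tendsto νn atTop (𝓝 ν) := by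
    rw [FiniteMeasure.tendsto_iff_forall_integral_tendsto]
    intro f
    simp only [hint _ f f.continuous.measurable]
    refine tendsto_integral_filter_of_dominated_convergence (fun _ => ‖f‖)
      (Eventually.of_forall fun n =>
        (f.continuous.measurable.comp (φ n).measurable).aestronglyMeasurable)
      (Eventually.of_forall fun n => Eventually.of_forall fun x => f.norm_coe_le_norm _)
      (integrable_const _) (Eventually.of_forall fun x => ?_)
    exact (f.continuous.tendsto x).comp (hφ x)
  have hray : ∀ r : ℝ, Tendsto (fun n => μ + r.toNNReal • νn n) atTop
      (𝓝 (μ + r.toNNReal • ν)) := fun r => tendsto_const_nhds.add (hνn.const_smul _)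
  have h1 : ∀ n, U (μ + s.toNNReal • νn n) - U μ =
      ∫ r in 0..s, ∫ x, D (μ + r.toNNReal • νn n) x ∂(νn n : Measure M) := fun n => by
    refine h.sub_eq_integral_of_hasDirectionalDeriv ?_ μ hs
    change HasDirectionalDeriv U D (ν.map (φ n))
    rw [map_simpleFunc_eq_sum]
    exact h.hasDirectionalDeriv_sum _ _ _
  have h2 : Tendsto (fun n => U (μ + s.toNNReal • νn n) - U μ) atTop
      (𝓝 (U (μ + s.toNNReal • ν) - U μ)) :=
    ((h.cont.tendsto _).comp (hray s)).sub_const _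
  refine tendsto_nhds_unique h2 ?_
  simp only [h1]
  refine intervalIntegral.tendsto_integral_filter_of_dominated_convergence
    (fun _ => C * ν.mass) (Eventually.of_forall fun n =>
      (h.continuous_integral (continuous_ray μ (νn n)) _).aestronglyMeasurable)
    (Eventually.of_forall fun n => Eventually.of_forall fun r _ => ?_)
    intervalIntegrable_const (Eventually.of_forall fun r _ => ?_)
  · rw [hint n _ (h.continuous_right _).measurable]
    refine (norm_integral_le_of_norm_le_const (Eventually.of_forall fun x => hC _ _)).trans ?_
    rfl
  · simp only [hint _ _ (h.continuous_right _).measurable]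
    refine tendsto_integral_filter_of_dominated_convergence (fun _ => C)
      (Eventually.of_forall fun n =>
        ((h.continuous_right _).measurable.comp (φ n).measurable).aestronglyMeasurable)
      (Eventually.of_forall fun n => Eventually.of_forall fun x => hC _ _)
      (integrable_const _) (Eventually.of_forall fun x => ?_)
    exact (h.contD.tendsto (μ + r.toNNReal • ν, x)).comp ((hray r).prodMk_nhds (hφ x))

/-- The mean value theorem for the extrinsic derivative. -/
theorem exists_sub_eq_integral (h : HasExtrinsicDeriv U D) (μ ν : FiniteMeasure M) :
    ∃ r : ℝ≥0, r ≤ 1 ∧ U (μ + ν) - U μ = ∫ x, D (μ + r • ν) x ∂(ν : Measure M) := by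
  have hk := h.continuous_integral (continuous_ray μ ν) (ν : Measure M)
  -- The mean value theorem is applied to the primitive in the integral formula, which is two-sided
  -- differentiable, rather than to the one-sided increment.
  obtain ⟨r, hr, hr'⟩ := exists_deriv_eq_slope
    (fun s : ℝ => ∫ r in 0..s, ∫ x, D (μ + r.toNNReal • ν) x ∂(ν : Measure M)) zero_lt_one
    (intervalIntegral.continuous_primitive (fun a b => hk.intervalIntegrable a b) 0).continuousOn
    (fun s _ => (intervalIntegral.integral_hasDerivAt_right (hk.intervalIntegrable _ _)
      (hk.stronglyMeasurableAtFilter _ _) hk.continuousAt).differentiableAt.differentiableWithinAt)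
  rw [hk.deriv_integral] at hr'
  refine ⟨r.toNNReal, Real.toNNReal_le_one.2 hr.2.le, ?_⟩
  have h1 := h.sub_eq_integral μ ν zero_le_one
  rw [Real.toNNReal_one, one_smul] at h1
  rw [h1, hr']
  simp

end HasPathDeriv

end Fundamental

/-! ### Measures with `L¹` densities and increments between them. -/

section Densities

variable {M : Type*} [MeasurableSpace M] {lam : Measure M}

theorem integrable_L1 (a : Lp ℝ 1 lam) : Integrable a lam := L1.integrable_coeFn a

/-- The finite measure whose density is the positive part of `a`. -/
noncomputable def withDensityL1 (a : Lp ℝ 1 lam) : FiniteMeasure M :=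
  ⟨lam.withDensity fun x => ENNReal.ofReal (a x),
    isFiniteMeasure_withDensity_ofReal (integrable_L1 a).2⟩

theorem coe_withDensityL1 (a : Lp ℝ 1 lam) :
    (withDensityL1 a : Measure M) = lam.withDensity fun x => ENNReal.ofReal (a x) := rfl

theorem withDensityL1_absolutelyContinuous (a : Lp ℝ 1 lam) :
    (withDensityL1 a : Measure M) ≪ lam :=
  withDensity_absolutelyContinuous _ _

theorem measurable_ofReal_L1 (a : Lp ℝ 1 lam) : Measurable fun x => ENNReal.ofReal (a x) :=
  (Lp.stronglyMeasurable a).measurable.ennreal_ofReal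

theorem integral_withDensityL1 {a : Lp ℝ 1 lam} (ha : 0 ≤ a) (f : M → ℝ) :
    ∫ x, f x ∂(withDensityL1 a : Measure M) = ∫ x, a x * f x ∂lam := by
  rw [coe_withDensityL1, integral_withDensity_eq_integral_toReal_smul (measurable_ofReal_L1 a)
    (Eventually.of_forall fun x => ENNReal.ofReal_lt_top)]
  refine integral_congr_ae ?_
  filter_upwards [(Lp.coeFn_nonneg a).2 ha] with x hx
  rw [ENNReal.toReal_ofReal hx, smul_eq_mul]

theorem withDensityL1_add {a b : Lp ℝ 1 lam} (ha : 0 ≤ a) (hb : 0 ≤ b) :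
    withDensityL1 (a + b) = withDensityL1 a + withDensityL1 b := by
  refine FiniteMeasure.toMeasure_injective ?_
  rw [FiniteMeasure.toMeasure_add, coe_withDensityL1, coe_withDensityL1, coe_withDensityL1,
    ← withDensity_add_left (measurable_ofReal_L1 a)]
  refine withDensity_congr_ae ?_
  filter_upwards [Lp.coeFn_add a b, (Lp.coeFn_nonneg a).2 ha, (Lp.coeFn_nonneg b).2 hb]
    with x h1 h2 h3
  rw [h1, Pi.add_apply, Pi.add_apply, ENNReal.ofReal_add h2 h3]

theorem withDensityL1_smul (c : ℝ≥0) (a : Lp ℝ 1 lam) :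
    withDensityL1 ((c : ℝ) • a) = c • withDensityL1 a := by
  refine FiniteMeasure.toMeasure_injective ?_
  rw [FiniteMeasure.toMeasure_smul, coe_withDensityL1, coe_withDensityL1]
  have h0 : c • lam.withDensity (fun x => ENNReal.ofReal (a x))
      = (c : ℝ≥0∞) • lam.withDensity fun x => ENNReal.ofReal (a x) := rfl
  rw [h0, ← withDensity_smul _ (measurable_ofReal_L1 a)]
  refine withDensity_congr_ae ?_
  filter_upwards [Lp.coeFn_smul (c : ℝ) a] with x h1
  rw [h1, Pi.smul_apply, Pi.smul_apply, smul_eq_mul, smul_eq_mul, ENNReal.ofReal_mul c.coe_nonneg,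
    ENNReal.ofReal_coe_nnreal]

theorem norm_L1 (a : Lp ℝ 1 lam) : ‖a‖ = ∫ x, |a x| ∂lam := L1.norm_eq_integral_norm a

theorem mass_withDensityL1 {a : Lp ℝ 1 lam} (ha : 0 ≤ a) : ((withDensityL1 a).mass : ℝ) = ‖a‖ := by
  have h1 := integral_withDensityL1 ha fun _ => 1
  rw [integral_const, smul_eq_mul, mul_one] at h1
  rw [norm_L1]
  refine Eq.trans ?_ (h1.trans ?_)
  · rfl
  · refine integral_congr_ae ?_
    filter_upwards [(Lp.coeFn_nonneg a).2 ha] with x hx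
    rw [mul_one, abs_of_nonneg hx]

theorem integrable_mul_of_bounded (a : Lp ℝ 1 lam) {f : M → ℝ} (hf : AEStronglyMeasurable f lam)
    {C : ℝ} (hC : ∀ x, |f x| ≤ C) : Integrable (fun x => a x * f x) lam :=
  (integrable_L1 a).mul_bdd (c := C) hf (Eventually.of_forall hC)

theorem abs_integral_mul_le (a : Lp ℝ 1 lam) {f : M → ℝ} {C : ℝ} (hC : ∀ x, |f x| ≤ C) :
    |∫ x, a x * f x ∂lam| ≤ C * ‖a‖ := by
  rw [norm_L1, ← integral_const_mul, ← Real.norm_eq_abs]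
  refine norm_integral_le_of_norm_le ((integrable_L1 a).abs.const_mul C)
    (Eventually.of_forall fun x => ?_)
  rw [norm_mul, Real.norm_eq_abs, Real.norm_eq_abs, mul_comm]
  exact mul_le_mul_of_nonneg_right (hC x) (abs_nonneg _)

theorem integral_mul_sub (a b : Lp ℝ 1 lam) {f : M → ℝ} (hf : AEStronglyMeasurable f lam)
    {C : ℝ} (hC : ∀ x, |f x| ≤ C) :
    ∫ x, a x * f x ∂lam - ∫ x, b x * f x ∂lam = ∫ x, (a - b : Lp ℝ 1 lam) x * f x ∂lam := by
  rw [← integral_sub (integrable_mul_of_bounded a hf hC) (integrable_mul_of_bounded b hf hC)]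
  refine integral_congr_ae ?_
  filter_upwards [Lp.coeFn_sub a b] with x hx
  rw [hx, Pi.sub_apply, sub_mul]

variable [TopologicalSpace M] [OpensMeasurableSpace M]

/-- Total variation convergence controls the integrals of all bounded functions. Nonnegativity is
needed because `withDensityL1` keeps only the positive part. -/
theorem tendsto_withDensityL1 {ι : Type*} {l : Filter ι} {a : ι → Lp ℝ 1 lam} {b : Lp ℝ 1 lam}
    (ha : ∀ i, 0 ≤ a i) (hb : 0 ≤ b) (h : Tendsto a l (𝓝 b)) :
    Tendsto (fun i => withDensityL1 (a i)) l (𝓝 (withDensityL1 b)) := by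
  rw [FiniteMeasure.tendsto_iff_forall_integral_tendsto]
  intro f
  rw [tendsto_iff_norm_sub_tendsto_zero]
  have h1 : Tendsto (fun i => ‖f‖ * ‖a i - b‖) l (𝓝 0) := by
    simpa using (tendsto_iff_norm_sub_tendsto_zero.1 h).const_mul ‖f‖
  refine squeeze_zero (fun _ => norm_nonneg _) (fun i => ?_) h1
  rw [integral_withDensityL1 (ha i), integral_withDensityL1 hb,
    integral_mul_sub _ _ f.continuous.measurable.aestronglyMeasurable f.norm_coe_le_norm]
  exact abs_integral_mul_le _ f.norm_coe_le_norm

theorem norm_sub_inf_le (a b : Lp ℝ 1 lam) : ‖b - a ⊓ b‖ ≤ ‖b - a‖ ∧ ‖a - a ⊓ b‖ ≤ ‖b - a‖ := by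
  constructor
  · refine Lp.norm_le_norm_of_ae_le ?_
    filter_upwards [Lp.coeFn_sub b (a ⊓ b), Lp.coeFn_sub b a, Lp.coeFn_inf a b] with x h1 h2 h3
    rw [h1, h2, Pi.sub_apply, Pi.sub_apply, h3, Pi.inf_apply, Real.norm_eq_abs, Real.norm_eq_abs]
    rcases le_total (a x) (b x) with h | h
    · rw [inf_eq_left.2 h]
    · rw [inf_eq_right.2 h, sub_self, abs_zero]
      exact abs_nonneg _
  · refine Lp.norm_le_norm_of_ae_le ?_
    filter_upwards [Lp.coeFn_sub a (a ⊓ b), Lp.coeFn_sub b a, Lp.coeFn_inf a b] with x h1 h2 h3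
    rw [h1, h2, Pi.sub_apply, Pi.sub_apply, h3, Pi.inf_apply, Real.norm_eq_abs, Real.norm_eq_abs]
    rcases le_total (a x) (b x) with h | h
    · rw [inf_eq_left.2 h, sub_self, abs_zero]
      exact abs_nonneg _
    · rw [inf_eq_right.2 h, abs_sub_comm]

namespace HasPathDeriv

variable [TopologicalSpace.PseudoMetrizableSpace M] [SecondCountableTopology M] [BorelSpace M]
variable {U : FiniteMeasure M → ℝ} {D : FiniteMeasure M → M → ℝ}

/-- The increment of `U` between two measures with densities, by the mean value theorem. -/
theorem exists_withDensityL1_sub_eq (h : HasExtrinsicDeriv U D) {a b : Lp ℝ 1 lam} (ha : 0 ≤ a)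
    (hb : 0 ≤ b) : ∃ c c' : Lp ℝ 1 lam, 0 ≤ c ∧ 0 ≤ c' ∧ ‖c - a‖ ≤ 2 * ‖b - a‖ ∧
      ‖c' - a‖ ≤ 2 * ‖b - a‖ ∧
      U (withDensityL1 b) - U (withDensityL1 a) =
        ∫ x, (b - a ⊓ b : Lp ℝ 1 lam) x * D (withDensityL1 c) x ∂lam
          - ∫ x, (a - a ⊓ b : Lp ℝ 1 lam) x * D (withDensityL1 c') x ∂lam := by
  have hab : 0 ≤ a ⊓ b := le_inf ha hb
  have hp : 0 ≤ b - a ⊓ b := sub_nonneg.2 inf_le_right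
  have hq : 0 ≤ a - a ⊓ b := sub_nonneg.2 inf_le_left
  obtain ⟨hpn, hqn⟩ := norm_sub_inf_le a b
  -- The derivative only sees the addition of positive measures. Both endpoints are therefore
  -- reached by increasing from their minimum `a ⊓ b`.
  obtain ⟨r, hr, hr'⟩ := h.exists_sub_eq_integral (withDensityL1 (a ⊓ b))
    (withDensityL1 (b - a ⊓ b))
  obtain ⟨s, hs, hs'⟩ := h.exists_sub_eq_integral (withDensityL1 (a ⊓ b))
    (withDensityL1 (a - a ⊓ b))
  have hnonneg : ∀ (r : ℝ≥0) {p : Lp ℝ 1 lam}, 0 ≤ p → 0 ≤ (r : ℝ) • p := fun r p hp => by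
    rw [← Lp.coeFn_nonneg] at hp ⊢
    filter_upwards [hp, Lp.coeFn_smul (r : ℝ) p] with x h1 h2
    rw [h2]
    exact mul_nonneg r.2 h1
  have hnorm : ∀ {r : ℝ≥0} {p : Lp ℝ 1 lam}, r ≤ 1 → ‖p‖ ≤ ‖b - a‖ →
      ‖a ⊓ b + (r : ℝ) • p - a‖ ≤ 2 * ‖b - a‖ := fun {r p} hr hp => by
    have e : a ⊓ b + (r : ℝ) • p - a = (r : ℝ) • p - (a - a ⊓ b) := by abel
    rw [e]
    refine (norm_sub_le _ _).trans ?_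
    rw [norm_smul, Real.norm_of_nonneg r.coe_nonneg]
    have : (r : ℝ) * ‖p‖ ≤ 1 * ‖p‖ := mul_le_mul_of_nonneg_right (by exact_mod_cast hr)
      (norm_nonneg _)
    linarith
  refine ⟨a ⊓ b + (r : ℝ) • (b - a ⊓ b), a ⊓ b + (s : ℝ) • (a - a ⊓ b),
    add_nonneg hab (hnonneg r hp), add_nonneg hab (hnonneg s hq), hnorm hr hpn, hnorm hs hqn, ?_⟩
  rw [← integral_withDensityL1 hp, ← integral_withDensityL1 hq,
    withDensityL1_add hab (hnonneg r hp), withDensityL1_add hab (hnonneg s hq),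
    withDensityL1_smul, withDensityL1_smul, ← hr', ← hs', ← withDensityL1_add hab hp,
    ← withDensityL1_add hab hq, add_sub_cancel, add_sub_cancel]
  ring

/-- Each of the two increasing steps contributes at most `C ‖b - a‖`. This Lipschitz bound makes the
jump energy finite. -/
theorem abs_withDensityL1_sub_le (h : HasExtrinsicDeriv U D) {C : ℝ} (hC : ∀ μ x, |D μ x| ≤ C)
    (hC0 : 0 ≤ C) {a b : Lp ℝ 1 lam} (ha : 0 ≤ a) (hb : 0 ≤ b) :
    |U (withDensityL1 b) - U (withDensityL1 a)| ≤ 2 * C * ‖b - a‖ := by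
  obtain ⟨c, c', -, -, -, -, e⟩ := h.exists_withDensityL1_sub_eq ha hb
  rw [e]
  refine (abs_sub _ _).trans ?_
  obtain ⟨hpn, hqn⟩ := norm_sub_inf_le a b
  have h1 := abs_integral_mul_le (b - a ⊓ b) (hC (withDensityL1 c))
  have h2 := abs_integral_mul_le (a - a ⊓ b) (hC (withDensityL1 c'))
  nlinarith

end HasPathDeriv

end Densities

/-! ### Differentiability on `H` of the lift `h ↦ U(h²λ)`. -/

section Lift

variable {M : Type*} [MeasurableSpace M] {lam : Measure M}

theorem norm_sq_H (f : H lam) : ‖f‖ ^ 2 = ∫ x, f x ^ 2 ∂lam := by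
  rw [← real_inner_self_eq_norm_sq, L2.inner_def]
  refine integral_congr_ae (Eventually.of_forall fun x => ?_)
  simp [sq]

theorem integrable_abs_mul_abs (f g : H lam) : Integrable (fun x => |f x| * |g x|) lam := by
  refine (L2.integrable_inner (𝕜 := ℝ) |f| |g|).congr ?_
  filter_upwards [Lp.coeFn_abs f, Lp.coeFn_abs g] with x h1 h2
  rw [h1, h2]
  simp [mul_comm]

theorem integral_abs_mul_abs_le (f g : H lam) : ∫ x, |f x| * |g x| ∂lam ≤ ‖f‖ * ‖g‖ := by
  have h1 : ∫ x, |f x| * |g x| ∂lam = inner ℝ |f| |g| := by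
    rw [L2.inner_def]
    refine integral_congr_ae ?_
    filter_upwards [Lp.coeFn_abs f, Lp.coeFn_abs g] with x h1 h2
    rw [h1, h2]
    simp [mul_comm]
  rw [h1, ← norm_abs_eq_norm f, ← norm_abs_eq_norm g]
  exact real_inner_le_norm _ _

/-- The function `h²` as an element of `L¹(λ)`. -/
noncomputable def sqL1 (h : H lam) : Lp ℝ 1 lam :=
  (memLp_one_iff_integrable.2 (integrable_sq h)).toLp fun x => h x ^ 2

theorem coeFn_sqL1 (h : H lam) : sqL1 h =ᵐ[lam] fun x => h x ^ 2 := MemLp.coeFn_toLp _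

theorem sqL1_nonneg (h : H lam) : 0 ≤ sqL1 h := by
  rw [← Lp.coeFn_nonneg]
  filter_upwards [coeFn_sqL1 h] with x hx
  rw [hx]
  exact sq_nonneg _

theorem norm_sqL1 (h : H lam) : ‖sqL1 h‖ = ‖h‖ ^ 2 := by
  rw [norm_L1, norm_sq_H]
  refine integral_congr_ae ?_
  filter_upwards [coeFn_sqL1 h] with x hx
  rw [hx, abs_of_nonneg (sq_nonneg _)]

/-- Cauchy–Schwarz applied to `h² - k² = (h - k)(h + k)`. -/
theorem norm_sqL1_sub_le (h k : H lam) : ‖sqL1 h - sqL1 k‖ ≤ ‖h - k‖ * ‖h + k‖ := by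
  refine le_trans (le_of_eq ?_) (integral_abs_mul_abs_le (h - k) (h + k))
  rw [norm_L1]
  refine integral_congr_ae ?_
  filter_upwards [coeFn_sqL1 h, coeFn_sqL1 k, Lp.coeFn_sub (sqL1 h) (sqL1 k),
    Lp.coeFn_sub h k, Lp.coeFn_add h k] with x h1 h2 h3 h4 h5
  rw [h3, h4, h5, Pi.sub_apply, h1, h2, Pi.sub_apply, Pi.add_apply, ← abs_mul]
  congr 1
  ring

theorem continuous_sqL1 : Continuous (sqL1 : H lam → Lp ℝ 1 lam) := by
  rw [continuous_iff_continuousAt]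
  intro h
  rw [ContinuousAt, tendsto_iff_norm_sub_tendsto_zero]
  have h1 : Tendsto (fun k : H lam => ‖k - h‖ * ‖k + h‖) (𝓝 h) (𝓝 (‖h - h‖ * ‖h + h‖)) :=
    Continuous.tendsto (by fun_prop) h
  rw [sub_self, norm_zero, zero_mul] at h1
  exact squeeze_zero (fun _ => norm_nonneg _) (fun k => norm_sqL1_sub_le k h) h1

theorem withDensityL1_sqL1 (h : H lam) : withDensityL1 (sqL1 h) = (PsiM h).1 := by
  refine FiniteMeasure.toMeasure_injective ?_
  refine withDensity_congr_ae ?_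
  filter_upwards [coeFn_sqL1 h] with x hx
  rw [hx]

theorem memLp_mul_of_bounded (h : H lam) {φ : M → ℝ} (hφ : AEStronglyMeasurable φ lam) {C : ℝ}
    (hC : ∀ x, |φ x| ≤ C) : MemLp (fun x => h x * φ x) 2 lam := by
  refine (Lp.memLp h).of_le_mul (c := C) ((Lp.memLp h).aestronglyMeasurable.mul hφ)
    (Eventually.of_forall fun x => ?_)
  rw [norm_mul, mul_comm]
  exact mul_le_mul_of_nonneg_right (hC x) (norm_nonneg _)

theorem toL2_ae {ν : Measure M} {f : M → ℝ} (hf : MemLp f 2 ν) : toL2 ν f =ᵐ[ν] f := by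
  rw [toL2, dif_pos hf]
  exact hf.coeFn_toLp

theorem toL2_congr {ν : Measure M} {f g : M → ℝ} (h : f =ᵐ[ν] g) : toL2 ν f = toL2 ν g := by
  by_cases hf : MemLp f 2 ν
  · have hg : MemLp g 2 ν := (memLp_congr_ae h).1 hf
    rw [toL2, toL2, dif_pos hf, dif_pos hg]
    exact (MemLp.toLp_eq_toLp_iff _ _).2 h
  · have hg : ¬ MemLp g 2 ν := fun h' => hf ((memLp_congr_ae h).2 h')
    rw [toL2, toL2, dif_neg hf, dif_neg hg]

variable [TopologicalSpace M] [OpensMeasurableSpace M]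

/-- The gradient `2 h D(h² λ)` of the function `h ↦ U(h² λ)`. -/
noncomputable def liftGrad (D : FiniteMeasure M → M → ℝ) (h : H lam) : H lam :=
  toL2 lam fun x => h x * (2 * D (PsiM h).1 x)

namespace HasPathDeriv

variable {U : FiniteMeasure M → ℝ} {D : FiniteMeasure M → M → ℝ}

theorem liftGrad_ae (h : HasExtrinsicDeriv U D) (k : H lam) :
    liftGrad D k =ᵐ[lam] fun x => k x * (2 * D (PsiM k).1 x) := by
  obtain ⟨C, hC⟩ := h.bddD
  refine toL2_ae (memLp_mul_of_bounded k
    ((h.continuous_right _).measurable.const_mul 2).aestronglyMeasurable (C := 2 * C) fun x => ?_)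
  rw [abs_mul, abs_two]
  linarith [hC (PsiM k).1 x]

/-- `h (D(μ) - D(μ'))` as an element of `H`. -/
theorem tendsto_mul_sub (h : HasExtrinsicDeriv U D) (k : H lam) {a : Lp ℝ 1 lam} (ha : 0 ≤ a) :
    Tendsto (fun c : Lp ℝ 1 lam =>
      ‖toL2 lam fun x => k x * (D (withDensityL1 c) x - D (withDensityL1 a) x)‖)
      (𝓝[{c | 0 ≤ c}] a) (𝓝 0) := by
  obtain ⟨C, hC⟩ := h.bddD
  have hm : ∀ c : Lp ℝ 1 lam, AEStronglyMeasurable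
      (fun x => D (withDensityL1 c) x - D (withDensityL1 a) x) lam := fun c =>
    ((h.continuous_right _).measurable.sub (h.continuous_right _).measurable).aestronglyMeasurable
  have hb : ∀ (c : Lp ℝ 1 lam) x, |D (withDensityL1 c) x - D (withDensityL1 a) x| ≤ 2 * C :=
    fun c x => by
      refine (abs_sub _ _).trans ?_
      linarith [hC (withDensityL1 c) x, hC (withDensityL1 a) x]
  have hae := fun c : Lp ℝ 1 lam => toL2_ae (memLp_mul_of_bounded k (hm c) (hb c))
  have h1 : Tendsto (fun c : Lp ℝ 1 lam =>
      ∫ x, (k x * (D (withDensityL1 c) x - D (withDensityL1 a) x)) ^ 2 ∂lam)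
      (𝓝[{c | 0 ≤ c}] a) (𝓝 (∫ _, (0 : ℝ) ∂lam)) := by
    -- The multiplier `k` supplies the integrable majorant `4C²k²`, so pointwise convergence of `D`
    -- suffices; uniformity in `x` would be false in general.
    refine tendsto_integral_filter_of_dominated_convergence
      (fun x => (2 * C) ^ 2 * k x ^ 2) (Eventually.of_forall fun c => ?_)
      (Eventually.of_forall fun c => Eventually.of_forall fun x => ?_)
      ((integrable_sq k).const_mul _) (Eventually.of_forall fun x => ?_)
    · exact ((Lp.memLp k).aestronglyMeasurable.mul (hm c)).pow 2
    · rw [Real.norm_of_nonneg (sq_nonneg _), mul_pow, mul_comm]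
      exact mul_le_mul_of_nonneg_right (sq_le_sq' (abs_le.1 (hb c x)).1 (abs_le.1 (hb c x)).2)
        (sq_nonneg _)
    · have h2 : Tendsto (fun c : Lp ℝ 1 lam => withDensityL1 c) (𝓝[{c | 0 ≤ c}] a)
          (𝓝 (withDensityL1 a)) := by
        rw [nhdsWithin_eq_map_subtype_coe (show a ∈ {c : Lp ℝ 1 lam | 0 ≤ c} from ha),
          tendsto_map'_iff]
        exact tendsto_withDensityL1 (fun c => c.2) ha
          (continuous_subtype_val.tendsto (⟨a, ha⟩ : {c : Lp ℝ 1 lam // 0 ≤ c}))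
      have h5 := (((h.continuous_left x).tendsto _).comp h2).sub_const (D (withDensityL1 a) x)
      rw [sub_self] at h5
      simpa using (h5.const_mul (k x)).pow 2
  rw [integral_zero] at h1
  have h2 := (Real.continuous_sqrt.tendsto _).comp h1
  rw [Real.sqrt_zero] at h2
  refine h2.congr fun c => ?_
  rw [Function.comp_apply, ← Real.sqrt_sq (norm_nonneg (toL2 lam _)), norm_sq_H]
  congr 1
  refine integral_congr_ae ?_
  filter_upwards [hae c] with x hx
  rw [hx]

/-- With `D'` the derivative at `k'`, one has `k'D' - kD = (k' - k)D' + k(D' - D)`. The first term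
is bounded by a multiple of `‖k' - k‖`, and the second is handled by `tendsto_mul_sub`. -/
theorem continuous_liftGrad (h : HasExtrinsicDeriv U D) :
    Continuous (liftGrad D : H lam → H lam) := by
  obtain ⟨C, hC⟩ := h.bddD
  rw [continuous_iff_continuousAt]
  intro k
  rw [ContinuousAt, tendsto_iff_norm_sub_tendsto_zero]
  have h1 : Tendsto (sqL1 : H lam → Lp ℝ 1 lam) (𝓝 k) (𝓝[{c | 0 ≤ c}] (sqL1 k)) :=
    tendsto_nhdsWithin_iff.2 ⟨continuous_sqL1.tendsto k, Eventually.of_forall sqL1_nonneg⟩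
  have h2 := (h.tendsto_mul_sub k (sqL1_nonneg k)).comp h1
  have h3 : Tendsto (fun k' : H lam => 2 * C * ‖k' - k‖) (𝓝 k) (𝓝 0) := by
    have : Tendsto (fun k' : H lam => 2 * C * ‖k' - k‖) (𝓝 k) (𝓝 (2 * C * ‖k - k‖)) :=
      Continuous.tendsto (by fun_prop) k
    simpa using this
  have h4 := h3.add (h2.const_mul 2)
  rw [mul_zero, add_zero] at h4
  refine squeeze_zero (fun _ => norm_nonneg _) (fun k' => ?_) h4
  have hm : ∀ μ, AEStronglyMeasurable (fun x => 2 * D μ x) lam := fun μ =>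
    ((h.continuous_right _).measurable.const_mul 2).aestronglyMeasurable
  have hb : ∀ μ x, |2 * D μ x| ≤ 2 * C := fun μ x => by
    rw [abs_mul, abs_two]
    linarith [hC μ x]
  have hm' : AEStronglyMeasurable (fun x => D (PsiM k').1 x - D (PsiM k).1 x) lam :=
    ((h.continuous_right _).measurable.sub (h.continuous_right _).measurable).aestronglyMeasurable
  have hb' : ∀ x, |D (PsiM k').1 x - D (PsiM k).1 x| ≤ 2 * C := fun x => by
    refine (abs_sub _ _).trans ?_
    linarith [hC (PsiM k').1 x, hC (PsiM k).1 x]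
  have e : liftGrad D k' - liftGrad D k
      = toL2 lam (fun x => (k' - k : H lam) x * (2 * D (PsiM k').1 x))
        + (2 : ℝ) • toL2 lam fun x => k x * (D (PsiM k').1 x - D (PsiM k).1 x) := by
    refine Lp.ext ?_
    filter_upwards [Lp.coeFn_sub (liftGrad D k') (liftGrad D k), h.liftGrad_ae k',
      h.liftGrad_ae k, Lp.coeFn_add (toL2 lam (fun x => (k' - k : H lam) x * (2 * D (PsiM k').1 x)))
        ((2 : ℝ) • toL2 lam fun x => k x * (D (PsiM k').1 x - D (PsiM k).1 x)),
      Lp.coeFn_smul (2 : ℝ) (toL2 lam fun x => k x * (D (PsiM k').1 x - D (PsiM k).1 x)),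
      toL2_ae (memLp_mul_of_bounded (k' - k) (hm _) (hb (PsiM k').1)),
      toL2_ae (memLp_mul_of_bounded k hm' hb'), Lp.coeFn_sub k' k]
      with x e1 e2 e3 e4 e5 e6 e7 e8
    rw [e1, e4, Pi.sub_apply, Pi.add_apply, e2, e3, e5, Pi.smul_apply, e6, e7, e8, Pi.sub_apply,
      smul_eq_mul]
    ring
  rw [e]
  refine (norm_add_le _ _).trans (add_le_add ?_ ?_)
  · refine Lp.norm_le_mul_norm_of_ae_le_mul ?_
    filter_upwards [toL2_ae (memLp_mul_of_bounded (k' - k) (hm _) (hb (PsiM k').1))] with x hx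
    rw [hx, norm_mul, mul_comm]
    exact mul_le_mul_of_nonneg_right (hb _ x) (norm_nonneg _)
  · rw [norm_smul, Real.norm_two, Function.comp_apply, withDensityL1_sqL1, withDensityL1_sqL1]

variable [TopologicalSpace.PseudoMetrizableSpace M] [SecondCountableTopology M] [BorelSpace M]

/-- With `a = k²` and `b = (k + k')²`, the increment of `U` is an integral of `b - a = 2kk' + k'²`
against `D` at intermediate densities within `2‖b - a‖` of `a`. Replacing these by `a` leaves the
linear term `∫ 2kk'D(a)`; every error is small relative to `‖k'‖`. -/
theorem hasGradientAt_lift (h : HasExtrinsicDeriv U D) (k : H lam) :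
    HasGradientAt (fun k : H lam => U (PsiM k).1) (liftGrad D k) k := by
  obtain ⟨C, hC⟩ := h.bddD
  rw [hasGradientAt_iff_hasFDerivAt, hasFDerivAt_iff_isLittleO_nhds_zero,
    Asymptotics.isLittleO_iff]
  intro ε hε
  have h1 := h.tendsto_mul_sub k (sqL1_nonneg k)
  have h2 := (tendsto_order.1 h1).2 (ε / 8) (by positivity)
  rw [eventually_nhdsWithin_iff, Metric.eventually_nhds_iff] at h2
  obtain ⟨δ, hδ, h2⟩ := h2
  have h3 : ∀ᶠ k' : H lam in 𝓝 0, 2 * ‖sqL1 (k + k') - sqL1 k‖ < δ := by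
    have : Tendsto (fun k' : H lam => 2 * ‖sqL1 (k + k') - sqL1 k‖) (𝓝 0)
        (𝓝 (2 * ‖sqL1 (k + 0) - sqL1 k‖)) := by
      have := continuous_sqL1 (lam := lam)
      exact Continuous.tendsto (by fun_prop) 0
    simp only [add_zero, sub_self, norm_zero, mul_zero] at this
    exact (tendsto_order.1 this).2 δ hδ
  -- The quadratic errors sum to `5|C|‖k'‖²`: twice `2|C|` from the intermediate densities and once
  -- `|C|` from the term `k'²D(a)`. The bound `ε/8` on `w` leaves the other half `ε/2`.
  have h4 : ∀ᶠ k' : H lam in 𝓝 0, 5 * |C| * ‖k'‖ < ε / 2 := by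
    have : Tendsto (fun k' : H lam => 5 * |C| * ‖k'‖) (𝓝 0) (𝓝 (5 * |C| * ‖(0 : H lam)‖)) :=
      Continuous.tendsto (by fun_prop) 0
    simp only [norm_zero, mul_zero] at this
    exact (tendsto_order.1 this).2 _ (by positivity)
  filter_upwards [h3, h4] with k' hk' hk''
  obtain ⟨c, c', hc, hc', hca, hca', e⟩ :=
    h.exists_withDensityL1_sub_eq (sqL1_nonneg k) (sqL1_nonneg (k + k'))
  set a := sqL1 k
  set b := sqL1 (k + k')
  have hm : ∀ μ, AEStronglyMeasurable (D μ) lam := fun μ =>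
    (h.continuous_right _).measurable.aestronglyMeasurable
  have hmd : ∀ μ μ', AEStronglyMeasurable (fun x => D μ x - D μ' x) lam := fun μ μ' =>
    (hm μ).sub (hm μ')
  have hbd : ∀ μ μ' x, |D μ x - D μ' x| ≤ 2 * |C| := fun μ μ' x => by
    refine (abs_sub _ _).trans ?_
    linarith [hC μ x, hC μ' x, le_abs_self C]
  have hba : ∀ᵐ x ∂lam, (b - a : Lp ℝ 1 lam) x = 2 * k x * k' x + k' x ^ 2 := by
    filter_upwards [Lp.coeFn_sub b a, coeFn_sqL1 k, coeFn_sqL1 (k + k'), Lp.coeFn_add k k']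
      with x e1 e2 e3 e4
    rw [e1, Pi.sub_apply, e2, e3, e4, Pi.add_apply]
    ring
  -- The part `2kk'` of the increment is paired with `k(D(c) - D(a))`, small in `L²`, by
  -- Cauchy–Schwarz; the part `k'²` uses only boundedness of `D`.
  have hsmall : ∀ (c : Lp ℝ 1 lam), 0 ≤ c → ‖c - a‖ ≤ 2 * ‖b - a‖ → ∀ p : Lp ℝ 1 lam,
      (∀ᵐ x ∂lam, |p x| ≤ |(b - a : Lp ℝ 1 lam) x|) →
      |∫ x, p x * (D (withDensityL1 c) x - D (withDensityL1 a) x) ∂lam|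
        ≤ ‖k'‖ * (ε / 4 + 2 * |C| * ‖k'‖) := by
    intro c hc hca p hp
    set w : H lam := toL2 lam fun x => k x * (D (withDensityL1 c) x - D (withDensityL1 a) x)
      with hw
    have hwn : ‖w‖ < ε / 8 := h2 (by rw [dist_eq_norm]; exact hca.trans_lt hk') hc
    have hwae := toL2_ae (memLp_mul_of_bounded k (hmd (withDensityL1 c) (withDensityL1 a))
      (hbd _ _))
    rw [← hw] at hwae
    have hint : Integrable (fun x => 2 * (|w x| * |k' x|) + 2 * |C| * k' x ^ 2) lam :=
      ((integrable_abs_mul_abs w k').const_mul 2).add ((integrable_sq k').const_mul _)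
    rw [← Real.norm_eq_abs]
    refine (norm_integral_le_of_norm_le hint ?_).trans ?_
    · filter_upwards [hwae, hba, hp] with x e1 e2 e3
      rw [norm_mul, Real.norm_eq_abs, Real.norm_eq_abs, e1, abs_mul]
      rw [e2] at e3
      have e4 : |p x| ≤ 2 * |k x| * |k' x| + k' x ^ 2 := e3.trans ((abs_add_le _ _).trans (by
        rw [abs_mul, abs_mul, abs_two, abs_of_nonneg (sq_nonneg (k' x))]))
      have e5 := hbd (withDensityL1 c) (withDensityL1 a) x
      have e6 := mul_le_mul_of_nonneg_right e4
        (abs_nonneg (D (withDensityL1 c) x - D (withDensityL1 a) x))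
      have e7 := mul_le_mul_of_nonneg_left e5 (sq_nonneg (k' x))
      nlinarith
    · rw [integral_add ((integrable_abs_mul_abs w k').const_mul 2)
        ((integrable_sq k').const_mul _), integral_const_mul, integral_const_mul, ← norm_sq_H]
      have e1 := integral_abs_mul_abs_le w k'
      have e2 := mul_le_mul_of_nonneg_right hwn.le (norm_nonneg k')
      nlinarith
  have habs : ∀ᵐ x ∂lam, |(b - a ⊓ b : Lp ℝ 1 lam) x| ≤ |(b - a : Lp ℝ 1 lam) x| ∧
      |(a - a ⊓ b : Lp ℝ 1 lam) x| ≤ |(b - a : Lp ℝ 1 lam) x| := by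
    filter_upwards [Lp.coeFn_sub b (a ⊓ b), Lp.coeFn_sub a (a ⊓ b), Lp.coeFn_sub b a,
      Lp.coeFn_inf a b] with x e1 e2 e3 e4
    rw [e1, e2, e3, Pi.sub_apply, Pi.sub_apply, Pi.sub_apply, e4, Pi.inf_apply]
    rcases le_total (a x) (b x) with h | h
    · rw [inf_eq_left.2 h, sub_self, abs_zero]
      exact ⟨le_rfl, abs_nonneg _⟩
    · rw [inf_eq_right.2 h, sub_self, abs_zero, abs_sub_comm (a x)]
      exact ⟨abs_nonneg _, le_rfl⟩
  have hs1 := hsmall c hc hca _ (habs.mono fun x hx => hx.1)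
  have hs2 := hsmall c' hc' hca' _ (habs.mono fun x hx => hx.2)
  have hgrad : inner ℝ (liftGrad D k) k'
      = ∫ x, (b - a : Lp ℝ 1 lam) x * D (withDensityL1 a) x ∂lam
        - ∫ x, k' x ^ 2 * D (withDensityL1 a) x ∂lam := by
    rw [L2.inner_def, ← integral_sub (integrable_mul_of_bounded _ (hm _) (hC _))
      ((integrable_sq k').mul_bdd (c := C) (hm _) (Eventually.of_forall (hC _)))]
    refine integral_congr_ae ?_
    filter_upwards [h.liftGrad_ae k, hba] with x e1 e2
    rw [e1, e2, ← withDensityL1_sqL1]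
    simp only [RCLike.inner_apply, conj_trivial]
    ring
  have hs3 : |∫ x, k' x ^ 2 * D (withDensityL1 a) x ∂lam| ≤ |C| * ‖k'‖ ^ 2 := by
    rw [norm_sq_H, ← integral_const_mul, ← Real.norm_eq_abs]
    refine norm_integral_le_of_norm_le ((integrable_sq k').const_mul _)
      (Eventually.of_forall fun x => ?_)
    rw [norm_mul, Real.norm_of_nonneg (sq_nonneg _), mul_comm]
    exact mul_le_mul_of_nonneg_right ((hC _ x).trans (le_abs_self C)) (sq_nonneg _)
  have hexp : ∀ (p : Lp ℝ 1 lam) (c : Lp ℝ 1 lam), ∫ x, p x * D (withDensityL1 c) x ∂lam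
      = ∫ x, p x * (D (withDensityL1 c) x - D (withDensityL1 a) x) ∂lam
        + ∫ x, p x * D (withDensityL1 a) x ∂lam := fun p c => by
    rw [← integral_add (integrable_mul_of_bounded p (hmd _ _) (hbd _ _))
      (integrable_mul_of_bounded p (hm _) (hC _))]
    refine integral_congr_ae (Eventually.of_forall fun x => ?_)
    ring
  have hsub := integral_mul_sub (b - a ⊓ b) (a - a ⊓ b) (hm (withDensityL1 a)) (hC _)
  rw [sub_sub_sub_cancel_right] at hsub
  rw [InnerProductSpace.toDual_apply_apply, hgrad, ← withDensityL1_sqL1, ← withDensityL1_sqL1,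
    e, hexp _ c, hexp _ c', Real.norm_eq_abs]
  rw [abs_le] at hs1 hs2 hs3 ⊢
  have hfin : ‖k'‖ * (5 * |C| * ‖k'‖) ≤ ‖k'‖ * (ε / 2) :=
    mul_le_mul_of_nonneg_left hk''.le (norm_nonneg _)
  constructor <;> nlinarith

theorem contDiff_lift (h : HasExtrinsicDeriv U D) :
    ContDiff ℝ 1 fun k : H lam => U (PsiM k).1 := by
  rw [contDiff_one_iff_hasFDerivAt]
  exact ⟨_, (InnerProductSpace.toDual ℝ (H lam)).continuous.comp h.continuous_liftGrad,
    fun k => (h.hasGradientAt_lift k).hasFDerivAt⟩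

theorem gradient_lift (h : HasExtrinsicDeriv U D) (k : H lam) :
    gradient (fun k : H lam => U (PsiM k).1) k = liftGrad D k :=
  (h.hasGradientAt_lift k).gradient

end HasPathDeriv

end Lift

/-! ### The total variation spaces `Mac` and `Pac` as closed subsets of `L¹`. -/

section Densities

variable {M : Type*} [MeasurableSpace M] {lam : Measure M}

theorem coeFn_density (ν : Measure M) [IsFiniteMeasure ν] :
    density lam ν =ᵐ[lam] fun x => (ν.rnDeriv lam x).toReal := MemLp.coeFn_toLp _

theorem density_nonneg (ν : Measure M) [IsFiniteMeasure ν] : 0 ≤ density lam ν := by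
  rw [← Lp.coeFn_nonneg]
  filter_upwards [coeFn_density (lam := lam) ν] with x hx
  rw [hx]
  exact ENNReal.toReal_nonneg

variable [SigmaFinite lam]

theorem withDensityL1_density (μ : FiniteMeasure M) (hμ : (μ : Measure M) ≪ lam) :
    withDensityL1 (density lam (μ : Measure M)) = μ := by
  refine FiniteMeasure.toMeasure_injective ?_
  rw [coe_withDensityL1]
  conv_rhs => rw [← Measure.withDensity_rnDeriv_eq (μ : Measure M) lam hμ]
  refine withDensity_congr_ae ?_
  filter_upwards [coeFn_density (lam := lam) (μ : Measure M),
    Measure.rnDeriv_lt_top (μ : Measure M) lam] with x h1 h2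
  rw [h1, ENNReal.ofReal_toReal h2.ne]

theorem density_withDensityL1 {a : Lp ℝ 1 lam} (ha : 0 ≤ a) :
    density lam (withDensityL1 a : Measure M) = a := by
  refine Lp.ext ?_
  filter_upwards [coeFn_density (lam := lam) (withDensityL1 a : Measure M),
    Measure.rnDeriv_withDensity lam (measurable_ofReal_L1 a), (Lp.coeFn_nonneg a).2 ha]
    with x h1 h2 h3
  rw [h1, coe_withDensityL1, h2, ENNReal.toReal_ofReal h3]

theorem density_eq_of_eq {μ : FiniteMeasure M} {a : Lp ℝ 1 lam} (ha : 0 ≤ a)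
    (h : withDensityL1 a = μ) : density lam (μ : Measure M) = a := by
  subst h
  exact density_withDensityL1 ha

theorem norm_density (μ : FiniteMeasure M) (hμ : (μ : Measure M) ≪ lam) :
    ‖density lam (μ : Measure M)‖ = μ.mass := by
  rw [← mass_withDensityL1 (density_nonneg _), withDensityL1_density μ hμ]

/-- The density of an absolutely continuous finite measure. -/
noncomputable def Mac.dens (μ : Mac lam) : Lp ℝ 1 lam := density lam μ.meas

/-- The density of an absolutely continuous probability measure. -/
noncomputable def Pac.dens (μ : Pac lam) : Lp ℝ 1 lam := density lam μ.meas

theorem Mac.isometry_dens : Isometry (Mac.dens : Mac lam → Lp ℝ 1 lam) :=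
  Isometry.of_dist_eq fun _ _ => rfl

theorem Pac.isometry_dens : Isometry (Pac.dens : Pac lam → Lp ℝ 1 lam) :=
  Isometry.of_dist_eq fun _ _ => rfl

theorem Mac.dens_nonneg (μ : Mac lam) : 0 ≤ μ.dens := density_nonneg _

theorem Mac.withDensityL1_dens (μ : Mac lam) : withDensityL1 μ.dens = μ.1 :=
  withDensityL1_density μ.1 μ.2

theorem Mac.norm_dens (μ : Mac lam) : ‖μ.dens‖ = μ.1.mass := norm_density μ.1 μ.2

theorem Pac.dens_toMac (μ : Pac lam) : μ.toMac.dens = μ.dens := rfl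

theorem Pac.norm_dens (μ : Pac lam) : ‖μ.dens‖ = 1 := by
  rw [← Pac.dens_toMac, Mac.norm_dens]
  change ((μ.1.toFiniteMeasure.mass : ℝ≥0) : ℝ) = 1
  rw [ProbabilityMeasure.mass_toFiniteMeasure, NNReal.coe_one]

theorem Pac.isometry_toMac : Isometry (Pac.toMac : Pac lam → Mac lam) :=
  Isometry.of_dist_eq fun _ _ => rfl

theorem Mac.range_dens : Set.range (Mac.dens : Mac lam → Lp ℝ 1 lam) = {a | 0 ≤ a} := by
  ext a
  constructor
  · rintro ⟨μ, rfl⟩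
    exact μ.dens_nonneg
  · intro ha
    exact ⟨⟨withDensityL1 a, withDensityL1_absolutelyContinuous a⟩, density_withDensityL1 ha⟩

theorem Mac.range_toMac : Set.range (Pac.toMac : Pac lam → Mac lam) = {μ | ‖μ.dens‖ = 1} := by
  ext μ
  constructor
  · rintro ⟨ν, rfl⟩
    exact ν.norm_dens
  · intro hμ
    rw [Set.mem_ofPred_eq, Mac.norm_dens] at hμ
    have h1 : (μ.1 : Measure M) Set.univ = 1 := by
      rw [← FiniteMeasure.ennreal_mass]
      exact_mod_cast hμ
    exact ⟨⟨⟨μ.1, ⟨h1⟩⟩, μ.2⟩, rfl⟩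

/-- Taking densities is an isometry onto the closed cone of nonnegative elements of `L¹`.
Completeness is what makes closed totally bounded sets compact. -/
instance : CompleteSpace (Mac lam) := by
  rw [completeSpace_iff_isComplete_range Mac.isometry_dens.isUniformInducing, Mac.range_dens]
  exact isClosed_Ici.isComplete

theorem Mac.isClosed_range_toMac : IsClosed (Set.range (Pac.toMac : Pac lam → Mac lam)) := by
  rw [Mac.range_toMac]
  exact isClosed_eq Mac.isometry_dens.continuous.norm continuous_const

instance : CompleteSpace (Pac lam) := by
  rw [completeSpace_iff_isComplete_range Pac.isometry_toMac.isUniformInducing]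
  exact Mac.isClosed_range_toMac.isComplete

/-- For a fixed measurable set, `μ ↦ μ(s)` is `1`-Lipschitz in total variation, so the family of
base measures is a measurable kernel. -/
theorem Mac.measurable_meas : Measurable fun μ : Mac lam => μ.meas := by
  refine Measure.measurable_of_measurable_coe _ fun s hs => ?_
  have h1 : ∀ μ : Mac lam, μ.meas s =
      ENNReal.ofReal (∫ x, μ.dens x * s.indicator (fun _ => (1 : ℝ)) x ∂lam) := fun μ => by
    rw [← integral_withDensityL1 μ.dens_nonneg, μ.withDensityL1_dens,
      integral_indicator hs, setIntegral_const, smul_eq_mul, mul_one, ofReal_measureReal]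
  simp only [h1]
  refine ENNReal.measurable_ofReal.comp (Continuous.measurable ?_)
  have hm : AEStronglyMeasurable (s.indicator fun _ => (1 : ℝ)) lam :=
    (measurable_const.indicator hs).aestronglyMeasurable
  have hb : ∀ x, |s.indicator (fun _ => (1 : ℝ)) x| ≤ 1 := fun x => by
    by_cases hx : x ∈ s <;> simp [hx]
  refine LipschitzWith.continuous (K := 1) (LipschitzWith.of_dist_le_mul fun μ ν => ?_)
  rw [Real.dist_eq, integral_mul_sub _ _ hm hb, ← Mac.isometry_dens.dist_eq, dist_eq_norm]
  exact abs_integral_mul_le _ hb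

theorem Pac.measurable_meas : Measurable fun μ : Pac lam => μ.meas :=
  Mac.measurable_meas.comp (Pac.isometry_toMac (lam := lam)).continuous.measurable

theorem Mac.dens_PsiM (h : H lam) : (PsiM h).dens = sqL1 h :=
  density_eq_of_eq (sqL1_nonneg h) (withDensityL1_sqL1 h)

theorem continuous_PsiM : Continuous (PsiM : H lam → Mac lam) := by
  rw [Mac.isometry_dens.isUniformInducing.isInducing.continuous_iff]
  refine continuous_sqL1.congr fun h => ?_
  rw [Function.comp_apply, Mac.dens_PsiM]

theorem coe_toMac_PsiP (h : H0 lam) :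
    (PsiP h).toMac.1 = (‖h.1‖₊ ^ 2)⁻¹ • (PsiM h.1).1 := by
  refine FiniteMeasure.toMeasure_injective ?_
  rw [FiniteMeasure.toMeasure_smul]
  change (ENNReal.ofReal (∫ x, h.1 x ^ 2 ∂lam))⁻¹ • sqMeasure h.1
    = (((‖h.1‖₊ ^ 2)⁻¹ : ℝ≥0) : ℝ≥0∞) • sqMeasure h.1
  have h0 : ‖h.1‖₊ ^ 2 ≠ 0 := pow_ne_zero _ (nnnorm_ne_zero_iff.2 h.2)
  rw [← norm_sq_H, ENNReal.coe_inv h0]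
  congr 2
  rw [← coe_nnnorm, ← NNReal.coe_pow, ENNReal.ofReal_coe_nnreal]

theorem Pac.dens_PsiP (h : H0 lam) : (PsiP h).dens = (‖h.1‖ ^ 2)⁻¹ • sqL1 h.1 := by
  rw [← Pac.dens_toMac]
  have h1 : (((‖h.1‖₊ ^ 2)⁻¹ : ℝ≥0) : ℝ) = (‖h.1‖ ^ 2)⁻¹ := by simp
  refine density_eq_of_eq ?_ ?_
  · rw [← Lp.coeFn_nonneg]
    filter_upwards [Lp.coeFn_smul ((‖h.1‖ ^ 2)⁻¹) (sqL1 h.1),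
      (Lp.coeFn_nonneg _).2 (sqL1_nonneg h.1)] with x h1 h2
    rw [h1]
    exact mul_nonneg (by positivity) h2
  · rw [coe_toMac_PsiP, ← h1, withDensityL1_smul, withDensityL1_sqL1]

theorem continuous_PsiP : Continuous (PsiP : H0 lam → Pac lam) := by
  rw [Pac.isometry_dens.isUniformInducing.isInducing.continuous_iff]
  have h1 : Continuous fun h : H0 lam => (‖h.1‖ ^ 2)⁻¹ • sqL1 h.1 :=
    ((continuous_subtype_val.norm.pow 2).inv₀
      (fun h => pow_ne_zero _ (norm_ne_zero_iff.2 h.2))).smul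
      (continuous_sqL1.comp continuous_subtype_val)
  refine h1.congr fun h => ?_
  rw [Function.comp_apply, Pac.dens_PsiP]

variable [TopologicalSpace M] [BorelSpace M]

theorem Mac.continuous_val [OpensMeasurableSpace M] :
    Continuous fun μ : Mac lam => μ.1 := by
  rw [continuous_iff_continuousAt]
  intro μ
  have h1 := tendsto_withDensityL1 (fun ν : Mac lam => ν.dens_nonneg) μ.dens_nonneg
    (Mac.isometry_dens.continuous.tendsto μ)
  simp only [Mac.withDensityL1_dens] at h1
  exact h1

theorem Pac.continuous_val [OpensMeasurableSpace M] :
    Continuous fun μ : Pac lam => μ.1 := by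
  rw [continuous_iff_continuousAt]
  intro μ
  rw [ContinuousAt, ProbabilityMeasure.tendsto_nhds_iff_toFiniteMeasure_tendsto_nhds]
  exact (Mac.continuous_val.comp Pac.isometry_toMac.continuous).tendsto μ

variable [PolishSpace M]

theorem secondCountable_L1 : SecondCountableTopology (Lp ℝ 1 lam) := by
  have : Fact ((1 : ℝ≥0∞) ≠ ∞) := ⟨ENNReal.one_ne_top⟩
  infer_instance

instance : SecondCountableTopology (Mac lam) :=
  have := secondCountable_L1 (lam := lam)
  Mac.isometry_dens.isUniformInducing.isInducing.secondCountableTopology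

instance : SecondCountableTopology (Pac lam) :=
  have := secondCountable_L1 (lam := lam)
  Pac.isometry_dens.isUniformInducing.isInducing.secondCountableTopology

end Densities

/-! ### A countable norming family of continuous functions for `L¹`. -/

section Norming

variable {M : Type*} [MeasurableSpace M] [TopologicalSpace M] [PolishSpace M] [BorelSpace M]

/-- The sign of `g` is norming. It is approximated by a continuous function in `L¹(|g|λ)`;
truncation to `[-1, 1]` cannot increase the distance to a function already taking values there. -/
theorem exists_boundedContinuous_norming (lam : Measure M) (g : Lp ℝ 1 lam) {ε : ℝ} (hε : 0 < ε) :
    ∃ f : BoundedContinuousFunction M ℝ, (∀ x, |f x| ≤ 1) ∧ ‖g‖ - ε ≤ ∫ x, g x * f x ∂lam := by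
  let ν : Measure M := withDensityL1 |g|
  let s : M → ℝ := fun x => if 0 < g x then 1 else -1
  have hgm : Measurable g := (Lp.stronglyMeasurable g).measurable
  have hs : Measurable s :=
    Measurable.ite (measurableSet_lt measurable_const hgm) measurable_const measurable_const
  have hs1 : ∀ x, |s x| ≤ 1 := fun x => by
    by_cases hx : 0 < g x <;> simp [s, hx]
  have hsg : ∀ x, g x = |g x| * s x := fun x => by
    by_cases hx : 0 < g x
    · simp [s, hx, abs_of_pos hx]
    · simp [s, hx, abs_of_nonpos (not_lt.1 hx)]
  have hsL : MemLp s 1 ν := MemLp.of_bound hs.aestronglyMeasurable 1 (Eventually.of_forall hs1)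
  obtain ⟨f0, hf0, hf0'⟩ := hsL.exists_boundedContinuous_eLpNorm_sub_le ENNReal.one_ne_top
    (ε := ENNReal.ofReal ε) (by simpa using hε)
  let f : BoundedContinuousFunction M ℝ := BoundedContinuousFunction.ofNormedAddCommGroup
    (fun x => max (-1) (min 1 (f0 x))) (by fun_prop) 1 fun x => by
      rw [Real.norm_eq_abs, abs_le]
      exact ⟨le_max_left _ _, max_le (by norm_num) (min_le_left _ _)⟩
  have hf : ∀ x, f x = max (-1) (min 1 (f0 x)) := fun x => rfl
  have hf1 : ∀ x, |f x| ≤ 1 := fun x => by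
    rw [hf, abs_le]
    exact ⟨le_max_left _ _, max_le (by norm_num) (min_le_left _ _)⟩
  refine ⟨f, hf1, ?_⟩
  have hclose : ∀ x, |s x - f x| ≤ |s x - f0 x| := fun x => by
    have h1 := abs_max_sub_max_le_abs (s x) (min 1 (f0 x)) (-1)
    have h2 : max (s x) (-1) = s x := max_eq_left (abs_le.1 (hs1 x)).1
    have h3 := abs_min_sub_min_le_max 1 (s x) 1 (f0 x)
    rw [sub_self, abs_zero, max_eq_right (abs_nonneg _), min_eq_right (abs_le.1 (hs1 x)).2] at h3
    rw [h2, max_comm] at h1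
    rw [hf]
    exact h1.trans h3
  have hint0 : Integrable (fun x => |s x - f0 x|) ν :=
    ((memLp_one_iff_integrable.1 hsL).sub (memLp_one_iff_integrable.1 hf0')).abs
  have h4 : ∫ x, |s x - f0 x| ∂ν ≤ ε := by
    have h5 := ENNReal.toReal_le_of_le_ofReal hε.le hf0
    rw [eLpNorm_one_eq_lintegral_enorm] at h5
    refine le_trans (le_of_eq ?_) h5
    have := integral_norm_eq_lintegral_enorm (μ := ν) (f := fun x => s x - f0 x)
      (hs.sub f0.continuous.measurable).aestronglyMeasurable
    simpa only [Real.norm_eq_abs, Pi.sub_apply] using this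
  have hae : ∀ᵐ x ∂lam, (|g| : Lp ℝ 1 lam) x = |g x| := Lp.coeFn_abs g
  have h6 : ‖g‖ - ∫ x, g x * f x ∂lam = ∫ x, s x * (s x - f x) ∂ν := by
    have e1 : ∫ x, s x * (s x - f x) ∂ν
        = ∫ x, (|g| : Lp ℝ 1 lam) x * (s x * (s x - f x)) ∂lam :=
      integral_withDensityL1 (abs_nonneg g) _
    rw [e1, norm_L1, ← integral_sub (integrable_L1 g).abs
      (integrable_mul_of_bounded g f.continuous.measurable.aestronglyMeasurable hf1)]
    refine integral_congr_ae ?_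
    filter_upwards [hae] with x hx
    have e2 : s x * s x = 1 := by
      by_cases hx : 0 < g x <;> simp [s, hx]
    rw [hx]
    conv_lhs => rw [hsg x, abs_mul, abs_abs]
    have e3 : |s x| = 1 := by
      by_cases hx : 0 < g x <;> simp [s, hx]
    rw [e3, mul_sub, e2]
    ring
  have h7 : ∫ x, s x * (s x - f x) ∂ν ≤ ∫ x, |s x - f0 x| ∂ν := by
    refine (le_abs_self _).trans ?_
    rw [← Real.norm_eq_abs]
    refine norm_integral_le_of_norm_le hint0 (Eventually.of_forall fun x => ?_)
    rw [norm_mul, Real.norm_eq_abs, Real.norm_eq_abs]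
    calc |s x| * |s x - f x| ≤ 1 * |s x - f0 x| :=
          mul_le_mul (hs1 x) (hclose x) (abs_nonneg _) zero_le_one
      _ = _ := one_mul _
  linarith

/-- A countable family of continuous functions which is norming for `L¹`. -/
theorem exists_norming_seq (lam : Measure M) [SigmaFinite lam] :
    ∃ f : ℕ → BoundedContinuousFunction M ℝ, (∀ n x, |f n x| ≤ 1) ∧
      ∀ (g : Lp ℝ 1 lam) (ε : ℝ), 0 < ε → ∃ n, ‖g‖ - ε ≤ ∫ x, g x * f n x ∂lam := by
  have := secondCountable_L1 (lam := lam)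
  have h1 := fun (j k : ℕ) => exists_boundedContinuous_norming lam
    (TopologicalSpace.denseSeq (Lp ℝ 1 lam) j) (ε := 1 / ((k : ℝ) + 1)) (by positivity)
  choose F hF1 hF using h1
  refine ⟨fun n => F n.unpair.1 n.unpair.2, fun n x => hF1 _ _ x, fun g ε hε => ?_⟩
  obtain ⟨j, hj⟩ := (Metric.denseRange_iff.1 (TopologicalSpace.denseRange_denseSeq (Lp ℝ 1 lam)))
    g (ε / 4) (by positivity)
  obtain ⟨k, hk⟩ := exists_nat_one_div_lt (show 0 < ε / 4 by positivity)
  refine ⟨Nat.pair j k, ?_⟩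
  simp only [Nat.unpair_pair]
  have h2 := integral_mul_sub g (TopologicalSpace.denseSeq (Lp ℝ 1 lam) j)
    (F j k).continuous.measurable.aestronglyMeasurable (hF1 j k)
  have h3 := abs_integral_mul_le (g - TopologicalSpace.denseSeq (Lp ℝ 1 lam) j) (hF1 j k)
  rw [dist_eq_norm] at hj
  have h4 := norm_le_norm_add_norm_sub' g (TopologicalSpace.denseSeq (Lp ℝ 1 lam) j)
  rw [abs_le] at h3
  linarith [hF j k]

end Norming

/-! ### Smooth approximations of the unit contraction. -/

section SmoothContractions

/-- A smooth approximation of the positive part. -/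
noncomputable def softPos (δ t : ℝ) : ℝ := (t + √(t ^ 2 + δ ^ 2) - δ) / 2

theorem hasDerivAt_sqrt_sq_add {δ : ℝ} (hδ : 0 < δ) (t : ℝ) :
    HasDerivAt (fun t => √(t ^ 2 + δ ^ 2)) (t / √(t ^ 2 + δ ^ 2)) t := by
  have h1 : HasDerivAt (fun t : ℝ => t ^ 2 + δ ^ 2) (2 * t) t := by
    simpa using ((hasDerivAt_id t).pow 2).add_const (δ ^ 2)
  have h2 := h1.sqrt (by positivity)
  convert h2 using 1
  field_simp

theorem contDiff_sqrt_sq_add {δ : ℝ} (hδ : 0 < δ) :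
    ContDiff ℝ 1 fun t : ℝ => √(t ^ 2 + δ ^ 2) :=
  ((contDiff_id.pow 2).add contDiff_const).sqrt fun t => by positivity

theorem abs_div_sqrt_sq_add_le {δ : ℝ} (hδ : 0 < δ) (t : ℝ) : |t / √(t ^ 2 + δ ^ 2)| ≤ 1 := by
  rw [abs_div, abs_of_nonneg (Real.sqrt_nonneg _), div_le_one (by positivity)]
  exact Real.abs_le_sqrt (by nlinarith)

theorem sqrt_sq_add_mem {δ : ℝ} (hδ : 0 < δ) (t : ℝ) :
    |t| ≤ √(t ^ 2 + δ ^ 2) ∧ √(t ^ 2 + δ ^ 2) ≤ |t| + δ := by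
  refine ⟨Real.abs_le_sqrt (by nlinarith), ?_⟩
  rw [Real.sqrt_le_left (by positivity)]
  nlinarith [sq_abs t, abs_nonneg t]

theorem contDiff_softPos {δ : ℝ} (hδ : 0 < δ) : ContDiff ℝ 1 (softPos δ) :=
  ((contDiff_id.add (contDiff_sqrt_sq_add hδ)).sub contDiff_const).div_const 2

theorem abs_deriv_softPos_le {δ : ℝ} (hδ : 0 < δ) (t : ℝ) : |deriv (softPos δ) t| ≤ 1 := by
  have h1 : HasDerivAt (softPos δ) ((1 + t / √(t ^ 2 + δ ^ 2)) / 2) t :=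
    (((hasDerivAt_id t).add (hasDerivAt_sqrt_sq_add hδ t)).sub_const δ).div_const 2
  rw [h1.deriv]
  have h2 := abs_le.1 (abs_div_sqrt_sq_add_le hδ t)
  rw [abs_le]
  constructor <;> linarith

theorem softPos_zero {δ : ℝ} (hδ : 0 < δ) : softPos δ 0 = 0 := by
  simp [softPos, Real.sqrt_sq hδ.le]

theorem abs_softPos_sub_le {δ : ℝ} (hδ : 0 < δ) (t : ℝ) : |softPos δ t - max t 0| ≤ δ := by
  obtain ⟨h1, h2⟩ := sqrt_sq_add_mem hδ t
  have h3 : max t 0 = (t + |t|) / 2 := by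
    rcases le_total 0 t with h | h
    · rw [max_eq_left h, abs_of_nonneg h]; ring
    · rw [max_eq_right h, abs_of_nonpos h]; ring
  rw [h3, softPos, abs_le]
  constructor <;> linarith

/-- A smooth approximation of the unit contraction. -/
noncomputable def softClamp (δ t : ℝ) : ℝ := softPos δ 1 - softPos δ (1 - softPos δ t)

theorem contDiff_softClamp {δ : ℝ} (hδ : 0 < δ) : ContDiff ℝ 1 (softClamp δ) :=
  contDiff_const.sub ((contDiff_softPos hδ).comp (contDiff_const.sub (contDiff_softPos hδ)))

theorem abs_deriv_softClamp_le {δ : ℝ} (hδ : 0 < δ) (t : ℝ) : |deriv (softClamp δ) t| ≤ 1 := by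
  have hd : ∀ s, HasDerivAt (softPos δ) (deriv (softPos δ) s) s := fun s =>
    ((contDiff_softPos hδ).differentiable one_ne_zero s).hasDerivAt
  have h1 := ((hd (1 - softPos δ t)).comp t ((hd t).const_sub 1)).const_sub (softPos δ 1)
  have h2 : deriv (softClamp δ) t = _ := h1.deriv
  rw [h2, mul_neg, neg_neg, abs_mul]
  exact mul_le_one₀ (abs_deriv_softPos_le hδ _) (abs_nonneg _) (abs_deriv_softPos_le hδ _)

/-- Since `1 ∧ s = 1 - (1 - s)⁺`, the leading constant could be `1`. Using `softPos δ 1` instead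
fixes the origin, which the killing part needs for `|φ(t)| ≤ |t|`. -/
theorem softClamp_zero {δ : ℝ} (hδ : 0 < δ) : softClamp δ 0 = 0 := by
  simp [softClamp, softPos_zero hδ]

/-- Each of the three occurrences of `softPos` costs at most `δ`, since the outer maps are
contractions. -/
theorem abs_softClamp_sub_le {δ : ℝ} (hδ : 0 < δ) (t : ℝ) : |softClamp δ t - clamp t| ≤ 3 * δ := by
  have h1 := abs_le.1 (abs_softPos_sub_le hδ t)
  have h2 := abs_le.1 (abs_softPos_sub_le hδ 1)
  have h3 := abs_le.1 (abs_softPos_sub_le hδ (1 - softPos δ t))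
  rw [max_eq_left zero_le_one] at h2
  rw [softClamp, clamp, abs_le]
  rcases le_total 1 (max t 0) with h | h
  · rw [min_eq_left h]
    rcases le_total (1 - softPos δ t) 0 with h' | h'
    · rw [max_eq_right h'] at h3
      constructor <;> linarith
    · rw [max_eq_left h'] at h3
      constructor <;> linarith
  · rw [min_eq_right h]
    rcases le_total (1 - softPos δ t) 0 with h' | h'
    · rw [max_eq_right h'] at h3
      constructor <;> linarith
    · rw [max_eq_left h'] at h3
      constructor <;> linarith

theorem abs_sub_le_of_deriv_le {φ : ℝ → ℝ} (hφ : ContDiff ℝ 1 φ) (hd : ∀ t, |deriv φ t| ≤ 1)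
    (a b : ℝ) : |φ a - φ b| ≤ |a - b| := by
  have h1 := lipschitzWith_of_nnnorm_deriv_le (C := 1) (hφ.differentiable one_ne_zero) hd
  simpa [Real.dist_eq] using h1.dist_le_mul a b

end SmoothContractions

/-- An `L²`-Cauchy sequence which tends to zero almost everywhere along a subsequence tends to zero
in `L²`. -/
theorem tendsto_integral_sq_of_cauchy {Z : Type*} [MeasurableSpace Z] {ν : Measure Z}
    {g : ℕ → Z → ℝ} (hg : ∀ n, MemLp (g n) 2 ν)
    (hc : Tendsto (fun p : ℕ × ℕ => ∫ z, (g p.1 z - g p.2 z) ^ 2 ∂ν) atTop (𝓝 0))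
    {ns : ℕ → ℕ} (hns : Tendsto ns atTop atTop)
    (hae : ∀ᵐ z ∂ν, Tendsto (fun k => g (ns k) z) atTop (𝓝 0)) :
    Tendsto (fun n => ∫ z, g n z ^ 2 ∂ν) atTop (𝓝 0) := by
  let f : ℕ → Lp ℝ 2 ν := fun n => (hg n).toLp (g n)
  have hf : ∀ n, f n =ᵐ[ν] g n := fun n => (hg n).coeFn_toLp
  have hnorm : ∀ n k, ‖f n - f k‖ ^ 2 = ∫ z, (g n z - g k z) ^ 2 ∂ν := fun n k => by
    rw [norm_sq_H]
    refine integral_congr_ae ?_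
    filter_upwards [Lp.coeFn_sub (f n) (f k), hf n, hf k] with z h1 h2 h3
    rw [h1, Pi.sub_apply, h2, h3]
  have h1 : CauchySeq f := by
    rw [Metric.cauchySeq_iff]
    intro ε hε
    have h2 := (tendsto_order.1 hc).2 (ε ^ 2) (by positivity)
    rw [← prod_atTop_atTop_eq, eventually_prod_iff] at h2
    obtain ⟨p, hp, r, hr, hpr⟩ := h2
    obtain ⟨N, hN⟩ := eventually_atTop.1 (hp.and hr)
    refine ⟨N, fun m hm n hn => ?_⟩
    rw [dist_eq_norm]
    refine lt_of_pow_lt_pow_left₀ 2 hε.le ?_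
    rw [hnorm]
    exact hpr (hN m hm).1 (hN n hn).2
  obtain ⟨y, hy⟩ := cauchySeq_tendsto_of_complete h1
  -- A further subsequence converges almost everywhere to the `L²` limit, which must then be zero.
  -- This does not require a finite measure and so applies to infinite jump measures.
  have hm := tendstoInMeasure_of_tendsto_Lp (hy.comp hns)
  obtain ⟨ms, hms, hlim⟩ := hm.exists_seq_tendsto_ae
  have hy0 : y = 0 := by
    rw [Lp.eq_zero_iff_ae_eq_zero]
    have hall : ∀ᵐ z ∂ν, ∀ n, f n z = g n z := ae_all_iff.2 hf
    filter_upwards [hlim, hae, hall] with z h1 h2 h3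
    refine tendsto_nhds_unique h1 ?_
    simp only [Function.comp_apply, h3]
    exact h2.comp hms.tendsto_atTop
  rw [hy0] at hy
  have h2 := hy.norm.pow 2
  simp only [norm_zero, zero_pow two_ne_zero] at h2
  refine h2.congr fun n => ?_
  rw [norm_sq_H]
  exact integral_congr_ae ((hf n).mono fun z hz => by simp only [hz])

/-! ### Jump, killing and diffusion parts over a general state space. -/

section GeneralForm

variable {X Y M : Type*} [MeasurableSpace X] [MeasurableSpace M]

/-- The jump part. -/
noncomputable def jumpForm (J : Measure (X × X)) (e : X → Y) (u v : Y → ℝ) : ℝ :=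
  ∫ p, (u (e p.1) - u (e p.2)) * (v (e p.1) - v (e p.2)) ∂J

/-- The killing part. -/
noncomputable def killForm (Λ : Measure X) (V : X → ℝ) (e : X → Y) (u v : Y → ℝ) : ℝ :=
  ∫ x, u (e x) * v (e x) * V x ∂Λ

variable {m : X → Measure M}

/-- The energy density of the diffusion part. -/
noncomputable def energyDensity (A : ∀ x, Lp ℝ 2 (m x) →L[ℝ] Lp ℝ 2 (m x)) (e : X → Y)
    (d : (Y → ℝ) → Y → M → ℝ) (u v : Y → ℝ) (x : X) : ℝ :=
  inner ℝ (A x (toL2 (m x) (d u (e x)))) (toL2 (m x) (d v (e x)))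

/-- The diffusion part. -/
noncomputable def diffForm (Λ : Measure X) (A : ∀ x, Lp ℝ 2 (m x) →L[ℝ] Lp ℝ 2 (m x)) (e : X → Y)
    (d : (Y → ℝ) → Y → M → ℝ) (u v : Y → ℝ) : ℝ :=
  ∫ x, energyDensity A e d u v x ∂Λ

/-- The sum of the jump, killing and diffusion parts. -/
noncomputable def sumForm (Λ : Measure X) (J : Measure (X × X)) (V : X → ℝ)
    (A : ∀ x, Lp ℝ 2 (m x) →L[ℝ] Lp ℝ 2 (m x)) (e : X → Y)
    (d : (Y → ℝ) → Y → M → ℝ) (u v : Y → ℝ) : ℝ :=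
  jumpForm J e u v + killForm Λ V e u v + diffForm Λ A e d u v

/-- The integrability and linearity properties that make `sumForm` a bilinear form on `D`. -/
structure IsFormCore (D : Submodule ℝ (Y → ℝ)) (Λ : Measure X) (J : Measure (X × X)) (V : X → ℝ)
    (A : ∀ x, Lp ℝ 2 (m x) →L[ℝ] Lp ℝ 2 (m x)) (e : X → Y)
    (d : (Y → ℝ) → Y → M → ℝ) : Prop where
  pos : ∀ x, (A x).IsPositive
  d_add : ∀ u ∈ D, ∀ v ∈ D, d (u + v) = d u + d v
  d_smul : ∀ (c : ℝ), ∀ u ∈ D, d (c • u) = c • d u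
  d_memLp : ∀ u ∈ D, ∀ x, MemLp (d u (e x)) 2 (m x)
  integrable_energy : ∀ u ∈ D, ∀ v ∈ D, Integrable (energyDensity A e d u v) Λ
  jump_memLp : ∀ u ∈ D, MemLp (fun p : X × X => u (e p.1) - u (e p.2)) 2 J
  V_nonneg : 0 ≤ᵐ[Λ] V
  V_integrable : Integrable V Λ
  bdd : ∀ u ∈ D, ∃ C : ℝ, ∀ x, |u (e x)| ≤ C
  meas : ∀ u ∈ D, Measurable fun x => u (e x)
  J_ac : J ≪ Λ.prod Λ
  chain : ∀ u ∈ D, ∀ φ : ℝ → ℝ, ContDiff ℝ 1 φ → (fun y => φ (u y)) ∈ D ∧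
    ∀ y z, d (fun y => φ (u y)) y z = deriv φ (u y) * d u y z

namespace IsFormCore

variable {D : Submodule ℝ (Y → ℝ)} {Λ : Measure X} {J : Measure (X × X)} {V : X → ℝ}
  {A : ∀ x, Lp ℝ 2 (m x) →L[ℝ] Lp ℝ 2 (m x)} {e : X → Y} {d : (Y → ℝ) → Y → M → ℝ}

theorem toL2_add {ν : Measure M} {f g : M → ℝ} (hf : MemLp f 2 ν) (hg : MemLp g 2 ν) :
    toL2 ν (f + g) = toL2 ν f + toL2 ν g := by
  rw [toL2, toL2, toL2, dif_pos hf, dif_pos hg, dif_pos (hf.add hg), MemLp.toLp_add]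

theorem toL2_smul {ν : Measure M} {f : M → ℝ} (c : ℝ) (hf : MemLp f 2 ν) :
    toL2 ν (c • f) = c • toL2 ν f := by
  rw [toL2, toL2, dif_pos hf, dif_pos (hf.const_smul c), MemLp.toLp_const_smul]

theorem norm_toL2_le {ν : Measure M} {f : M → ℝ} {C : ℝ} (hC : 0 ≤ C)
    (hf : eLpNorm f 2 ν ≤ ENNReal.ofReal C) : ‖toL2 ν f‖ ≤ C := by
  by_cases h : MemLp f 2 ν
  · rw [toL2, dif_pos h, Lp.norm_toLp]
    exact ENNReal.toReal_le_of_le_ofReal hC hf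
  · rw [toL2, dif_neg h, norm_zero]
    exact hC

theorem energy_add (S : IsFormCore D Λ J V A e d) {u v w : Y → ℝ} (hu : u ∈ D) (hv : v ∈ D)
    (x : X) : energyDensity A e d (u + v) w x
      = energyDensity A e d u w x + energyDensity A e d v w x := by
  rw [energyDensity, S.d_add u hu v hv, Pi.add_apply, toL2_add (S.d_memLp u hu x)
    (S.d_memLp v hv x), map_add, inner_add_left]
  rfl

theorem energy_smul (S : IsFormCore D Λ J V A e d) (c : ℝ) {u w : Y → ℝ} (hu : u ∈ D)
    (x : X) : energyDensity A e d (c • u) w x = c * energyDensity A e d u w x := by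
  rw [energyDensity, S.d_smul c u hu, Pi.smul_apply, toL2_smul c (S.d_memLp u hu x), map_smul,
    real_inner_smul_left]
  rfl

theorem energy_symm (S : IsFormCore D Λ J V A e d) (u v : Y → ℝ) (x : X) :
    energyDensity A e d u v x = energyDensity A e d v u x := by
  rw [energyDensity, energyDensity, real_inner_comm]
  exact ((S.pos x).isSymmetric _ _).symm

theorem energy_nonneg (S : IsFormCore D Λ J V A e d) (u : Y → ℝ) (x : X) :
    0 ≤ energyDensity A e d u u x :=
  (S.pos x).inner_nonneg_left _

theorem integrable_jump (S : IsFormCore D Λ J V A e d) {u v : Y → ℝ} (hu : u ∈ D) (hv : v ∈ D) :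
    Integrable (fun p : X × X => (u (e p.1) - u (e p.2)) * (v (e p.1) - v (e p.2))) J :=
  (S.jump_memLp u hu).integrable_mul (S.jump_memLp v hv)

theorem integrable_kill (S : IsFormCore D Λ J V A e d) {u v : Y → ℝ} (hu : u ∈ D) (hv : v ∈ D) :
    Integrable (fun x => u (e x) * v (e x) * V x) Λ := by
  obtain ⟨C, hC⟩ := S.bdd u hu
  obtain ⟨C', hC'⟩ := S.bdd v hv
  refine S.V_integrable.bdd_mul (c := C * C')
    ((S.meas u hu).mul (S.meas v hv)).aestronglyMeasurable (Eventually.of_forall fun x => ?_)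
  rw [Real.norm_eq_abs, abs_mul]
  exact mul_le_mul (hC x) (hC' x) (abs_nonneg _) ((abs_nonneg _).trans (hC x))

theorem sumForm_add (S : IsFormCore D Λ J V A e d) {u v w : Y → ℝ} (hu : u ∈ D) (hv : v ∈ D)
    (hw : w ∈ D) :
    sumForm Λ J V A e d (u + v) w = sumForm Λ J V A e d u w + sumForm Λ J V A e d v w := by
  have h1 : jumpForm J e (u + v) w = jumpForm J e u w + jumpForm J e v w := by
    rw [jumpForm, jumpForm, jumpForm,
      ← integral_add (S.integrable_jump hu hw) (S.integrable_jump hv hw)]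
    refine integral_congr_ae (Eventually.of_forall fun p => ?_)
    simp only [Pi.add_apply]
    ring
  have h2 : killForm Λ V e (u + v) w = killForm Λ V e u w + killForm Λ V e v w := by
    rw [killForm, killForm, killForm,
      ← integral_add (S.integrable_kill hu hw) (S.integrable_kill hv hw)]
    refine integral_congr_ae (Eventually.of_forall fun p => ?_)
    simp only [Pi.add_apply]
    ring
  have h3 : diffForm Λ A e d (u + v) w = diffForm Λ A e d u w + diffForm Λ A e d v w := by
    rw [diffForm, diffForm, diffForm,
      ← integral_add (S.integrable_energy u hu w hw) (S.integrable_energy v hv w hw)]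
    exact integral_congr_ae (Eventually.of_forall fun x => S.energy_add hu hv x)
  rw [sumForm, sumForm, sumForm, h1, h2, h3]
  ring

theorem sumForm_smul (S : IsFormCore D Λ J V A e d) (c : ℝ) {u w : Y → ℝ} (hu : u ∈ D) :
    sumForm Λ J V A e d (c • u) w = c * sumForm Λ J V A e d u w := by
  rw [sumForm, sumForm, mul_add, mul_add]
  congr 1
  · congr 1
    · rw [jumpForm, jumpForm, ← integral_const_mul]
      refine integral_congr_ae (Eventually.of_forall fun p => ?_)
      simp only [Pi.smul_apply, smul_eq_mul]
      ring
    · rw [killForm, killForm, ← integral_const_mul]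
      refine integral_congr_ae (Eventually.of_forall fun p => ?_)
      simp only [Pi.smul_apply, smul_eq_mul]
      ring
  · rw [diffForm, diffForm, ← integral_const_mul]
    exact integral_congr_ae (Eventually.of_forall fun x => S.energy_smul c hu x)

theorem sumForm_symm (S : IsFormCore D Λ J V A e d) (u v : Y → ℝ) :
    sumForm Λ J V A e d u v = sumForm Λ J V A e d v u := by
  simp only [sumForm, jumpForm, killForm, diffForm]
  congr 1
  · congr 1
    · exact integral_congr_ae (Eventually.of_forall fun p => mul_comm _ _)
    · exact integral_congr_ae (Eventually.of_forall fun p => by simp only [mul_comm (u (e p))])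
  · exact integral_congr_ae (Eventually.of_forall fun x => S.energy_symm u v x)

theorem parts_nonneg (S : IsFormCore D Λ J V A e d) (u : Y → ℝ) :
    0 ≤ jumpForm J e u u ∧ 0 ≤ killForm Λ V e u u ∧ 0 ≤ diffForm Λ A e d u u := by
  refine ⟨integral_nonneg fun p => mul_self_nonneg _, ?_, integral_nonneg fun x =>
    S.energy_nonneg u x⟩
  refine integral_nonneg_of_ae ?_
  filter_upwards [S.V_nonneg] with x hx
  exact mul_nonneg (mul_self_nonneg _) hx

theorem sumForm_nonneg (S : IsFormCore D Λ J V A e d) (u : Y → ℝ) :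
    0 ≤ sumForm Λ J V A e d u u := by
  obtain ⟨h1, h2, h3⟩ := S.parts_nonneg u
  rw [sumForm]
  positivity

/-- The form is closable if its diffusion part is. -/
theorem isClosable [IsFiniteMeasure Λ] (S : IsFormCore D Λ J V A e d)
    (hd : IsClosable Λ (D : Set (Y → ℝ)) (fun u x => u (e x)) (diffForm Λ A e d)) :
    IsClosable Λ (D : Set (Y → ℝ)) (fun u x => u (e x)) (sumForm Λ J V A e d) := by
  intro u hu h0 hc
  -- All three parts are nonnegative, so a Cauchy sequence for the sum is Cauchy for each part.
  have hp := fun p : ℕ × ℕ => S.parts_nonneg (u p.1 - u p.2)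
  have hcJ : Tendsto (fun p : ℕ × ℕ => jumpForm J e (u p.1 - u p.2) (u p.1 - u p.2)) atTop (𝓝 0) :=
    squeeze_zero (fun p => (hp p).1) (fun p => by rw [sumForm]; linarith [hp p]) hc
  have hcV : Tendsto (fun p : ℕ × ℕ => killForm Λ V e (u p.1 - u p.2) (u p.1 - u p.2)) atTop
      (𝓝 0) :=
    squeeze_zero (fun p => (hp p).2.1) (fun p => by rw [sumForm]; linarith [hp p]) hc
  have hcA : Tendsto (fun p : ℕ × ℕ => diffForm Λ A e d (u p.1 - u p.2) (u p.1 - u p.2)) atTop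
      (𝓝 0) :=
    squeeze_zero (fun p => (hp p).2.2) (fun p => by rw [sumForm]; linarith [hp p]) hc
  have hA := hd u hu h0 hcA
  have hm : TendstoInMeasure Λ (fun n x => u n (e x)) atTop fun _ => (0 : ℝ) := by
    refine tendstoInMeasure_of_tendsto_eLpNorm (p := 2) two_ne_zero
      (fun n => (S.meas _ (hu n)).aestronglyMeasurable) aestronglyMeasurable_const ?_
    simpa [Pi.sub_def] using h0
  obtain ⟨ns, hns, hae⟩ := hm.exists_seq_tendsto_ae
  have hJ : Tendsto (fun n => jumpForm J e (u n) (u n)) atTop (𝓝 0) := by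
    have h1 := tendsto_integral_sq_of_cauchy (fun n => S.jump_memLp _ (hu n)) ?_ hns.tendsto_atTop
      (ν := J) ?_
    · refine h1.congr fun n => ?_
      simp only [sq]
      rfl
    · refine hcJ.congr fun p => ?_
      rw [jumpForm]
      refine integral_congr_ae (Eventually.of_forall fun q => ?_)
      simp only [Pi.sub_apply]
      ring
    -- Absolute continuity with respect to the product transfers almost everywhere convergence in
    -- each variable to `J`.
    · refine S.J_ac.ae_le ?_
      filter_upwards [Measure.quasiMeasurePreserving_fst.ae hae,
        Measure.quasiMeasurePreserving_snd.ae hae] with p h1 h2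
      simpa using h1.sub h2
  have hV : Tendsto (fun n => killForm Λ V e (u n) (u n)) atTop (𝓝 0) := by
    -- The killing energy is the squared norm in `L²(VΛ)`, and `VΛ` is finite.
    let ν : Measure X := Λ.withDensity fun x => ENNReal.ofReal (V x)
    have : IsFiniteMeasure ν := isFiniteMeasure_withDensity_ofReal S.V_integrable.2
    have hint : ∀ f : X → ℝ, ∫ x, f x * f x * V x ∂Λ = ∫ x, f x ^ 2 ∂ν := fun f => by
      rw [integral_withDensity_eq_integral_toReal_smul₀
        S.V_integrable.1.aemeasurable.ennreal_ofReal
        (Eventually.of_forall fun x => ENNReal.ofReal_lt_top)]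
      refine integral_congr_ae ?_
      filter_upwards [S.V_nonneg] with x hx
      rw [ENNReal.toReal_ofReal hx, smul_eq_mul]
      ring
    have h1 := tendsto_integral_sq_of_cauchy (ν := ν) (g := fun n x => u n (e x)) (fun n => ?_) ?_
      hns.tendsto_atTop ((withDensity_absolutelyContinuous _ _).ae_le hae)
    · exact h1.congr fun n => (hint _).symm
    · obtain ⟨C, hC⟩ := S.bdd _ (hu n)
      exact MemLp.of_bound (S.meas _ (hu n)).aestronglyMeasurable C (Eventually.of_forall hC)
    · refine hcV.congr fun p => ?_
      rw [killForm, hint]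
      rfl
  have := (hJ.add hV).add hA
  simpa [sumForm] using this

/-- The form decreases under smooth contractions. -/
theorem sumForm_comp_le (S : IsFormCore D Λ J V A e d) {u : Y → ℝ} (hu : u ∈ D) {φ : ℝ → ℝ}
    (hφ : ContDiff ℝ 1 φ) (hφ' : ∀ t, |deriv φ t| ≤ 1) (h0 : φ 0 = 0) :
    sumForm Λ J V A e d (fun y => φ (u y)) (fun y => φ (u y)) ≤ sumForm Λ J V A e d u u := by
  obtain ⟨hφu, hchain⟩ := S.chain u hu φ hφ
  have hlip := abs_sub_le_of_deriv_le hφ hφ'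
  refine add_le_add (add_le_add ?_ ?_) ?_
  · refine integral_mono (S.integrable_jump hφu hφu) (S.integrable_jump hu hu) fun p => ?_
    exact abs_le_iff_mul_self_le.1 (hlip _ _)
  · refine integral_mono_ae (S.integrable_kill hφu hφu) (S.integrable_kill hu hu) ?_
    filter_upwards [S.V_nonneg] with x hx
    refine mul_le_mul_of_nonneg_right (abs_le_iff_mul_self_le.1 ?_) hx
    simpa [h0] using hlip (u (e x)) 0
  · refine integral_mono (S.integrable_energy _ hφu _ hφu) (S.integrable_energy _ hu _ hu)
      fun x => ?_
    have h1 : d (fun y => φ (u y)) (e x) = deriv φ (u (e x)) • d u (e x) := by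
      ext z
      rw [hchain, Pi.smul_apply, smul_eq_mul]
    -- At a fixed measure the chain-rule factor is a scalar, so the energy density is multiplied by
    -- a square that is at most one.
    have h2 : energyDensity A e d (fun y => φ (u y)) (fun y => φ (u y)) x
        = deriv φ (u (e x)) ^ 2 * energyDensity A e d u u x := by
      rw [energyDensity, h1, toL2_smul _ (S.d_memLp u hu x), map_smul, real_inner_smul_left,
        real_inner_smul_right, energyDensity]
      ring
    rw [h2]
    have h3 : deriv φ (u (e x)) ^ 2 ≤ 1 := by
      rw [← sq_abs]
      exact pow_le_one₀ (abs_nonneg _) (hφ' _)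
    have h4 := S.energy_nonneg u x
    nlinarith

theorem exists_markov (S : IsFormCore D Λ J V A e d) {u : Y → ℝ} (hu : u ∈ D) {ε : ℝ}
    (hε : 0 < ε) : ∃ w ∈ D, sumForm Λ J V A e d w w ≤ sumForm Λ J V A e d u u ∧
      (∀ y, |w y - clamp (u y)| ≤ ε) := by
  have hδ : 0 < ε / 3 := by positivity
  refine ⟨fun y => softClamp (ε / 3) (u y), (S.chain u hu _ (contDiff_softClamp hδ)).1,
    S.sumForm_comp_le hu (contDiff_softClamp hδ) (abs_deriv_softClamp_le hδ)
      (softClamp_zero hδ), fun y => ?_⟩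
  refine (abs_softClamp_sub_le hδ _).trans (le_of_eq ?_)
  ring

end IsFormCore

end GeneralForm

/-! ### Measurability and integrability of the energy density. -/

section Energy

variable {X M : Type*} [MeasurableSpace X] [MeasurableSpace M]

/-- The masses `m x` may be unbounded. Dividing by `m x univ + 1` gives a uniformly finite kernel,
to which measurability of parameter integrals applies; the factor is then restored. -/
theorem measurable_integral_of_finite {m : X → Measure M} [∀ x, IsFiniteMeasure (m x)]
    (hm : Measurable m) {f : X × M → ℝ} (hf : Measurable f) :
    Measurable fun x => ∫ y, f (x, y) ∂(m x) := by
  have hmu : Measurable fun x => m x Set.univ := (Measure.measurable_coe MeasurableSet.univ).comp hm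
  have hκ : Measurable fun x => (m x Set.univ + 1)⁻¹ • m x := by
    refine Measure.measurable_of_measurable_coe _ fun s hs => ?_
    simp only [Measure.smul_apply, smul_eq_mul]
    exact (hmu.add_const 1).inv.mul ((Measure.measurable_coe hs).comp hm)
  let κ : ProbabilityTheory.Kernel X M := ⟨_, hκ⟩
  have : ProbabilityTheory.IsFiniteKernel κ := ⟨⟨1, ENNReal.one_lt_top, fun x => by
    change ((m x Set.univ + 1)⁻¹ • m x) Set.univ ≤ 1
    rw [Measure.smul_apply, smul_eq_mul, mul_comm, ← div_eq_mul_inv]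
    exact ENNReal.div_le_of_le_mul (by rw [one_mul]; exact le_self_add)⟩⟩
  have h1 : Measurable fun x => ∫ y, f (x, y) ∂(κ x) :=
    (hf.stronglyMeasurable.integral_kernel_prod_right' (κ := κ)).measurable
  have h2 := ((hmu.add_const 1).ennreal_toReal).mul h1
  convert h2 using 1
  funext x
  symm
  change (m x Set.univ + 1).toReal * ∫ y, f (x, y) ∂((m x Set.univ + 1)⁻¹ • m x) = _
  have h3 : (m x Set.univ + 1).toReal ≠ 0 :=
    (ENNReal.toReal_pos (by simp) (by simp)).ne'
  rw [integral_smul_measure, ENNReal.toReal_inv, smul_eq_mul, mul_inv_cancel_left₀ h3]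

/-- The inner product is `∫ G(x, ·) b(x, ·) d(m x)` for a jointly measurable version `G`, and is
dominated by a multiple of the integrable operator norm. -/
theorem integrable_inner_of_measurable {Λ : Measure X} {m : X → Measure M}
    [∀ x, IsFiniteMeasure (m x)] (hm : Measurable m) {A : ∀ x, Lp ℝ 2 (m x) →L[ℝ] Lp ℝ 2 (m x)}
    (hA : Integrable (fun x => ‖A x‖) Λ) {a b : X → M → ℝ} {G : X × M → ℝ} (hG : Measurable G)
    (hAG : ∀ x, A x (toL2 (m x) (a x)) =ᵐ[m x] fun y => G (x, y))
    (hb : Measurable fun p : X × M => b p.1 p.2) (hb2 : ∀ x, MemLp (b x) 2 (m x)) {K L : ℝ}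
    (hK : ∀ x, ‖toL2 (m x) (a x)‖ ≤ K) (hL : ∀ x, ‖toL2 (m x) (b x)‖ ≤ L) :
    Integrable (fun x => inner ℝ (A x (toL2 (m x) (a x))) (toL2 (m x) (b x))) Λ := by
  refine (hA.mul_const (K * L)).mono' ?_ (Eventually.of_forall fun x => ?_)
  · refine Measurable.aestronglyMeasurable ?_
    convert measurable_integral_of_finite hm (hG.mul hb) using 1
    funext x
    rw [L2.inner_def]
    refine integral_congr_ae ?_
    have h1 : toL2 (m x) (b x) =ᵐ[m x] b x := by
      rw [toL2, dif_pos (hb2 x)]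
      exact MemLp.coeFn_toLp _
    filter_upwards [hAG x, h1] with y h2 h3
    simp [h2, h3, mul_comm]
  · refine (norm_inner_le_norm _ _).trans ?_
    have h1 : ‖A x (toL2 (m x) (a x))‖ ≤ ‖A x‖ * K :=
      ((A x).le_opNorm _).trans (mul_le_mul_of_nonneg_left (hK x) (norm_nonneg _))
    calc _ ≤ (‖A x‖ * K) * L := mul_le_mul h1 (hL x) (norm_nonneg _) ((norm_nonneg _).trans h1)
      _ = _ := mul_assoc _ _ _

end Energy

theorem sq_sub_le_min {X : Type*} [PseudoMetricSpace X] {g : X → ℝ} {C : ℝ} (hC : ∀ x, |g x| ≤ C)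
    (hl : ∀ x y, |g x - g y| ≤ 2 * C * dist x y) (x y : X) :
    (g x - g y) ^ 2 ≤ 4 * C ^ 2 * min 1 (dist x y ^ 2) := by
  have h0 : 0 ≤ C := (abs_nonneg _).trans (hC x)
  have h1 : |g x - g y| ≤ 2 * C := by
    have h1 := abs_le.1 (hC x)
    have h2 := abs_le.1 (hC y)
    rw [abs_le]
    constructor <;> linarith
  rw [← sq_abs]
  rcases min_cases (1 : ℝ) (dist x y ^ 2) with ⟨h, _⟩ | ⟨h, _⟩ <;> rw [h]
  · nlinarith [abs_nonneg (g x - g y)]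
  · have h2 := pow_le_pow_left₀ (abs_nonneg _) (hl x y) 2
    linarith [mul_pow (2 * C) (dist x y) 2, mul_pow 2 C 2]

/-! ### Finite jump energy and uniform energy bounds. -/

section Jump

variable {X : Type*} [PseudoMetricSpace X] [SecondCountableTopology X] [MeasurableSpace X]
  [BorelSpace X]

theorem integrable_min_dist_sq {J : Measure (X × X)}
    (hJ : ∫⁻ p, ENNReal.ofReal (min 1 (dist p.1 p.2 ^ 2)) ∂J < ∞) :
    Integrable (fun p : X × X => min 1 (dist p.1 p.2 ^ 2)) J := by
  refine ⟨?_, ?_⟩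
  · exact (measurable_const.min ((measurable_fst.dist measurable_snd).pow_const 2)).aestronglyMeasurable
  · rw [hasFiniteIntegral_iff_ofReal (Eventually.of_forall fun p => by positivity)]
    exact hJ

theorem memLp_jump {J : Measure (X × X)}
    (hJ : ∫⁻ p, ENNReal.ofReal (min 1 (dist p.1 p.2 ^ 2)) ∂J < ∞) {g : X → ℝ} (hg : Measurable g)
    {C : ℝ} (hC : ∀ x, |g x| ≤ C) (hl : ∀ x y, |g x - g y| ≤ 2 * C * dist x y) :
    MemLp (fun p : X × X => g p.1 - g p.2) 2 J := by
  have hm : Measurable fun p : X × X => g p.1 - g p.2 :=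
    (hg.comp measurable_fst).sub (hg.comp measurable_snd)
  rw [memLp_two_iff_integrable_sq hm.aestronglyMeasurable]
  refine ((integrable_min_dist_sq hJ).const_mul (4 * C ^ 2)).mono'
    (hm.pow_const 2).aestronglyMeasurable (Eventually.of_forall fun p => ?_)
  rw [Real.norm_eq_abs, abs_of_nonneg (sq_nonneg _)]
  exact sq_sub_le_min hC hl p.1 p.2

/-- The bound depends on `u` only through `C`. A class with common sup, Lipschitz and gradient
bounds thus has uniformly bounded energy. -/
theorem IsFormCore.sumForm_le {Y M : Type*} [MeasurableSpace M] {m : X → Measure M}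
    {D : Submodule ℝ (Y → ℝ)} {Λ : Measure X} {J : Measure (X × X)} {V : X → ℝ}
    {A : ∀ x, Lp ℝ 2 (m x) →L[ℝ] Lp ℝ 2 (m x)} {e : X → Y} {d : (Y → ℝ) → Y → M → ℝ}
    (S : IsFormCore D Λ J V A e d)
    (hJ : ∫⁻ p, ENNReal.ofReal (min 1 (dist p.1 p.2 ^ 2)) ∂J < ∞)
    (hA : Integrable (fun x => ‖A x‖) Λ) {u : Y → ℝ} (hu : u ∈ D) {C : ℝ}
    (hC : ∀ x, |u (e x)| ≤ C) (hl : ∀ x y, |u (e x) - u (e y)| ≤ 2 * C * dist x y)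
    (hd : ∀ x, ‖toL2 (m x) (d u (e x))‖ ≤ C) :
    sumForm Λ J V A e d u u ≤
      C ^ 2 * (4 * ∫ p, min 1 (dist p.1 p.2 ^ 2) ∂J) + C ^ 2 * ∫ x, V x ∂Λ
        + C ^ 2 * ∫ x, ‖A x‖ ∂Λ := by
  refine add_le_add (add_le_add ?_ ?_) ?_
  · rw [← mul_assoc, ← integral_const_mul]
    refine integral_mono (S.integrable_jump hu hu) ((integrable_min_dist_sq hJ).const_mul _)
      fun p => ?_
    have := sq_sub_le_min hC hl p.1 p.2
    simp only
    nlinarith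
  · rw [← integral_const_mul]
    refine integral_mono_ae (S.integrable_kill hu hu) (S.V_integrable.const_mul _) ?_
    filter_upwards [S.V_nonneg] with x hx
    refine mul_le_mul_of_nonneg_right ?_ hx
    rw [← sq, ← sq_abs]
    exact pow_le_pow_left₀ (abs_nonneg _) (hC x) 2
  · rw [← integral_const_mul]
    refine integral_mono (S.integrable_energy u hu u hu) (hA.const_mul _) fun x => ?_
    refine (real_inner_le_norm _ _).trans ?_
    have h1 := hd x
    have h2 := (A x).le_opNorm (toL2 (m x) (d u (e x)))
    have h3 := norm_nonneg (toL2 (m x) (d u (e x)))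
    have h4 := norm_nonneg (A x)
    calc _ ≤ (‖A x‖ * ‖toL2 (m x) (d u (e x))‖) * ‖toL2 (m x) (d u (e x))‖ :=
          mul_le_mul_of_nonneg_right h2 h3
      _ = ‖toL2 (m x) (d u (e x))‖ ^ 2 * ‖A x‖ := by ring
      _ ≤ C ^ 2 * ‖A x‖ := mul_le_mul_of_nonneg_right (pow_le_pow_left₀ h3 h1 2) h4

end Jump

/-- Precomposition as a homomorphism of algebras of functions. -/
def compRightAlgHom {X Y : Type*} (e : X → Y) : (Y → ℝ) →ₐ[ℝ] (X → ℝ) where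
  toFun g x := g (e x)
  map_one' := rfl
  map_mul' _ _ := rfl
  map_zero' := rfl
  map_add' _ _ := rfl
  commutes' _ := rfl

/-- An algebra of functions on a Polish space which contains countably many bounded continuous
functions that separate the points is dense in `L²`. -/
theorem dense_of_separating {X : Type*} [TopologicalSpace X] [PolishSpace X] [MeasurableSpace X]
    [BorelSpace X] {Λ : Measure X} [IsFiniteMeasure Λ] (P : Subalgebra ℝ (X → ℝ)) (g : ℕ → X → ℝ)
    (hg : ∀ n, Continuous (g n)) (hb : ∀ n, ∃ c : ℝ, ∀ x, |g n x| ≤ c) (hgP : ∀ n, g n ∈ P)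
    (hsep : ∀ x y, (∀ n, g n x = g n y) → x = y) {f : X → ℝ} (hf : MemLp f 2 Λ) {ε : ℝ}
    (hε : 0 < ε) : ∃ p ∈ P, eLpNorm (f - p) 2 Λ ≤ ENNReal.ofReal ε := by
  choose c hc using hb
  -- The separating functions map the Polish space injectively into a compact product of intervals,
  -- and such a continuous injection is a measurable embedding. On the product, bounded continuous
  -- functions are dense in `L²` and Stone–Weierstrass applies.
  let Q := ∀ n : ℕ, Set.Icc (-c n) (c n)
  let Φ : X → Q := fun x n => ⟨g n x, abs_le.1 (hc n x)⟩
  have hΦc : Continuous Φ := continuous_pi fun n => (hg n).subtype_mk _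
  have hΦi : Function.Injective Φ := fun x y hxy => hsep x y fun n =>
    congrArg Subtype.val (congrFun hxy n)
  have hΦ : MeasurableEmbedding Φ := hΦc.measurableEmbedding hΦi
  have hext : Function.extend Φ f 0 ∘ Φ = f := funext fun x => hΦi.extend_apply _ _ _
  have hf' : MemLp (Function.extend Φ f 0) 2 (Λ.map Φ) := by
    rw [hΦ.memLp_map_measure_iff, hext]
    exact hf
  obtain ⟨k, hk, -⟩ := hf'.exists_boundedContinuous_eLpNorm_sub_le (by norm_num)
    (ε := ENNReal.ofReal (ε / 2)) (by simpa using hε)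
  rw [hΦ.eLpNorm_map_measure] at hk
  let S : Subalgebra ℝ C(Q, ℝ) := P.comap
    ((compRightAlgHom Φ).comp (ContinuousMap.coeFnAlgHom ℝ))
  have hS : S.SeparatesPoints := by
    intro a b hab
    obtain ⟨n, hn⟩ := Function.ne_iff.1 hab
    refine ⟨fun q => (q n : ℝ), ⟨⟨fun q => (q n : ℝ), by fun_prop⟩, hgP n, rfl⟩, fun h => hn ?_⟩
    exact Subtype.ext h
  have hmass : 0 ≤ (Λ Set.univ).toReal := ENNReal.toReal_nonneg
  -- A uniform error `r` costs `r Λ(X)^(1/2)` in `L²`; the added `1` avoids dividing by zero if `Λ`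
  -- vanishes.
  let r : ℝ := ε / 2 / ((Λ Set.univ ^ (1 / 2 : ℝ)).toReal + 1)
  have hr : 0 < r := by positivity
  obtain ⟨⟨p, hpS⟩, hp⟩ := ContinuousMap.exists_mem_subalgebra_near_continuousMap_of_separatesPoints
    S hS k.toContinuousMap r hr
  refine ⟨fun x => p (Φ x), hpS, ?_⟩
  have h1 : f - (fun x => p (Φ x)) = (f - fun x => k (Φ x)) + fun x => k (Φ x) - p (Φ x) := by
    ext x
    simp
  have hfin : Λ Set.univ ^ (1 / 2 : ℝ) ≠ ∞ :=
    ENNReal.rpow_ne_top_of_nonneg (by norm_num) (measure_ne_top _ _)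
  have h2 : eLpNorm (fun x => k (Φ x) - p (Φ x)) 2 Λ ≤ ENNReal.ofReal (ε / 2) := by
    refine (eLpNorm_le_of_ae_bound (C := r) (Eventually.of_forall fun x => ?_)).trans ?_
    · have h3 := (ContinuousMap.norm_coe_le_norm (p - k.toContinuousMap) (Φ x)).trans hp.le
      rw [norm_sub_rev]
      exact h3
    · have h4 : ((2 : ℝ≥0∞).toReal)⁻¹ = (1 / 2 : ℝ) := by norm_num
      rw [h4, ← ENNReal.ofReal_toReal hfin, ← ENNReal.ofReal_mul ENNReal.toReal_nonneg]
      refine ENNReal.ofReal_le_ofReal ?_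
      have h5 : r * ((Λ Set.univ ^ (1 / 2 : ℝ)).toReal + 1) = ε / 2 :=
        div_mul_cancel₀ _ (by positivity)
      nlinarith
  rw [h1]
  refine (eLpNorm_add_le (hf.1.sub ?_) ?_ (by norm_num)).trans ?_
  · exact (k.continuous.comp hΦc).measurable.aestronglyMeasurable
  · exact ((k.continuous.comp hΦc).sub (p.continuous.comp hΦc)).measurable.aestronglyMeasurable
  · have h6 : eLpNorm (f - fun x => k (Φ x)) 2 Λ ≤ ENNReal.ofReal (ε / 2) := by
      refine le_trans (le_of_eq ?_) hk
      congr 1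
      ext x
      simp [hΦi.extend_apply]
    calc _ ≤ ENNReal.ofReal (ε / 2) + ENNReal.ofReal (ε / 2) := add_le_add h6 h2
      _ = _ := by rw [← ENNReal.ofReal_add (by positivity) (by positivity), add_halves]

/-! ### Limits in `L²` of functions from a lattice-like class. -/

section Approximable

/-- The functions `v` on `X` which are limits in `L²(Λ)` of `u ∘ e` with `u ∈ B`. -/
def Approximable {X Y : Type*} [MeasurableSpace X] (Λ : Measure X) (e : X → Y) (B : Set (Y → ℝ)) :
    Set (X → ℝ) :=
  {v | AEStronglyMeasurable v Λ ∧
    ∀ ε : ℝ, 0 < ε → ∃ u ∈ B, eLpNorm ((fun x => u (e x)) - v) 2 Λ ≤ ENNReal.ofReal ε}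

/-- A set of functions that is stable under negation and under approximate maxima. -/
structure IsLatticeLike {X Y : Type*} [MeasurableSpace X] (e : X → Y) (B : Set (Y → ℝ)) :
    Prop where
  meas : ∀ u ∈ B, Measurable fun x => u (e x)
  neg : ∀ u ∈ B, -u ∈ B
  approx_max : ∀ u ∈ B, ∀ v ∈ B, ∀ ε : ℝ, 0 < ε → ∃ w ∈ B, ∀ y, |w y - max (u y) (v y)| ≤ ε

variable {X Y : Type*} [MeasurableSpace X] {Λ : Measure X} {e : X → Y} {B : Set (Y → ℝ)}

theorem IsLatticeLike.mem_approximable (hB : IsLatticeLike e B) {u : Y → ℝ} (hu : u ∈ B) :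
    (fun x => u (e x)) ∈ Approximable Λ e B :=
  ⟨(hB.meas u hu).aestronglyMeasurable, fun ε hε => ⟨u, hu, by simp⟩⟩

theorem IsLatticeLike.approximable_neg (hB : IsLatticeLike e B) {v : X → ℝ}
    (hv : v ∈ Approximable Λ e B) : (fun x => -v x) ∈ Approximable Λ e B := by
  refine ⟨hv.1.neg, fun ε hε => ?_⟩
  obtain ⟨u, hu, h⟩ := hv.2 ε hε
  refine ⟨-u, hB.neg u hu, le_trans (le_of_eq ?_) h⟩
  rw [← eLpNorm_neg]
  congr 1
  ext x
  simp [add_comm, sub_eq_add_neg]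

theorem IsLatticeLike.approximable_max [IsFiniteMeasure Λ] (hB : IsLatticeLike e B) {v w : X → ℝ}
    (hv : v ∈ Approximable Λ e B) (hw : w ∈ Approximable Λ e B) :
    (fun x => max (v x) (w x)) ∈ Approximable Λ e B := by
  refine ⟨hv.1.sup hw.1, fun ε hε => ?_⟩
  obtain ⟨a, ha, hva⟩ := hv.2 (ε / 3) (by positivity)
  obtain ⟨b, hb, hwb⟩ := hw.2 (ε / 3) (by positivity)
  have hfin : Λ Set.univ ^ (1 / 2 : ℝ) ≠ ∞ :=
    ENNReal.rpow_ne_top_of_nonneg (by norm_num) (measure_ne_top _ _)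
  let r : ℝ := ε / 3 / ((Λ Set.univ ^ (1 / 2 : ℝ)).toReal + 1)
  have hr : 0 < r := by positivity
  obtain ⟨c, hc, hcm⟩ := hB.approx_max a ha b hb r hr
  refine ⟨c, hc, ?_⟩
  have hma := hB.meas a ha
  have hmb := hB.meas b hb
  have h1 : eLpNorm ((fun x => c (e x)) - fun x => max (v x) (w x)) 2 Λ ≤
      eLpNorm ((fun x => |a (e x) - v x|) + ((fun x => |b (e x) - w x|) + fun _ => r)) 2 Λ := by
    refine eLpNorm_mono fun x => ?_
    have h2 := abs_le.1 (hcm (e x))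
    have h3 := abs_le.1 (abs_max_sub_max_le_max (a (e x)) (b (e x)) (v x) (w x))
    have h4 : max |a (e x) - v x| |b (e x) - w x| ≤ |a (e x) - v x| + |b (e x) - w x| :=
      max_le (le_add_of_nonneg_right (abs_nonneg _)) (le_add_of_nonneg_left (abs_nonneg _))
    simp only [Pi.sub_apply, Pi.add_apply, Real.norm_eq_abs]
    rw [abs_of_nonneg (a := |a (e x) - v x| + (|b (e x) - w x| + r)) (by positivity), abs_le]
    constructor <;> linarith
  have h2 : eLpNorm (fun x => |a (e x) - v x|) 2 Λ ≤ ENNReal.ofReal (ε / 3) := by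
    rw [show (fun x => |a (e x) - v x|) = fun x => ‖((fun x => a (e x)) - v) x‖ from rfl,
      eLpNorm_norm]
    exact hva
  have h3 : eLpNorm (fun x => |b (e x) - w x|) 2 Λ ≤ ENNReal.ofReal (ε / 3) := by
    rw [show (fun x => |b (e x) - w x|) = fun x => ‖((fun x => b (e x)) - w) x‖ from rfl,
      eLpNorm_norm]
    exact hwb
  have h4 : eLpNorm (fun _ : X => r) 2 Λ ≤ ENNReal.ofReal (ε / 3) := by
    refine (eLpNorm_le_of_ae_bound (C := r) (Eventually.of_forall fun x => ?_)).trans ?_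
    · rw [Real.norm_eq_abs, abs_of_pos hr]
    · have h4 : ((2 : ℝ≥0∞).toReal)⁻¹ = (1 / 2 : ℝ) := by norm_num
      rw [h4, ← ENNReal.ofReal_toReal hfin, ← ENNReal.ofReal_mul ENNReal.toReal_nonneg]
      refine ENNReal.ofReal_le_ofReal ?_
      have h5 : r * ((Λ Set.univ ^ (1 / 2 : ℝ)).toReal + 1) = ε / 3 :=
        div_mul_cancel₀ _ (by positivity)
      nlinarith
  refine h1.trans ((eLpNorm_add_le ?_ ?_ (by norm_num)).trans ?_)
  · exact (hma.aestronglyMeasurable.sub hv.1).norm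
  · exact (hmb.aestronglyMeasurable.sub hw.1).norm.add aestronglyMeasurable_const
  · refine (add_le_add h2 ((eLpNorm_add_le (hmb.aestronglyMeasurable.sub hw.1).norm
      aestronglyMeasurable_const (by norm_num)).trans (add_le_add h3 h4))).trans (le_of_eq ?_)
    rw [← ENNReal.ofReal_add (by positivity) (by positivity),
      ← ENNReal.ofReal_add (by positivity) (by positivity)]
    congr 1
    ring

theorem IsLatticeLike.approximable_min [IsFiniteMeasure Λ] (hB : IsLatticeLike e B) {v w : X → ℝ}
    (hv : v ∈ Approximable Λ e B) (hw : w ∈ Approximable Λ e B) :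
    (fun x => min (v x) (w x)) ∈ Approximable Λ e B := by
  have := hB.approximable_neg (hB.approximable_max (hB.approximable_neg hv) (hB.approximable_neg hw))
  simpa [max_neg_neg] using this

theorem IsLatticeLike.approximable_of_tendsto [IsFiniteMeasure Λ] (hB : IsLatticeLike e B)
    {f : ℕ → X → ℝ} {g : X → ℝ} {c : ℝ}
    (hf : ∀ n, f n ∈ Approximable Λ e B) (hc : ∀ n x, |f n x| ≤ c)
    (hlim : ∀ x, Tendsto (fun n => f n x) atTop (𝓝 (g x))) : g ∈ Approximable Λ e B := by
  have hgm : AEStronglyMeasurable g Λ :=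
    aestronglyMeasurable_of_tendsto_ae atTop (fun n => (hf n).1) (Eventually.of_forall hlim)
  have hg : ∀ x, |g x| ≤ c := fun x =>
    le_of_tendsto (hlim x).abs (Eventually.of_forall fun n => hc n x)
  refine ⟨hgm, fun ε hε => ?_⟩
  have h1 : Tendsto (fun n => eLpNorm (fun x => f n x - g x) 2 Λ) atTop (𝓝 0) := by
    refine tendsto_eLpNorm_two_of_bounded (c := c + c) (fun n => (hf n).1.sub hgm)
      (fun n => Eventually.of_forall fun x => ?_) (Eventually.of_forall fun x => ?_)
    · exact (abs_sub _ _).trans (add_le_add (hc n x) (hg x))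
    · simpa using (hlim x).sub_const (g x)
  obtain ⟨n, hn⟩ := (h1.eventually (ge_mem_nhds
    (show (0 : ℝ≥0∞) < ENNReal.ofReal (ε / 2) by simpa using hε))).exists
  obtain ⟨u, hu, hun⟩ := (hf n).2 (ε / 2) (by positivity)
  refine ⟨u, hu, ?_⟩
  have h2 : (fun x => u (e x)) - g = ((fun x => u (e x)) - f n) + fun x => f n x - g x := by
    ext x
    simp
  rw [h2]
  refine (eLpNorm_add_le ((hB.meas u hu).aestronglyMeasurable.sub (hf n).1)
    ((hf n).1.sub hgm) (by norm_num)).trans ?_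
  calc _ ≤ ENNReal.ofReal (ε / 2) + ENNReal.ofReal (ε / 2) := add_le_add hun hn
    _ = _ := by rw [← ENNReal.ofReal_add (by positivity) (by positivity), add_halves]

/-- Running maxima of the sequence stay approximable and increase to `g`, so bounded convergence
applies. No linear operations occur, and the bounds defining `B` are not degraded. -/
theorem IsLatticeLike.approximable_iSup [IsFiniteMeasure Λ] (hB : IsLatticeLike e B)
    {f : ℕ → X → ℝ} {g : X → ℝ} {c : ℝ} (hf : ∀ n, f n ∈ Approximable Λ e B)
    (hc : ∀ n x, |f n x| ≤ c) (hle : ∀ n x, f n x ≤ g x)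
    (hsup : ∀ x, ∀ ε > 0, ∃ n, g x - ε ≤ f n x) : g ∈ Approximable Λ e B := by
  let s : ℕ → X → ℝ := fun n x => Nat.rec (f 0 x) (fun k a => max a (f (k + 1) x)) n
  have hs : ∀ n x, s (n + 1) x = max (s n x) (f (n + 1) x) := fun n x => rfl
  have hmono : ∀ x, Monotone fun n => s n x := fun x =>
    monotone_nat_of_le_succ fun n => by rw [hs]; exact le_max_left _ _
  have hfs : ∀ n x, f n x ≤ s n x := fun n x => by
    cases n with
    | zero => exact le_rfl
    | succ n => rw [hs]; exact le_max_right _ _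
  have hsg : ∀ n x, s n x ≤ g x := fun n x => by
    induction n with
    | zero => exact hle 0 x
    | succ n ih => rw [hs]; exact max_le ih (hle _ x)
  refine hB.approximable_of_tendsto (f := s) (c := c) (fun n => ?_) (fun n x => ?_) fun x => ?_
  · induction n with
    | zero => exact hf 0
    | succ n ih => exact hB.approximable_max ih (hf (n + 1))
  · induction n with
    | zero => exact hc 0 x
    | succ n ih =>
      rw [hs, abs_le]
      exact ⟨(abs_le.1 ih).1.trans (le_max_left _ _), max_le (abs_le.1 ih).2 (abs_le.1 (hc _ x)).2⟩
  · refine tendsto_atTop_isLUB (hmono x) ⟨?_, fun b hb => ?_⟩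
    · rintro _ ⟨n, rfl⟩
      exact hsg n x
    · refine le_of_forall_pos_sub_le fun ε hε => ?_
      obtain ⟨n, hn⟩ := hsup x ε hε
      exact hn.trans ((hfs n x).trans (hb ⟨n, rfl⟩))

end Approximable

/-- Continuous functions decreasing to zero whose sublevel sets are compact in the limit. -/
theorem exists_compact_exhaustion {X L : Type*} [MetricSpace X] [CompleteSpace X]
    [PseudoMetricSpace L] {T : X → L} (hT : Continuous T) {t : ℕ → L}
    (htd : ∀ y, T y ∈ closure (Set.range t)) {c : ℝ} (htb : ∀ y j, dist (T y) (t j) ≤ c)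
    {r : ℕ → X → ℝ} (hrc : ∀ n, Continuous (r n)) (hr : ∀ n y, r (n + 1) y ≤ r n y)
    (hrb : ∀ n y, r n y ≤ c) (hrlim : ∀ y, Tendsto (fun n => r n y) atTop (𝓝 0))
    (hK : ∀ n, ∃ K : ℝ, ∀ y z, r n y ≤ 1 / 2 → r n z ≤ 1 / 2 → dist y z ≤ K * dist (T y) (T z))
    {W : Set (X → ℝ)} (hmax : ∀ v ∈ W, ∀ w ∈ W, (fun y => max (v y) (w y)) ∈ W)
    (hmin : ∀ v ∈ W, ∀ w ∈ W, (fun y => min (v y) (w y)) ∈ W)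
    (hWt : ∀ j, (fun y => dist (T y) (t j)) ∈ W) (hWr : ∀ n, r n ∈ W) :
    ∃ v : ℕ → X → ℝ, (∀ n, Continuous (v n)) ∧ (∀ n y, 0 ≤ v n y) ∧
      (∀ n y, v (n + 1) y ≤ v n y) ∧ (∀ n y, v n y ≤ c) ∧
      (∀ y, Tendsto (fun n => v n y) atTop (𝓝 0)) ∧ (∀ n, v n ∈ W) ∧
      ∀ (N : ℕ → ℕ) (n : ℕ), IsCompact {y | ∀ j ≥ n, v (N j) y ≤ 1 / ((j : ℝ) + 1)} := by
  -- `s n` is the distance of `T y` to the first `n + 1` points of the dense sequence. It decreases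
  -- to zero, and its sublevel sets have images covered by finitely many balls.
  let s : ℕ → X → ℝ := fun n y =>
    Nat.rec (dist (T y) (t 0)) (fun k a => min a (dist (T y) (t (k + 1)))) n
  have hs : ∀ n y, s (n + 1) y = min (s n y) (dist (T y) (t (n + 1))) := fun n y => rfl
  have hs0 : ∀ n y, 0 ≤ s n y := fun n y => by
    induction n with
    | zero => exact dist_nonneg
    | succ n ih => rw [hs]; exact le_min ih dist_nonneg
  have hsle : ∀ n y, s n y ≤ dist (T y) (t n) := fun n y => by
    cases n with
    | zero => exact le_rfl
    | succ n => rw [hs]; exact min_le_right _ _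
  have hanti : ∀ y, Antitone fun n => s n y := fun y =>
    antitone_nat_of_succ_le fun n => by rw [hs]; exact min_le_left _ _
  have hsex : ∀ n y a, s n y ≤ a → ∃ j, j ≤ n ∧ dist (T y) (t j) ≤ a := fun n y a => by
    induction n with
    | zero => exact fun h => ⟨0, le_rfl, h⟩
    | succ n ih =>
      intro h
      rw [hs, min_le_iff] at h
      rcases h with h | h
      · obtain ⟨j, hj, h'⟩ := ih h
        exact ⟨j, hj.trans (Nat.le_succ n), h'⟩
      · exact ⟨n + 1, le_rfl, h⟩
  have hsc : ∀ n, Continuous (s n) := fun n => by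
    induction n with
    | zero => exact hT.dist continuous_const
    | succ n ih => exact ih.min (hT.dist continuous_const)
  have hsW : ∀ n, s n ∈ W := fun n => by
    induction n with
    | zero => exact hWt 0
    | succ n ih => exact hmin _ ih _ (hWt _)
  have hvc : ∀ n, Continuous fun y => max (s n y) (r n y) := fun n => (hsc n).max (hrc n)
  refine ⟨fun n y => max (s n y) (r n y), hvc, fun n y => (hs0 n y).trans (le_max_left _ _),
    fun n y => max_le_max (hanti y (Nat.le_succ n)) (hr n y),
    fun n y => max_le ((hsle n y).trans (htb y n)) (hrb n y), fun y => ?_,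
    fun n => hmax _ (hsW n) _ (hWr n), fun N n => ?_⟩
  · have h1 : Tendsto (fun n => s n y) atTop (𝓝 0) := by
      refine tendsto_order.2 ⟨fun a ha => Eventually.of_forall fun n => ha.trans_le (hs0 n y),
        fun a ha => ?_⟩
      obtain ⟨_, ⟨j, rfl⟩, hj⟩ := Metric.mem_closure_iff.1 (htd y) a ha
      filter_upwards [eventually_ge_atTop j] with n hn
      exact ((hanti y hn).trans (hsle j y)).trans_lt hj
    simpa using h1.max (hrlim y)
  · refine TotallyBounded.isCompact_of_isClosed ?_ ?_
    -- The index `max n 1` ensures `1/(j + 1) ≤ 1/2`, the level below which `r` makes `T`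
    -- bi-Lipschitz from below. Finite nets of the image then pull back to the sublevel set.
    · obtain ⟨K, hK⟩ := hK (N (max n 1))
      have hrK : ∀ y ∈ {y | ∀ j ≥ n, max (s (N j) y) (r (N j) y) ≤ 1 / ((j : ℝ) + 1)},
          r (N (max n 1)) y ≤ 1 / 2 := fun y hy => by
        refine (le_max_right _ _).trans ((hy (max n 1) (le_max_left _ _)).trans ?_)
        refine one_div_le_one_div_of_le (by norm_num) ?_
        have : (1 : ℝ) ≤ ((max n 1 : ℕ) : ℝ) := by exact_mod_cast le_max_right n 1
        linarith
      refine Metric.totallyBounded_of_finite_discretization fun ε hε => ?_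
      obtain ⟨j, hj⟩ := exists_nat_gt (2 * (|K| + 1) / ε)
      let j' := max n j
      have hj' : 2 * (|K| + 1) < ε * ((j' : ℝ) + 1) := by
        rw [div_lt_iff₀ hε] at hj
        have : (j : ℝ) ≤ j' := by exact_mod_cast le_max_right n j
        nlinarith
      choose F hF1 hF2 using fun y : {y | ∀ j ≥ n, max (s (N j) y) (r (N j) y) ≤
        1 / ((j : ℝ) + 1)} => hsex (N j') y _ ((le_max_left _ _).trans (y.2 j' (le_max_left _ _)))
      refine ⟨ULift (Fin (N j' + 1)), inferInstance,
        fun y => ⟨⟨F y, Nat.lt_succ_of_le (hF1 y)⟩⟩, fun y z hyz => ?_⟩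
      have hyz' : F y = F z := by simpa using hyz
      have h1 := hK y z (hrK y y.2) (hrK z z.2)
      have h2 : dist (T y) (T z) ≤ 2 * (1 / ((j' : ℝ) + 1)) := by
        refine (dist_triangle_right _ _ (t (F y))).trans ?_
        have := hF2 z
        rw [← hyz'] at this
        linarith [hF2 y]
      have h3 : K * dist (T y) (T z) ≤ |K| * (2 * (1 / ((j' : ℝ) + 1))) :=
        mul_le_mul (le_abs_self K) h2 dist_nonneg (abs_nonneg K)
      refine h1.trans_lt (h3.trans_lt ?_)
      rw [mul_one_div, ← mul_div_assoc, div_lt_iff₀ (by positivity)]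
      linarith
    · have : {y | ∀ j ≥ n, max (s (N j) y) (r (N j) y) ≤ 1 / ((j : ℝ) + 1)} =
          ⋂ j, ⋂ (_ : j ≥ n), {y | max (s (N j) y) (r (N j) y) ≤ 1 / ((j : ℝ) + 1)} := by
        ext y
        simp
      rw [this]
      exact isClosed_iInter fun j => isClosed_iInter fun _ =>
        isClosed_le (hvc (N j)) continuous_const

/-! ### A class with uniform bounds, stable under approximate maxima. -/

section PathBall

variable {X Y N R : Type*} [MeasurableSpace X] [TopologicalSpace X] [OpensMeasurableSpace X]
  [TopologicalSpace Y] [TopologicalSpace N]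
  {l : Filter R} {c : R → ℝ} {path : Y → N → R → Y}

/-- The functions bounded by `C` with a derivative bounded by `C` times the weight `w`. -/
def pathBall (l : Filter R) (c : R → ℝ) (path : Y → N → R → Y) (w : Y → ℝ) (C : ℝ) :
    Set (Y → ℝ) :=
  {u | ∃ D, HasPathDeriv l c path u D ∧ (∀ y, |u y| ≤ C) ∧ ∀ y x, |D y x| ≤ C * w y}

/-- The maximum is `(u + v + |u - v|)/2`, with the absolute value replaced by `√((u - v)² + δ²)`.
The derivative becomes a convex combination of those of `u` and `v`, so it keeps the bound `C w`
exactly. -/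
theorem isLatticeLike_pathBall (hc : Tendsto c l (𝓝[≠] 0)) {w : Y → ℝ} (hw : ∀ y, 0 ≤ w y) {C : ℝ}
    (hC : 0 < C) {e : X → Y} (he : Continuous e) :
    IsLatticeLike e (pathBall l c path w C) where
  meas := fun u ⟨D, hD, _⟩ => (hD.cont.comp he).measurable
  neg := fun u ⟨D, hD, h1, h2⟩ => by
    refine ⟨fun y x => -1 * D y x, ?_, fun y => by simpa using h1 y, fun y x => by simpa using h2 y x⟩
    have : -u = fun y => -1 * u y := by ext y; simp
    rw [this]
    exact hD.smul (-1)
  approx_max := fun u ⟨D, hD, hu, hDu⟩ v ⟨E, hE, hv, hEv⟩ ε hε => by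
    have hδ : 0 < ε / 2 := by positivity
    set δ := ε / 2 with hδε
    -- Smoothing may raise the sup bound to `C + δ`; multiplication by `a` restores `C` and moves
    -- the function by at most `δ`.
    let a := C / (C + δ)
    have ha0 : 0 ≤ a := by positivity
    have ha1 : a ≤ 1 := (div_le_one (by positivity)).2 (by linarith)
    have haC : a * (C + δ) = C := div_mul_cancel₀ _ (by positivity)
    have hsub := hD.add (hE.smul (-1))
    have hraw := ((hD.add hE).add (hsub.comp hc (contDiff_sqrt_sq_add hδ))).smul (a / 2)
    have hmem := fun y => sqrt_sq_add_mem hδ (u y + -1 * v y)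
    have hmaxeq : ∀ y, max (u y) (v y) = (u y + v y + |u y + -1 * v y|) / 2 := fun y => by
      rcases le_total (u y) (v y) with h | h
      · rw [max_eq_right h, abs_of_nonpos (by linarith)]; ring
      · rw [max_eq_left h, abs_of_nonneg (by linarith)]; ring
    have hmaxb : ∀ y, |max (u y) (v y)| ≤ C := fun y =>
      (abs_max_le_max_abs_abs).trans (max_le (hu y) (hv y))
    have hR : ∀ y, |(u y + v y + √((u y + -1 * v y) ^ 2 + δ ^ 2)) / 2 - max (u y) (v y)| ≤ δ / 2 :=
      fun y => by
        rw [hmaxeq, abs_le]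
        constructor <;> linarith [hmem y]
    refine ⟨_, ⟨_, hraw, fun y => ?_, fun y x => ?_⟩, fun y => ?_⟩
    · have h1 := abs_le.1 (hR y)
      have h2 := abs_le.1 (hmaxb y)
      have h3 : |(u y + v y + √((u y + -1 * v y) ^ 2 + δ ^ 2)) / 2| ≤ C + δ := by
        rw [abs_le]
        constructor <;> linarith
      calc _ = a * |(u y + v y + √((u y + -1 * v y) ^ 2 + δ ^ 2)) / 2| := by
            rw [← abs_of_nonneg ha0, ← abs_mul, abs_of_nonneg ha0]
            congr 1
            ring
        _ ≤ a * (C + δ) := mul_le_mul_of_nonneg_left h3 ha0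
        _ = C := haC
    · rw [(hasDerivAt_sqrt_sq_add hδ _).deriv]
      obtain ⟨h1, h2⟩ := abs_le.1 (abs_div_sqrt_sq_add_le hδ (u y + -1 * v y))
      generalize (u y + -1 * v y) / √((u y + -1 * v y) ^ 2 + δ ^ 2) = θ at h1 h2
      have h3 : |((1 + θ) * D y x + (1 - θ) * E y x) / 2| ≤ C * w y := by
        obtain ⟨h4, h5⟩ := abs_le.1 (hDu y x)
        obtain ⟨h6, h7⟩ := abs_le.1 (hEv y x)
        rw [abs_le]
        constructor <;> nlinarith
      calc _ = a * |((1 + θ) * D y x + (1 - θ) * E y x) / 2| := by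
            rw [← abs_of_nonneg ha0, ← abs_mul, abs_of_nonneg ha0]
            congr 1
            ring
        _ ≤ a * (C * w y) := mul_le_mul_of_nonneg_left h3 ha0
        _ ≤ C * w y := mul_le_of_le_one_left (mul_nonneg hC.le (hw y)) ha1
    · have h1 := abs_le.1 (hR y)
      have h2 := abs_le.1 (hmaxb y)
      have h3 : (1 - a) * (C + δ) = δ := by rw [sub_mul, haC]; ring
      set z := (u y + v y + √((u y + -1 * v y) ^ 2 + δ ^ 2)) / 2 with hz
      have h4 : a / 2 * (u y + v y + √((u y + -1 * v y) ^ 2 + δ ^ 2)) = z - (1 - a) * z := by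
        rw [hz]; ring
      have h5 : |(1 - a) * z| ≤ δ := by
        rw [abs_mul, abs_of_nonneg (sub_nonneg.2 ha1), ← h3]
        refine mul_le_mul_of_nonneg_left ?_ (sub_nonneg.2 ha1)
        rw [abs_le]
        constructor <;> linarith
      have h6 := abs_le.1 h5
      rw [h4, abs_le]
      constructor <;> linarith

end PathBall

/-- Quasi-regularity of the closure of `sumForm`, considered over a space `X'` in which `X` is
closed. -/
theorem IsFormCore.hasQuasiRegularClosure {X X' Y M L : Type*} [MeasurableSpace M] [MetricSpace X]
    [PolishSpace X] [MeasurableSpace X] [BorelSpace X] [MetricSpace X']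
    [CompleteSpace X'] [MeasurableSpace X'] [BorelSpace X']
    [PseudoMetricSpace L] {m : X → Measure M} {D : Subalgebra ℝ (Y → ℝ)}
    {Λ : Measure X} [IsFiniteMeasure Λ] {J : Measure (X × X)} {V : X → ℝ}
    {A : ∀ x, Lp ℝ 2 (m x) →L[ℝ] Lp ℝ 2 (m x)} {e : X → Y} {d : (Y → ℝ) → Y → M → ℝ}
    (S : IsFormCore (Subalgebra.toSubmodule D) Λ J V A e d)
    (hd : IsClosable Λ (D : Set (Y → ℝ)) (fun u x => u (e x)) (diffForm Λ A e d))
    (hJ : ∫⁻ p, ENNReal.ofReal (min 1 (dist p.1 p.2 ^ 2)) ∂J < ∞)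
    (hA : Integrable (fun x => ‖A x‖) Λ) (hcont : ∀ u ∈ D, Continuous fun x => u (e x))
    {i : X → X'} (hi : IsClosedEmbedding i)
    (hsep : ∃ g : ℕ → Y → ℝ, (∀ n, g n ∈ D) ∧ ∀ x y, (∀ n, g n (e x) = g n (e y)) → x = y)
    {B : Set (Y → ℝ)} (hB : IsLatticeLike e B) {C : ℝ}
    (hBD : ∀ u ∈ B, u ∈ D ∧ (∀ x, |u (e x)| ≤ C) ∧
      (∀ x y, |u (e x) - u (e y)| ≤ 2 * C * dist x y) ∧ ∀ x, ‖toL2 (m x) (d u (e x))‖ ≤ C)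
    {T : X' → L} (hT : Continuous T) {t : ℕ → L}
    (htd : ∀ y, T y ∈ closure (Set.range t)) {c : ℝ} (htb : ∀ y j, dist (T y) (t j) ≤ c)
    {r : ℕ → X' → ℝ} (hrc : ∀ n, Continuous (r n)) (hr : ∀ n y, r (n + 1) y ≤ r n y)
    (hrb : ∀ n y, r n y ≤ c) (hrlim : ∀ y, Tendsto (fun n => r n y) atTop (𝓝 0))
    (hK : ∀ n, ∃ K : ℝ, ∀ y z, r n y ≤ 1 / 2 → r n z ≤ 1 / 2 → dist y z ≤ K * dist (T y) (T z))
    (hBt : ∀ j, (fun x => dist (T (i x)) (t j)) ∈ Approximable Λ e B)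
    (hBr : ∀ n, (fun x => r n (i x)) ∈ Approximable Λ e B) :
    HasQuasiRegularClosure (Λ.map i) (D : Set (Y → ℝ))
      (fun u => Function.extend i (fun x => u (e x)) 0) (sumForm Λ J V A e d) := by
  have hinj := hi.injective
  have hm : MeasurableEmbedding i := hi.measurableEmbedding
  have hext : ∀ (u : Y → ℝ) x, Function.extend i (fun x => u (e x)) 0 (i x) = u (e x) :=
    fun u x => hinj.extend_apply _ _ _
  have hcomp : ∀ u : Y → ℝ, Function.extend i (fun x => u (e x)) 0 ∘ i = fun x => u (e x) :=
    fun u => funext (hext u)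
  have hext' : ∀ (u : Y → ℝ) y, y ∉ Set.range i → Function.extend i (fun x => u (e x)) 0 y = 0 :=
    fun u y hy => Function.extend_apply' _ _ _ hy
  have hclos := S.isClosable hd
  -- Functions on `X'` whose restriction to `X` is approximable from `B` are stable under maxima and
  -- minima. The compactness functions built from distances therefore inherit the one energy bound
  -- valid on `B`.
  obtain ⟨v, hvc, hv0, hvanti, hvb, hvlim, hvW, hvK⟩ := exists_compact_exhaustion hT htd htb hrc hr
    hrb hrlim hK (W := {v | (fun x => v (i x)) ∈ Approximable Λ e B})
    (fun v hv w hw => hB.approximable_max hv hw) (fun v hv w hw => hB.approximable_min hv hw)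
    hBt hBr
  refine hasQuasiRegularClosure_of (Subalgebra.toSubmodule D) _ _ (fun u v => ?_) (fun a u => ?_)
    (fun u hu v hv w hw => S.sumForm_add hu hv hw) (fun a u hu v _ => S.sumForm_smul a hu)
    (fun u _ v _ => S.sumForm_symm u v) (fun u _ => S.sumForm_nonneg u) (fun u hu => ?_) ?_
    (fun f hf ε hε => ?_) (fun u hu ε hε => ?_) hi.isClosed_range ?_ (fun u hu => ?_)
    (fun u hu => ?_) ?_ v hvc hv0 hvanti hvb (Eventually.of_forall hvlim)
    (C := C ^ 2 * (4 * ∫ p, min 1 (dist p.1 p.2 ^ 2) ∂J) + C ^ 2 * ∫ x, V x ∂Λ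
        + C ^ 2 * ∫ x, ‖A x‖ ∂Λ) (fun n ε hε => ?_) (fun N n => (hvK N n).inter_left hi.isClosed_range)
  · ext y
    by_cases hy : y ∈ Set.range i
    · obtain ⟨x, rfl⟩ := hy
      rw [Pi.add_apply, hext, hext, hext, Pi.add_apply]
    · rw [Pi.add_apply, hext' _ _ hy, hext' _ _ hy, hext' _ _ hy, add_zero]
  · ext y
    by_cases hy : y ∈ Set.range i
    · obtain ⟨x, rfl⟩ := hy
      rw [Pi.smul_apply, hext, hext, Pi.smul_apply]
    · rw [Pi.smul_apply, hext' _ _ hy, hext' _ _ hy, smul_zero]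
  · rw [hm.memLp_map_measure_iff, hcomp]
    obtain ⟨C, hC⟩ := S.bdd u hu
    exact MemLp.of_bound (S.meas u hu).aestronglyMeasurable C (Eventually.of_forall hC)
  · intro u hu h0 hc
    refine hclos u hu (h0.congr fun n => ?_) hc
    rw [hm.eLpNorm_map_measure, hcomp]
  · obtain ⟨g, hg, hgs⟩ := hsep
    rw [hm.memLp_map_measure_iff] at hf
    obtain ⟨p, ⟨u, hu, rfl⟩, hp⟩ := dense_of_separating (D.map (compRightAlgHom e))
      (fun n x => g n (e x)) (fun n => hcont _ (hg n)) (fun n => S.bdd _ (hg n))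
      (fun n => ⟨g n, hg n, rfl⟩) hgs hf hε
    refine ⟨u, hu, ?_⟩
    rw [hm.eLpNorm_map_measure]
    refine le_trans (le_of_eq ?_) hp
    congr 1
    ext x
    simp only [Function.comp_apply, Pi.sub_apply, hext]
    rfl
  · obtain ⟨w, hw, h1, h2⟩ := S.exists_markov hu hε
    refine ⟨w, hw, h1, Eventually.of_forall fun y => ?_⟩
    by_cases hy : y ∈ Set.range i
    · obtain ⟨x, rfl⟩ := hy
      rw [hext, hext]
      exact h2 _
    · rw [hext' _ _ hy, hext' _ _ hy]
      simpa [clamp] using hε.le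
  · rw [hm.map_apply]
    simp
  · exact hm.measurable_extend (S.meas u hu) measurable_const
  · rintro _ ⟨x, rfl⟩
    rw [ContinuousWithinAt, ← hi.isInducing.map_nhds_eq, tendsto_map'_iff, hcomp, hext]
    exact (hcont u hu).tendsto x
  · obtain ⟨g, hg, hgs⟩ := hsep
    refine ⟨g, hg, ?_⟩
    rintro _ ⟨x, rfl⟩ _ ⟨y, rfl⟩ hxy
    by_contra! hn
    refine hxy (congrArg i (hgs x y fun n => ?_))
    have := hn n
    rwa [hext, hext] at this
  · obtain ⟨u, hu, hun⟩ := (hvW n).2 ε hε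
    obtain ⟨h1, h2, h3, h4⟩ := hBD u hu
    refine ⟨u, h1, S.sumForm_le hJ hA h1 h2 h3 h4, ?_⟩
    rw [hm.eLpNorm_map_measure]
    refine le_trans (le_of_eq ?_) hun
    congr 1
    ext x
    simp only [Function.comp_apply, Pi.sub_apply, hext]

theorem isFormCore_of_hasPathDeriv {X Y M R : Type*} [MeasurableSpace M] [TopologicalSpace M]
    [BorelSpace M] [SecondCountableTopology M] [Nonempty M] [PseudoMetricSpace X]
    [SecondCountableTopology X] [MeasurableSpace X] [BorelSpace X] [TopologicalSpace Y]
    {l : Filter R} {c : R → ℝ} {path : Y → M → R → Y} (hc : Tendsto c l (𝓝[≠] 0))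
    {m : X → Measure M} [∀ x, IsFiniteMeasure (m x)] (hm : Measurable m)
    {D : Submodule ℝ (Y → ℝ)} {Λ : Measure X} {J : Measure (X × X)} {V : X → ℝ}
    {A : ∀ x, Lp ℝ 2 (m x) →L[ℝ] Lp ℝ 2 (m x)} {e : X → Y} (he : Continuous e)
    {d : (Y → ℝ) → Y → M → ℝ} (hD : ∀ u ∈ D, HasPathDeriv l c path u (d u))
    (hd : ∀ u E, HasPathDeriv l c path u E → d u = E)
    (hbd : ∀ u ∈ D, ∃ C : ℝ, ∀ x, ‖toL2 (m x) (d u (e x))‖ ≤ C)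
    (hlip : ∀ u ∈ D, ∃ C : ℝ, ∀ x y, |u (e x) - u (e y)| ≤ C * dist x y)
    (hchain : ∀ u ∈ D, ∀ φ : ℝ → ℝ, ContDiff ℝ 1 φ → (fun y => φ (u y)) ∈ D)
    (hpos : ∀ x, (A x).IsPositive) (hA : Integrable (fun x => ‖A x‖) Λ)
    (hAm : ∀ η : BoundedContinuousFunction (X × M) ℝ, ∃ G : X × M → ℝ, Measurable G ∧
      ∀ x, A x (toL2 (m x) (fun y => η (x, y))) =ᵐ[m x] (fun y => G (x, y)))
    (hV : 0 ≤ᵐ[Λ] V) (hVi : Integrable V Λ)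
    (hJ : ∫⁻ p, ENNReal.ofReal (min 1 (dist p.1 p.2 ^ 2)) ∂J < ∞) (hJΛ : J ≪ Λ.prod Λ) :
    IsFormCore D Λ J V A e d := by
  have hbu : ∀ u ∈ D, ∃ C : ℝ, ∀ x, |u (e x)| ≤ C := fun u hu => by
    obtain ⟨C, hC⟩ := (hD u hu).bddu
    exact ⟨C, fun x => hC _⟩
  have hme : ∀ u ∈ D, Measurable fun x => u (e x) := fun u hu => ((hD u hu).cont.comp he).measurable
  have hcd : ∀ u ∈ D, Continuous fun p : X × M => d u (e p.1) p.2 := fun u hu =>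
    (hD u hu).contD.comp ((he.comp continuous_fst).prodMk continuous_snd)
  have hmem : ∀ u ∈ D, ∀ x, MemLp (d u (e x)) 2 (m x) := fun u hu x => by
    obtain ⟨C, hC⟩ := (hD u hu).bddD
    exact MemLp.of_bound ((hcd u hu).comp (Continuous.prodMk_right x)).measurable.aestronglyMeasurable
      C (Eventually.of_forall fun y => hC _ _)
  refine ⟨hpos, fun u hu v hv => hd _ _ ((hD u hu).add (hD v hv)),
    fun a u hu => hd _ _ ((hD u hu).smul a), hmem, fun u hu v hv => ?_, fun u hu => ?_, hV, hVi, hbu,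
    hme, hJΛ, fun u hu φ hφ => ⟨hchain u hu φ hφ, fun y z => ?_⟩⟩
  · obtain ⟨C, hC⟩ := (hD u hu).bddD
    -- The derivative is bounded and jointly continuous also for the finer topology of `X`, so it is
    -- an admissible test function for the measurability of `A`.
    obtain ⟨G, hG, hG'⟩ := hAm (BoundedContinuousFunction.ofNormedAddCommGroup
      (fun p : X × M => d u (e p.1) p.2) (hcd u hu) C fun p => hC _ _)
    obtain ⟨K, hK⟩ := hbd u hu
    obtain ⟨L, hL⟩ := hbd v hv
    exact integrable_inner_of_measurable hm hA (a := fun x => d u (e x)) (b := fun x => d v (e x))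
      hG hG' (hcd v hv).measurable (hmem v hv) hK hL
  · obtain ⟨C, hC⟩ := hbu u hu
    obtain ⟨K, hK⟩ := hlip u hu
    refine memLp_jump hJ (hme u hu) (C := max C K) (fun x => (hC x).trans (le_max_left _ _))
      fun x y => (hK x y).trans (mul_le_mul_of_nonneg_right ?_ dist_nonneg)
    have h0 : 0 ≤ C := (abs_nonneg _).trans (hC x)
    linarith [le_max_left C K, le_max_right C K]
  · rw [hd _ _ ((hD u hu).comp hc hφ)]

/-! ### Comparison of the energy densities on `H` and over measures. -/

section Lift

variable {M : Type*} [MeasurableSpace M] {lam : Measure M}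

theorem norm_toL2_sq {ν : Measure M} {f : M → ℝ} (hf : MemLp f 2 ν) :
    ‖toL2 ν f‖ ^ 2 = ∫ x, f x ^ 2 ∂ν := by
  rw [norm_sq_H]
  exact integral_congr_ae ((toL2_ae hf).mono fun x hx => by simp only [hx])

theorem integral_sqMeasure (h : H lam) (f : M → ℝ) :
    ∫ x, f x ∂(sqMeasure h) = ∫ x, h x ^ 2 * f x ∂lam := by
  rw [sqMeasure, integral_withDensity_eq_integral_toReal_smul
    (((Lp.stronglyMeasurable h).measurable.pow_const 2).ennreal_ofReal)
    (Eventually.of_forall fun x => ENNReal.ofReal_lt_top)]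
  refine integral_congr_ae (Eventually.of_forall fun x => ?_)
  simp only
  rw [ENNReal.toReal_ofReal (sq_nonneg _), smul_eq_mul]

theorem integrable_sqMeasure_iff (h : H lam) (f : M → ℝ) :
    Integrable f (sqMeasure h) ↔ Integrable (fun x => h x ^ 2 * f x) lam := by
  rw [sqMeasure, integrable_withDensity_iff_integrable_smul'
    (((Lp.stronglyMeasurable h).measurable.pow_const 2).ennreal_ofReal)
    (Eventually.of_forall fun x => ENNReal.ofReal_lt_top)]
  refine integrable_congr (Eventually.of_forall fun x => ?_)
  simp only
  rw [ENNReal.toReal_ofReal (sq_nonneg _), smul_eq_mul]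

theorem ae_sqMeasure_ne_zero (h : H lam) : ∀ᵐ x ∂(sqMeasure h), h x ≠ 0 := by
  rw [sqMeasure, ae_withDensity_iff
    (((Lp.stronglyMeasurable h).measurable.pow_const 2).ennreal_ofReal)]
  refine Eventually.of_forall fun x hx h0 => hx ?_
  simp [h0]

theorem memLp_mul_of_sqMeasure (h : H lam) {f : M → ℝ} (hf : StronglyMeasurable f)
    (hi : Integrable (fun x => f x ^ 2) (sqMeasure h)) : MemLp (fun x => h x * f x) 2 lam := by
  have hm : StronglyMeasurable fun x => h x * f x := (Lp.stronglyMeasurable h).mul hf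
  rw [memLp_two_iff_integrable_sq hm.aestronglyMeasurable]
  rw [integrable_sqMeasure_iff] at hi
  refine hi.congr (Eventually.of_forall fun x => ?_)
  simp only
  ring

/-- The energy density on `H` in terms of the one over the space of measures. -/
theorem inner_liftOp (h : H lam) {ν : Measure M} {κ : ℝ} (hκ : 0 < κ)
    (hν : ν = ENNReal.ofReal κ • sqMeasure h) (A : Lp ℝ 2 ν →L[ℝ] Lp ℝ 2 ν) {D D' : M → ℝ}
    (hD : MemLp D 2 ν) (hD' : MemLp D' 2 ν) {g g' : H lam}
    (hg : g =ᵐ[lam] fun x => h x * (2 * D x)) (hg' : g' =ᵐ[lam] fun x => h x * (2 * D' x)) :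
    inner ℝ (liftOp A h g) g' = 4 / κ * inner ℝ (A (toL2 ν D)) (toL2 ν D') := by
  have hac : ν ≪ sqMeasure h := by
    rw [hν]
    exact Measure.smul_absolutelyContinuous
  have hacl : ν ≪ lam := hac.trans (withDensity_absolutelyContinuous _ _)
  -- Division by `h` is harmless because `ν` does not charge its zeros. The two gradients give the
  -- factor `4`, and the normalization of `ν` gives `1/κ`.
  have h1 : toL2 ν (fun y => g y / h y) = (2 : ℝ) • toL2 ν D := by
    rw [← IsFormCore.toL2_smul 2 hD]
    refine toL2_congr ?_
    filter_upwards [hacl.ae_le hg, hac.ae_le (ae_sqMeasure_ne_zero h)] with y hy hy0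
    rw [hy, Pi.smul_apply, smul_eq_mul, mul_div_cancel_left₀ _ hy0]
  have hint : ∀ f : M → ℝ, ∫ x, f x ∂ν = κ * ∫ x, f x ∂(sqMeasure h) := fun f => by
    rw [hν, integral_smul_measure, ENNReal.toReal_ofReal hκ.le, smul_eq_mul]
  have hint' : ∀ f : M → ℝ, Integrable f ν → Integrable f (sqMeasure h) := fun f hf => by
    rwa [hν, integrable_smul_measure (by simpa using hκ) ENNReal.ofReal_ne_top] at hf
  set a := A (toL2 ν D) with ha
  have hasq : Integrable (fun x => (2 * a x) ^ 2) (sqMeasure h) := by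
    have h2 := hint' _ (Lp.memLp a).integrable_sq
    refine (h2.const_mul 4).congr (Eventually.of_forall fun x => ?_)
    simp only
    ring
  have hmem := memLp_mul_of_sqMeasure h ((Lp.stronglyMeasurable a).const_mul 2) hasq
  have h3 : liftOp A h g =ᵐ[lam] fun x => h x * (2 * a x) := by
    rw [liftOp, h1, map_smul, ← ha]
    -- An identity holding `ν`-almost everywhere becomes one holding `lam`-almost everywhere after
    -- multiplication by `h`, since both sides vanish where `h = 0`.
    have h4 : ∀ᵐ x ∂lam, h x * ((2 : ℝ) • a : Lp ℝ 2 ν) x = h x * (2 * a x) := by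
      have h5 : ∀ᵐ x ∂(sqMeasure h), ((2 : ℝ) • a : Lp ℝ 2 ν) x = 2 * a x := by
        have h6 := Lp.coeFn_smul (2 : ℝ) a
        have h7 : sqMeasure h ≪ ν := by
          rw [hν]
          exact Measure.absolutelyContinuous_smul (by simpa using hκ)
        filter_upwards [h7.ae_le h6] with x hx
        rw [hx, Pi.smul_apply, smul_eq_mul]
      rw [sqMeasure, ae_withDensity_iff
        (((Lp.stronglyMeasurable h).measurable.pow_const 2).ennreal_ofReal)] at h5
      filter_upwards [h5] with x hx
      by_cases h0 : h x = 0
      · rw [h0, zero_mul, zero_mul]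
      · rw [hx (ENNReal.ofReal_pos.2 (by positivity)).ne']
    rw [toL2_congr h4]
    exact toL2_ae hmem
  rw [L2.inner_def, L2.inner_def, hint, integral_sqMeasure]
  have h4 : ∫ x, inner ℝ ((liftOp A h g) x) (g' x) ∂lam
      = 4 * ∫ x, h x ^ 2 * (a x * D' x) ∂lam := by
    rw [← integral_const_mul]
    refine integral_congr_ae ?_
    filter_upwards [h3, hg'] with x e1 e2
    rw [e1, e2]
    simp only [RCLike.inner_apply, conj_trivial]
    ring
  have h5 : ∫ x, h x ^ 2 * inner ℝ (a x) ((toL2 ν D') x) ∂lam = ∫ x, h x ^ 2 * (a x * D' x) ∂lam := by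
    rw [← integral_sqMeasure h fun x => inner ℝ (a x) ((toL2 ν D') x),
      ← integral_sqMeasure h fun x => a x * D' x]
    have h7 : sqMeasure h ≪ ν := by
      rw [hν]
      exact Measure.absolutelyContinuous_smul (by simpa using hκ)
    refine integral_congr_ae (h7.ae_le ?_)
    filter_upwards [toL2_ae hD'] with x hx
    rw [hx]
    simp only [RCLike.inner_apply, conj_trivial]
    ring
  rw [h4, h5]
  field_simp

end Lift

/-! ### Bounded coordinates on `Mac`: scaled density and mass. -/

section Normalized

variable {M : Type*} [MeasurableSpace M] {lam : Measure M} [SigmaFinite lam]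

/-- The density of `μ`, divided by one plus the mass of `μ`. -/
noncomputable def Mac.scaledDens (μ : Mac lam) : Lp ℝ 1 lam := (1 + ‖μ.dens‖)⁻¹ • μ.dens

theorem Mac.continuous_scaledDens : Continuous (Mac.scaledDens : Mac lam → Lp ℝ 1 lam) := by
  have h1 := (Mac.isometry_dens (lam := lam)).continuous
  exact ((continuous_const.add h1.norm).inv₀ fun μ =>
    (add_pos_of_pos_of_nonneg one_pos (norm_nonneg _)).ne').smul h1

theorem Mac.norm_scaledDens (μ : Mac lam) : ‖μ.scaledDens‖ = ‖μ.dens‖ / (1 + ‖μ.dens‖) := by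
  rw [Mac.scaledDens, norm_smul, Real.norm_of_nonneg (by positivity), div_eq_inv_mul]

theorem Mac.norm_scaledDens_le (μ : Mac lam) : ‖μ.scaledDens‖ ≤ 1 := by
  rw [Mac.norm_scaledDens]
  exact div_le_one_of_le₀ (by linarith) (by positivity)

/-- On sets of bounded mass the scaling has a Lipschitz inverse. The mass difference is recovered
from `m - m' = (1 + m)(1 + m')(‖s‖ - ‖s'‖)`, with `s` and `s'` the scaled densities. -/
theorem Mac.dist_le_scaledDens {R : ℝ} {μ ν : Mac lam} (hμ : ‖μ.dens‖ ≤ R) (hν : ‖ν.dens‖ ≤ R) :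
    dist μ ν ≤ ((1 + R) + (1 + R) ^ 2) * dist μ.scaledDens ν.scaledDens := by
  rw [← Mac.isometry_dens.dist_eq, dist_eq_norm, dist_eq_norm]
  have hR : 0 ≤ R := (norm_nonneg _).trans hμ
  have h1 : ∀ ρ : Mac lam, ρ.dens = (1 + ‖ρ.dens‖) • ρ.scaledDens := fun ρ => by
    rw [Mac.scaledDens, smul_inv_smul₀ (by positivity)]
  have h2 : μ.dens - ν.dens = (1 + ‖μ.dens‖) • (μ.scaledDens - ν.scaledDens)
      + (‖μ.dens‖ - ‖ν.dens‖) • ν.scaledDens := by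
    conv_lhs => rw [h1 μ, h1 ν]
    module
  have h3 : |‖μ.dens‖ - ‖ν.dens‖| ≤ (1 + R) ^ 2 * ‖μ.scaledDens - ν.scaledDens‖ := by
    have h4 : ‖μ.dens‖ - ‖ν.dens‖ = (1 + ‖μ.dens‖) * (1 + ‖ν.dens‖)
        * (‖μ.scaledDens‖ - ‖ν.scaledDens‖) := by
      rw [Mac.norm_scaledDens, Mac.norm_scaledDens]
      have h5 : (1 + ‖μ.dens‖) ≠ 0 := by positivity
      have h6 : (1 + ‖ν.dens‖) ≠ 0 := by positivity
      field_simp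
      ring
    rw [h4, abs_mul, abs_of_nonneg (by positivity), sq]
    refine mul_le_mul (mul_le_mul ?_ ?_ ?_ ?_) 
      (abs_norm_sub_norm_le μ.scaledDens ν.scaledDens) (abs_nonneg _) ?_ <;>
      first | positivity | linarith
  rw [h2]
  refine (norm_add_le _ _).trans ?_
  rw [norm_smul, norm_smul, Real.norm_of_nonneg (by positivity), Real.norm_eq_abs, add_mul (1 + R)]
  refine add_le_add (mul_le_mul_of_nonneg_right (by linarith)
    (norm_nonneg (μ.scaledDens - ν.scaledDens))) ?_
  exact (mul_le_of_le_one_right (abs_nonneg _) ν.norm_scaledDens_le).trans h3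

/-- The functions `m / (n + 1 + m)` of the mass `m`, which control the mass. -/
noncomputable def Mac.massRatio (n : ℕ) (μ : Mac lam) : ℝ := ‖μ.dens‖ / ((n : ℝ) + 1 + ‖μ.dens‖)

theorem Mac.continuous_massRatio (n : ℕ) : Continuous (Mac.massRatio n : Mac lam → ℝ) := by
  have h1 := (Mac.isometry_dens (lam := lam)).continuous.norm
  exact h1.div (continuous_const.add h1) fun μ => by positivity

theorem Mac.massRatio_succ_le (n : ℕ) (μ : Mac lam) : Mac.massRatio (n + 1) μ ≤ Mac.massRatio n μ := by
  rw [Mac.massRatio, Mac.massRatio]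
  refine div_le_div_of_nonneg_left (norm_nonneg _) (by positivity) ?_
  push_cast
  linarith

theorem Mac.massRatio_le (n : ℕ) (μ : Mac lam) : Mac.massRatio n μ ≤ 1 :=
  div_le_one_of_le₀ (by linarith [Nat.cast_nonneg (α := ℝ) n]) (by positivity)

theorem Mac.tendsto_massRatio (μ : Mac lam) :
    Tendsto (fun n => Mac.massRatio n μ) atTop (𝓝 0) := by
  refine Tendsto.div_atTop tendsto_const_nhds ?_
  exact tendsto_atTop_add_const_right _ _
    (tendsto_atTop_add_const_right _ _ tendsto_natCast_atTop_atTop)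

/-- The level `1/2` of `massRatio n` is reached exactly at mass `n + 1`; this bounds the mass on the
sublevel sets. -/
theorem Mac.norm_dens_le_of_massRatio_le {n : ℕ} {μ : Mac lam} (h : Mac.massRatio n μ ≤ 1 / 2) :
    ‖μ.dens‖ ≤ n + 1 := by
  rw [Mac.massRatio, div_le_iff₀ (by positivity)] at h
  linarith

instance : Nonempty (Mac lam) := ⟨PsiM 0⟩

/-- A dense sequence of scaled densities. -/
noncomputable def scaledDensSeq [SecondCountableTopology (Mac lam)] (j : ℕ) : Lp ℝ 1 lam :=
  (TopologicalSpace.denseSeq (Mac lam) j).scaledDens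

variable [SecondCountableTopology (Mac lam)]

theorem norm_scaledDensSeq_le (j : ℕ) : ‖(scaledDensSeq j : Lp ℝ 1 lam)‖ ≤ 1 :=
  Mac.norm_scaledDens_le _

theorem Mac.scaledDens_mem_closure (μ : Mac lam) :
    μ.scaledDens ∈ closure (Set.range (scaledDensSeq : ℕ → Lp ℝ 1 lam)) := by
  have h1 := Mac.continuous_scaledDens.range_subset_closure_image_dense
    (TopologicalSpace.denseRange_denseSeq (Mac lam))
  rw [← Set.range_comp] at h1
  exact h1 ⟨μ, rfl⟩

theorem Mac.dist_scaledDensSeq_le (μ : Mac lam) (j : ℕ) :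
    dist μ.scaledDens (scaledDensSeq j) ≤ 2 := by
  refine (dist_le_norm_add_norm _ _).trans ?_
  linarith [μ.norm_scaledDens_le, norm_scaledDensSeq_le (lam := lam) j]

end Normalized

/-! ### Reduction to densities for closed isometric state spaces. -/

section FormCoreMac

variable {X Y M : Type*} [MeasurableSpace M] {lam : Measure M} [SigmaFinite lam]
  [SecondCountableTopology (Mac lam)] [MetricSpace X] [PolishSpace X] [MeasurableSpace X]
  [BorelSpace X]

/-- Quasi-regularity when the underlying space is isometric to a closed set of absolutely
continuous measures. -/
theorem IsFormCore.hasQuasiRegularClosure_of_isometry {X' : Type*} [MetricSpace X']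
    [CompleteSpace X'] [MeasurableSpace X'] [BorelSpace X']
    {m : X → Measure M} {D : Subalgebra ℝ (Y → ℝ)}
    {Λ : Measure X} [IsFiniteMeasure Λ] {J : Measure (X × X)} {V : X → ℝ}
    {A : ∀ x, Lp ℝ 2 (m x) →L[ℝ] Lp ℝ 2 (m x)} {e : X → Y} {d : (Y → ℝ) → Y → M → ℝ}
    (S : IsFormCore (Subalgebra.toSubmodule D) Λ J V A e d)
    (hd : IsClosable Λ (D : Set (Y → ℝ)) (fun u x => u (e x)) (diffForm Λ A e d))
    (hJ : ∫⁻ p, ENNReal.ofReal (min 1 (dist p.1 p.2 ^ 2)) ∂J < ∞)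
    (hA : Integrable (fun x => ‖A x‖) Λ) (hcont : ∀ u ∈ D, Continuous fun x => u (e x))
    {i : X → X'} (hi : IsClosedEmbedding i) {k : X' → Mac lam} (hk : Isometry k)
    (hsep : ∃ g : ℕ → Y → ℝ, (∀ n, g n ∈ D) ∧ ∀ x y, (∀ n, g n (e x) = g n (e y)) → x = y)
    {B : Set (Y → ℝ)} (hB : IsLatticeLike e B) {C : ℝ}
    (hBD : ∀ u ∈ B, u ∈ D ∧ (∀ x, |u (e x)| ≤ C) ∧
      (∀ x y, |u (e x) - u (e y)| ≤ 2 * C * dist x y) ∧ ∀ x, ‖toL2 (m x) (d u (e x))‖ ≤ C)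
    (hBt : ∀ t : Lp ℝ 1 lam, ‖t‖ ≤ 1 →
      (fun x => ‖(k (i x)).scaledDens - t‖) ∈ Approximable Λ e B)
    (hBr : ∀ n, (fun x => (k (i x)).massRatio n) ∈ Approximable Λ e B) :
    HasQuasiRegularClosure (Λ.map i) (D : Set (Y → ℝ))
      (fun u => Function.extend i (fun x => u (e x)) 0) (sumForm Λ J V A e d) := by
  refine S.hasQuasiRegularClosure hd hJ hA hcont hi hsep hB hBD (T := fun y => (k y).scaledDens)
    (t := scaledDensSeq) (c := 2) (r := fun n y => (k y).massRatio n)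
    (Mac.continuous_scaledDens.comp hk.continuous) (fun y => (k y).scaledDens_mem_closure)
    (fun y j => (k y).dist_scaledDensSeq_le j)
    (fun n => (Mac.continuous_massRatio n).comp hk.continuous)
    (fun n y => Mac.massRatio_succ_le n (k y))
    (fun n y => ((k y).massRatio_le n).trans one_le_two) (fun y => (k y).tendsto_massRatio)
    (fun n => ⟨(1 + ((n : ℝ) + 1)) + (1 + ((n : ℝ) + 1)) ^ 2, fun y z hy hz => ?_⟩)
    (fun j => ?_) hBr
  · rw [← hk.dist_eq]
    exact Mac.dist_le_scaledDens (Mac.norm_dens_le_of_massRatio_le hy)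
      (Mac.norm_dens_le_of_massRatio_le hz)
  · simpa only [dist_eq_norm] using hBt _ (norm_scaledDensSeq_le j)

end FormCoreMac

/-! ### Normalized integrals and the algebra `CE1b2`. -/

section FiniteMeasures

variable {M : Type*} [MeasurableSpace M] [TopologicalSpace M]

section Opens

variable [OpensMeasurableSpace M]

theorem integral_add_smul_dirac (f : BoundedContinuousFunction M ℝ) (μ : FiniteMeasure M) (x : M)
    (ε : ℝ≥0) : ∫ y, f y ∂((μ + ε • diracFinite x : FiniteMeasure M) : Measure M) =
      ∫ y, f y ∂(μ : Measure M) + ε * f x := by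
  rw [FiniteMeasure.toMeasure_add, FiniteMeasure.toMeasure_smul]
  have h1 : ((diracFinite x : FiniteMeasure M) : Measure M) = Measure.dirac x := rfl
  rw [h1, integral_add_measure (f.integrable _) ((f.integrable _).smul_measure_nnreal),
    integral_smul_nnreal_measure, integral_dirac' _ _ f.continuous.stronglyMeasurable]
  rfl

theorem coe_mass_eq_real (μ : FiniteMeasure M) : (μ.mass : ℝ) = (μ : Measure M).real Set.univ := rfl

theorem mass_add_smul_dirac (μ : FiniteMeasure M) (x : M) (ε : ℝ≥0) :
    ((μ + ε • diracFinite x).mass : ℝ) = μ.mass + ε := by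
  have h := integral_add_smul_dirac (BoundedContinuousFunction.const M (1 : ℝ)) μ x ε
  rw [coe_mass_eq_real, coe_mass_eq_real]
  simpa only [BoundedContinuousFunction.const_apply, integral_const, smul_eq_mul, mul_one] using h

theorem abs_integral_le_mass (f : BoundedContinuousFunction M ℝ) (hf : ∀ x, |f x| ≤ 1)
    (μ : FiniteMeasure M) : |∫ y, f y ∂(μ : Measure M)| ≤ μ.mass := by
  have h := norm_integral_le_of_norm_le_const (μ := (μ : Measure M)) (f := f) (C := 1)
    (Eventually.of_forall hf)
  rwa [one_mul, Real.norm_eq_abs, ← coe_mass_eq_real] at h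

/-- The extrinsic derivative of `μ ↦ μ(f) / (K + μ(M)) - b`. -/
theorem hasExtrinsicDeriv_ratio (f : BoundedContinuousFunction M ℝ) (hf : ∀ x, |f x| ≤ 1) {K : ℝ}
    (hK : 0 < K) (b : ℝ) :
    HasExtrinsicDeriv (fun μ : FiniteMeasure M => (∫ y, f y ∂(μ : Measure M)) / (K + μ.mass) - b)
      fun μ x => f x / (K + μ.mass) - (∫ y, f y ∂(μ : Measure M)) / (K + μ.mass) ^ 2 := by
  have hm : ∀ μ : FiniteMeasure M, 0 < K + (μ.mass : ℝ) := fun μ => by positivity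
  have hci := FiniteMeasure.continuous_integral_boundedContinuousFunction f
  have hcm : Continuous fun μ : FiniteMeasure M => K + (μ.mass : ℝ) := by fun_prop
  refine ⟨(hci.div hcm fun μ => (hm μ).ne').sub continuous_const, fun μ x => ?_, ?_, ?_⟩
  · have hg : HasDerivAt (fun s : ℝ => ((∫ y, f y ∂(μ : Measure M)) + s * f x)
        / (K + μ.mass + s) - b)
        (f x / (K + μ.mass) - (∫ y, f y ∂(μ : Measure M)) / (K + μ.mass) ^ 2) 0 := by
      have h1 : HasDerivAt (fun s : ℝ => (∫ y, f y ∂(μ : Measure M)) + s * f x) (f x) 0 := by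
        simpa using ((hasDerivAt_id (0 : ℝ)).mul_const (f x)).const_add
          (∫ y, f y ∂(μ : Measure M))
      have h2 : HasDerivAt (fun s : ℝ => K + μ.mass + s) 1 0 := (hasDerivAt_id 0).const_add _
      have h3 := (h1.div h2 (by simpa using (hm μ).ne')).sub_const b
      refine h3.congr_deriv ?_
      have := (hm μ).ne'
      simp only [add_zero, zero_mul, mul_one]
      field_simp
    refine tendsto_quot_of_hasDerivAt tendsto_coe_nnreal hg (Eventually.of_forall fun ε => ?_) ?_
    · rw [integral_add_smul_dirac, mass_add_smul_dirac, add_assoc]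
    · simp
  · refine Continuous.sub ?_ ?_
    · exact (f.continuous.comp continuous_snd).div (hcm.comp continuous_fst) fun p => (hm p.1).ne'
    · exact (hci.comp continuous_fst).div ((hcm.comp continuous_fst).pow 2)
        fun p => (pow_pos (hm p.1) 2).ne'
  · refine ⟨1 + |b| + 2 * K⁻¹, fun μ x => add_le_add ?_ ?_⟩
    · refine (abs_sub _ _).trans (add_le_add_left ?_ _)
      rw [abs_div, abs_of_pos (hm μ), div_le_one (hm μ)]
      linarith [abs_integral_le_mass f hf μ]
    · have h1 : |f x / (K + μ.mass)| ≤ K⁻¹ := by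
        rw [abs_div, abs_of_pos (hm μ), ← one_div]
        exact div_le_div₀ zero_le_one (hf x) hK (by simp)
      have h2 : |(∫ y, f y ∂(μ : Measure M)) / (K + μ.mass) ^ 2| ≤ K⁻¹ := by
        rw [abs_div, abs_of_pos (pow_pos (hm μ) 2), sq, ← div_div, ← one_div]
        refine div_le_div₀ zero_le_one ?_ hK (by simp)
        rw [div_le_one (hm μ)]
        linarith [abs_integral_le_mass f hf μ]
      refine (abs_sub _ _).trans ?_
      linarith

/-- Both terms of the quotient-rule derivative are at most `1/(K + m) ≤ 1/(1 + m)`, where `m` is the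
mass; this accounts for the constant `2` and the weight. -/
theorem ratio_mem_pathBall (f : BoundedContinuousFunction M ℝ) (hf : ∀ x, |f x| ≤ 1) {K : ℝ}
    (hK : 1 ≤ K) {b : ℝ} (hb : |b| ≤ 1) :
    (fun μ : FiniteMeasure M => (∫ y, f y ∂(μ : Measure M)) / (K + μ.mass) - b) ∈
      pathBall (𝓝[>] (0 : ℝ≥0)) (fun ε => (ε : ℝ)) (fun μ (x : M) ε => μ + ε • diracFinite x)
        (fun μ => (1 + (μ.mass : ℝ))⁻¹) 2 := by
  have hK0 : 0 < K := by linarith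
  have hm : ∀ μ : FiniteMeasure M, 0 < K + (μ.mass : ℝ) := fun μ => by positivity
  have hI : ∀ μ : FiniteMeasure M, |∫ y, f y ∂(μ : Measure M)| ≤ K + μ.mass := fun μ => by
    linarith [abs_integral_le_mass f hf μ]
  refine ⟨_, hasExtrinsicDeriv_ratio f hf hK0 b, fun μ => ?_, fun μ x => ?_⟩
  · refine (abs_sub _ _).trans ?_
    have : |(∫ y, f y ∂(μ : Measure M)) / (K + μ.mass)| ≤ 1 := by
      rw [abs_div, abs_of_pos (hm μ), div_le_one (hm μ)]
      exact hI μ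
    linarith
  · have h0 : (K + μ.mass)⁻¹ ≤ (1 + (μ.mass : ℝ))⁻¹ :=
      inv_anti₀ (by positivity) (by linarith)
    have h1 : |f x / (K + μ.mass)| ≤ (K + μ.mass)⁻¹ := by
      rw [abs_div, abs_of_pos (hm μ), ← one_div]
      exact div_le_div_of_nonneg_right (hf x) (hm μ).le
    have h2 : |(∫ y, f y ∂(μ : Measure M)) / (K + μ.mass) ^ 2| ≤ (K + μ.mass)⁻¹ := by
      rw [abs_div, abs_of_pos (pow_pos (hm μ) 2), sq, ← div_div, ← one_div]
      refine div_le_div_of_nonneg_right ?_ (hm μ).le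
      rw [div_le_one (hm μ)]
      exact hI μ
    refine (abs_sub _ _).trans ?_
    linarith

end Opens

section Algebra

variable [BorelSpace M] {lam : Measure M}

theorem mem_CE1b2_iff {u : FiniteMeasure M → ℝ} : u ∈ CE1b2 lam ↔ ∃ D, HasExtrinsicDeriv u D ∧
    ∃ C : ℝ≥0, ∀ μ : Mac lam, eLpNorm (D μ.1) 2 μ.meas ≤ C := by
  constructor
  · rintro ⟨h, C, hC⟩
    exact ⟨_, hasExtrinsicDeriv_of_mem h, C, hC⟩
  · rintro ⟨D, h, C, hC⟩
    exact ⟨h.mem_CE1b, C, by rwa [h.extrinsicDeriv_eq]⟩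

theorem comp_mem_CE1b2 [Nonempty M] {u : FiniteMeasure M → ℝ} (hu : u ∈ CE1b2 lam) {φ : ℝ → ℝ}
    (hφ : ContDiff ℝ 1 φ) : (fun μ => φ (u μ)) ∈ CE1b2 lam := by
  obtain ⟨D, h, C, hC⟩ := mem_CE1b2_iff.1 hu
  obtain ⟨B, hB⟩ := h.bddu
  obtain ⟨B', hB'⟩ := (isCompact_Icc (a := -B) (b := B)).exists_bound_of_continuousOn
      (hφ.continuous_deriv le_rfl).continuousOn
  refine mem_CE1b2_iff.2 ⟨_, h.comp tendsto_coe_nnreal hφ, B'.toNNReal * C, fun μ => ?_⟩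
  have h1 : (fun x => deriv φ (u μ.1) * D μ.1 x) = deriv φ (u μ.1) • D μ.1 := rfl
  rw [h1, eLpNorm_const_smul, ENNReal.coe_mul]
  refine mul_le_mul' ?_ (hC μ)
  rw [← ofReal_norm]
  exact ENNReal.ofReal_le_ofReal (hB' _ (abs_le.1 (hB _)))

/-- `CE1b2` as an algebra. -/
def CE1b2.subalgebra (lam : Measure M) [Nonempty M] : Subalgebra ℝ (FiniteMeasure M → ℝ) where
  carrier := CE1b2 lam
  mul_mem' := fun {u v} hu hv => by
    obtain ⟨D, h, C, hC⟩ := mem_CE1b2_iff.1 hu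
    obtain ⟨D', h', C', hC'⟩ := mem_CE1b2_iff.1 hv
    obtain ⟨B, hB⟩ := h.bddu
    obtain ⟨B', hB'⟩ := h'.bddu
    refine mem_CE1b2_iff.2 ⟨_, h.mul tendsto_coe_nnreal h', B'.toNNReal * C + B.toNNReal * C',
      fun μ => ?_⟩
    have h1 : (fun x => D μ.1 x * v μ.1 + u μ.1 * D' μ.1 x) = v μ.1 • D μ.1 + u μ.1 • D' μ.1 := by
      ext x
      simp [mul_comm]
    have hm := (h.continuous_right μ.1).measurable.aestronglyMeasurable (μ := μ.meas)
    have hm' := (h'.continuous_right μ.1).measurable.aestronglyMeasurable (μ := μ.meas)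
    rw [h1, ENNReal.coe_add, ENNReal.coe_mul, ENNReal.coe_mul]
    refine (eLpNorm_add_le (hm.const_smul _) (hm'.const_smul _) (by norm_num)).trans ?_
    rw [eLpNorm_const_smul, eLpNorm_const_smul, ← ofReal_norm, ← ofReal_norm]
    exact add_le_add (mul_le_mul' (ENNReal.ofReal_le_ofReal (hB' _)) (hC μ))
      (mul_le_mul' (ENNReal.ofReal_le_ofReal (hB _)) (hC' μ))
  add_mem' := fun {u v} hu hv => by
    obtain ⟨D, h, C, hC⟩ := mem_CE1b2_iff.1 hu
    obtain ⟨D', h', C', hC'⟩ := mem_CE1b2_iff.1 hv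
    refine mem_CE1b2_iff.2 ⟨_, h.add h', C + C', fun μ => ?_⟩
    have hm := (h.continuous_right μ.1).measurable.aestronglyMeasurable (μ := μ.meas)
    have hm' := (h'.continuous_right μ.1).measurable.aestronglyMeasurable (μ := μ.meas)
    rw [ENNReal.coe_add]
    exact (eLpNorm_add_le hm hm' (by norm_num)).trans (add_le_add (hC μ) (hC' μ))
  algebraMap_mem' := fun a =>
    mem_CE1b2_iff.2 ⟨_, HasPathDeriv.const a, 0, fun μ => by simp⟩

/-- The weight compensates for the mass of `μ`: the `L²(μ)` norm is at most `C√m/(1 + m) ≤ C`, so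
the class `pathBall` lies in `CE1b2` with uniform gradient bounds. -/
theorem eLpNorm_le_of_weighted {D : FiniteMeasure M → M → ℝ} {C : ℝ} (hC : 0 ≤ C)
    (hD : ∀ μ x, |D μ x| ≤ C * (1 + (μ.mass : ℝ))⁻¹) (μ : FiniteMeasure M) :
    eLpNorm (D μ) 2 (μ : Measure M) ≤ ENNReal.ofReal C := by
  refine (eLpNorm_le_of_ae_bound (Eventually.of_forall (hD μ))).trans ?_
  have h1 : (μ : Measure M) Set.univ = ENNReal.ofReal (μ.mass : ℝ) := by
    rw [ENNReal.ofReal_coe_nnreal, FiniteMeasure.ennreal_mass]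
  have hm : (0 : ℝ) ≤ μ.mass := μ.mass.2
  rw [h1, ENNReal.ofReal_rpow_of_nonneg hm (by simp), ← ENNReal.ofReal_mul (by positivity)]
  refine ENNReal.ofReal_le_ofReal ?_
  have h2 : ((2 : ℝ≥0∞).toReal)⁻¹ = (1 / 2 : ℝ) := by norm_num
  rw [h2, ← Real.sqrt_eq_rpow]
  have h3 : √(μ.mass : ℝ) ≤ 1 + (μ.mass : ℝ) := by
    rw [Real.sqrt_le_left (by positivity)]
    nlinarith
  calc √(μ.mass : ℝ) * (C * (1 + (μ.mass : ℝ))⁻¹)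
      = C * (√(μ.mass : ℝ) / (1 + (μ.mass : ℝ))) := by ring
    _ ≤ C * 1 := mul_le_mul_of_nonneg_left (div_le_one_of_le₀ h3 (by positivity)) hC
    _ = C := mul_one C

end Algebra

end FiniteMeasures

/-! ### Approximating total variation distances by domain functions. -/

section MacTools

variable {M : Type*} [MeasurableSpace M] [TopologicalSpace M] [PolishSpace M] [BorelSpace M]
  {lam : Measure M} [SigmaFinite lam]

theorem Mac.integral_dens (μ : Mac lam) (f : M → ℝ) :
    ∫ x, μ.dens x * f x ∂lam = ∫ x, f x ∂(μ.1 : Measure M) := by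
  rw [← integral_withDensityL1 μ.dens_nonneg, μ.withDensityL1_dens]

theorem Mac.integral_scaledDens_sub (μ : Mac lam) (t : Lp ℝ 1 lam)
    (f : BoundedContinuousFunction M ℝ) :
    ∫ x, (μ.scaledDens - t : Lp ℝ 1 lam) x * f x ∂lam =
      (∫ x, f x ∂(μ.1 : Measure M)) / (1 + μ.1.mass) - ∫ x, t x * f x ∂lam := by
  rw [← integral_mul_sub _ _ f.continuous.measurable.aestronglyMeasurable f.norm_coe_le_norm]
  congr 1
  rw [← μ.integral_dens, div_eq_inv_mul, ← μ.norm_dens, ← integral_const_mul]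
  refine integral_congr_ae ?_
  filter_upwards [Lp.coeFn_smul (1 + ‖μ.dens‖)⁻¹ μ.dens] with x hx
  rw [Mac.scaledDens, hx, Pi.smul_apply, smul_eq_mul, mul_assoc]

/-- The `L¹` norm is the supremum of the pairings with a norming sequence. Each pairing is a
normalized integral minus the constant `∫ t f dλ`, whose modulus is at most `1`. -/
theorem IsLatticeLike.norm_scaledDens_sub_mem {X Y : Type*} [MeasurableSpace X] {Λ : Measure X}
    [IsFiniteMeasure Λ] {e : X → Y} {B : Set (Y → ℝ)} (hB : IsLatticeLike e B) (k : X → Mac lam)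
    (h : ∀ f : BoundedContinuousFunction M ℝ, (∀ x, |f x| ≤ 1) → ∀ b : ℝ, |b| ≤ 1 →
      (fun x => (∫ y, f y ∂((k x).1 : Measure M)) / (1 + (k x).1.mass) - b) ∈ Approximable Λ e B)
    {t : Lp ℝ 1 lam} (ht : ‖t‖ ≤ 1) :
    (fun x => ‖(k x).scaledDens - t‖) ∈ Approximable Λ e B := by
  obtain ⟨f, hf, hfn⟩ := exists_norming_seq lam
  have h2 : ∀ x, ‖(k x).scaledDens - t‖ ≤ 2 := fun x => by
    linarith [norm_sub_le (k x).scaledDens t, (k x).norm_scaledDens_le]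
  have h1 : ∀ n x, |∫ y, ((k x).scaledDens - t : Lp ℝ 1 lam) y * f n y ∂lam| ≤
      ‖(k x).scaledDens - t‖ := fun n x => by
    simpa using abs_integral_mul_le ((k x).scaledDens - t) (hf n)
  refine hB.approximable_iSup (c := 2)
    (f := fun n x => ∫ y, ((k x).scaledDens - t : Lp ℝ 1 lam) y * f n y ∂lam) (fun n => ?_)
    (fun n x => (h1 n x).trans (h2 x)) (fun n x => (le_abs_self _).trans (h1 n x))
    fun x ε hε => hfn _ ε hε
  simp only [Mac.integral_scaledDens_sub]
  refine h (f n) (hf n) _ ((abs_integral_mul_le t (hf n)).trans ?_)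
  simpa using ht

theorem Mac.eq_of_norming {f : ℕ → BoundedContinuousFunction M ℝ}
    (hf : ∀ (g : Lp ℝ 1 lam) (ε : ℝ), 0 < ε → ∃ n, ‖g‖ - ε ≤ ∫ x, g x * f n x ∂lam) {μ ν : Mac lam}
    (h : ∀ n, ∫ x, f n x ∂(μ.1 : Measure M) = ∫ x, f n x ∂(ν.1 : Measure M)) : μ = ν := by
  refine Mac.isometry_dens.injective (sub_eq_zero.1 (norm_le_zero_iff.1 ?_))
  refine le_of_forall_pos_le_add fun ε hε => ?_
  obtain ⟨n, hn⟩ := hf (μ.dens - ν.dens) ε hε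
  rw [← integral_mul_sub _ _ (f n).continuous.measurable.aestronglyMeasurable (f n).norm_coe_le_norm,
    μ.integral_dens, ν.integral_dens, h n, sub_self] at hn
  linarith

theorem HasPathDeriv.abs_mac_sub_le {u : FiniteMeasure M → ℝ} {D : FiniteMeasure M → M → ℝ}
    (h : HasExtrinsicDeriv u D) {C : ℝ} (hC : ∀ μ x, |D μ x| ≤ C) (hC0 : 0 ≤ C) (μ ν : Mac lam) :
    |u μ.1 - u ν.1| ≤ 2 * C * dist μ ν := by
  have h1 := h.abs_withDensityL1_sub_le hC hC0 ν.dens_nonneg μ.dens_nonneg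
  rwa [μ.withDensityL1_dens, ν.withDensityL1_dens, ← dist_eq_norm,
    Mac.isometry_dens.dist_eq] at h1

end MacTools

/-! ### The assertion for finite measures. -/

section MacForm

variable {M : Type*} [TopologicalSpace M] [PolishSpace M] [MeasurableSpace M] [BorelSpace M]
  [Nonempty M] {lam : Measure M} [SigmaFinite lam] {Λ0 : Measure (H lam)}

instance [IsProbabilityMeasure Λ0] : IsProbabilityMeasure (LamM Λ0) :=
  Measure.isProbabilityMeasure_map continuous_PsiM.measurable.aemeasurable

theorem isFormCore_mac {Λ : Measure (Mac lam)} {A : CoeffM lam}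
    (hA : AdmissibleM Λ A) {V : Mac lam → ℝ} (hV : 0 ≤ᵐ[Λ] V)
    (hVi : Integrable V Λ) {J : Measure (Mac lam × Mac lam)} (hJ : IsJumpM Λ J) :
    IsFormCore (Subalgebra.toSubmodule (CE1b2.subalgebra lam)) Λ J V A
      (fun μ : Mac lam => μ.1) extrinsicDeriv := by
  refine isFormCore_of_hasPathDeriv tendsto_coe_nnreal Mac.measurable_meas Mac.continuous_val
    (fun u hu => hasExtrinsicDeriv_of_mem hu.1) (fun u E h => h.extrinsicDeriv_eq)
    (fun u hu => ?_) (fun u hu => ?_) (fun u hu φ hφ => comp_mem_CE1b2 hu hφ) hA.positive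
    hA.integrable_norm hA.measurable hV hVi hJ.lintegral_lt_top hJ.absolutelyContinuous
  · obtain ⟨C, hC⟩ := hu.2
    refine ⟨C, fun μ => IsFormCore.norm_toL2_le C.2 ((hC μ).trans (le_of_eq ?_))⟩
    rw [ENNReal.ofReal_coe_nnreal]
  · have h := hasExtrinsicDeriv_of_mem hu.1
    obtain ⟨C, hC⟩ := h.bddD
    exact ⟨2 * |C|, h.abs_mac_sub_le (fun μ x => (hC μ x).trans (le_abs_self C)) (abs_nonneg C)⟩

/-- The norm of the gradient at `h` is `2‖D^E u(h²λ)‖` in `L²(h²λ)`. This is where the uniform `L²`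
bound defining `CE1b2` enters. -/
theorem lift_mem_C1b {u : FiniteMeasure M → ℝ} (hu : u ∈ CE1b2 lam) :
    (fun h : H lam => u (PsiM h).1) ∈ C1b lam := by
  obtain ⟨D, h, C, hC⟩ := mem_CE1b2_iff.1 hu
  obtain ⟨B, hB⟩ := h.bddu
  refine ⟨h.contDiff_lift, ⟨B, fun k => hB _⟩, 2 * C, fun k => ?_⟩
  rw [h.gradient_lift]
  have hm : MemLp (D (PsiM k).1) 2 (sqMeasure k) :=
    ⟨(h.continuous_right _).measurable.aestronglyMeasurable, (hC (PsiM k)).trans_lt ENNReal.coe_lt_top⟩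
  have h1 : ‖toL2 (sqMeasure k) (D (PsiM k).1)‖ ≤ C :=
    IsFormCore.norm_toL2_le C.2 ((hC (PsiM k)).trans (by rw [ENNReal.ofReal_coe_nnreal]))
  have h2 : ‖liftGrad D k‖ ^ 2 = (2 * ‖toL2 (sqMeasure k) (D (PsiM k).1)‖) ^ 2 := by
    rw [mul_pow, norm_toL2_sq hm, norm_sq_H, integral_sqMeasure, ← integral_const_mul]
    refine integral_congr_ae ?_
    filter_upwards [h.liftGrad_ae k] with x hx
    rw [hx]
    ring
  rw [pow_left_inj₀ (norm_nonneg _) (by positivity) two_ne_zero] at h2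
  linarith

theorem form0M_lift {Λ : Measure (Mac lam)} (hΛ : Λ = LamM Λ0) {J : Measure (Mac lam × Mac lam)}
    {V : Mac lam → ℝ} {A : CoeffM lam}
    (S : IsFormCore (Subalgebra.toSubmodule (CE1b2.subalgebra lam)) Λ J V A
      (fun μ : Mac lam => μ.1) extrinsicDeriv) {u : FiniteMeasure M → ℝ} (hu : u ∈ CE1b2 lam) :
    form0M Λ0 A (fun h => u (PsiM h).1) (fun h => u (PsiM h).1) =
      4 * diffForm Λ A (fun μ : Mac lam => μ.1) extrinsicDeriv u u := by
  have h := hasExtrinsicDeriv_of_mem hu.1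
  have h1 := S.integrable_energy u hu u hu
  rw [diffForm, hΛ, LamM, integral_map continuous_PsiM.measurable.aemeasurable
    (by rw [hΛ] at h1; exact h1.1), ← integral_const_mul, form0M]
  refine integral_congr_ae (Eventually.of_forall fun k => ?_)
  have h2 := inner_liftOp k one_pos (ν := (PsiM k).meas) (by rw [ENNReal.ofReal_one, one_smul]; rfl)
    (A (PsiM k)) (S.d_memLp u hu (PsiM k)) (S.d_memLp u hu (PsiM k)) (h.liftGrad_ae k)
    (h.liftGrad_ae k)
  simp only
  rw [h.gradient_lift, h2, div_one]
  rfl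

/-- Composition with `PsiM` preserves `L²` norms and multiplies the diffusion form by `4`, so
closability on `H` applies directly to the lifted sequence. -/
theorem isClosable_diffForm_mac [IsProbabilityMeasure Λ0] {J : Measure (Mac lam × Mac lam)}
    {V : Mac lam → ℝ} {A : CoeffM lam}
    (S : IsFormCore (Subalgebra.toSubmodule (CE1b2.subalgebra lam)) (LamM Λ0) J V A
      (fun μ : Mac lam => μ.1) extrinsicDeriv) (hcl : IsClosable Λ0 (C1b lam) id (form0M Λ0 A)) :
    IsClosable (LamM Λ0) (CE1b2.subalgebra lam : Set (FiniteMeasure M → ℝ))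
      (fun u (μ : Mac lam) => u μ.1)
      (diffForm (LamM Λ0) A (fun μ : Mac lam => μ.1) extrinsicDeriv) := by
  intro u hu h0 hc
  have h1 := hcl (fun n h => u n (PsiM h).1) (fun n => lift_mem_C1b (hu n)) ?_ ?_
  · refine (((h1.const_mul (1 / 4)).congr fun n => ?_)).trans (by rw [mul_zero])
    rw [form0M_lift rfl S (hu n)]
    ring
  · refine h0.congr fun n => ?_
    rw [LamM, eLpNorm_map_measure (S.meas _ (hu n)).aestronglyMeasurable
      continuous_PsiM.measurable.aemeasurable]
    rfl
  · have h2 := hc.const_mul 4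
    rw [mul_zero] at h2
    refine h2.congr fun p => ?_
    exact (form0M_lift rfl S ((CE1b2.subalgebra lam).sub_mem (hu p.1) (hu p.2))).symm

theorem hasQuasiRegularClosure_formM [IsProbabilityMeasure Λ0] {A : CoeffM lam}
    (hA : AdmissibleM (LamM Λ0) A) (hcl : IsClosable Λ0 (C1b lam) id (form0M Λ0 A))
    {V : Mac lam → ℝ} (hV : 0 ≤ᵐ[LamM Λ0] V) (hVi : Integrable V (LamM Λ0))
    {J : Measure (Mac lam × Mac lam)} (hJ : IsJumpM (LamM Λ0) J) :
    HasQuasiRegularClosure (LamM Λ0) (CE1b2 lam) (onMac lam) (formM (LamM Λ0) J V A) := by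
  have S := isFormCore_mac hA hV hVi hJ
  obtain ⟨f, hf, hfn⟩ := exists_norming_seq lam
  have hone : ∀ x, |BoundedContinuousFunction.const M (1 : ℝ) x| ≤ 1 := fun x => by simp
  have hB := isLatticeLike_pathBall (X := Mac lam) (l := 𝓝[>] (0 : ℝ≥0)) (c := fun ε => (ε : ℝ))
    (path := fun μ (x : M) ε => μ + ε • diracFinite x) tendsto_coe_nnreal
    (w := fun μ => (1 + (μ.mass : ℝ))⁻¹) (fun μ => by positivity) two_pos Mac.continuous_val
  have hBD : ∀ u ∈ pathBall (𝓝[>] (0 : ℝ≥0)) (fun ε => (ε : ℝ))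
      (fun μ (x : M) ε => μ + ε • diracFinite x) (fun μ => (1 + (μ.mass : ℝ))⁻¹) 2,
      u ∈ CE1b2.subalgebra lam ∧ (∀ μ : Mac lam, |u μ.1| ≤ 2) ∧
      (∀ μ ν : Mac lam, |u μ.1 - u ν.1| ≤ 2 * 2 * dist μ ν) ∧
      ∀ μ : Mac lam, ‖toL2 μ.meas (extrinsicDeriv u μ.1)‖ ≤ 2 := by
    rintro u ⟨D, h, hu, hD⟩
    have h1 := eLpNorm_le_of_weighted zero_le_two hD
    refine ⟨mem_CE1b2_iff.2 ⟨D, h, 2, fun μ => (h1 μ.1).trans (by simp)⟩, fun μ => hu _,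
      h.abs_mac_sub_le (fun μ x => (hD μ x).trans ?_) zero_le_two, fun μ => ?_⟩
    · exact mul_le_of_le_one_right zero_le_two (inv_le_one_of_one_le₀ (by simp))
    · rw [h.extrinsicDeriv_eq]
      exact IsFormCore.norm_toL2_le zero_le_two (h1 μ.1)
  have hmain := S.hasQuasiRegularClosure_of_isometry (isClosable_diffForm_mac S hcl)
    hJ.lintegral_lt_top hA.integrable_norm (fun u hu => hu.1.1.comp Mac.continuous_val)
    IsClosedEmbedding.id isometry_id
    -- The entry `0` is `m/(1 + m)` and determines the mass `m`; the other ratios then determine the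
    -- integrals of the norming functions.
    ⟨fun n => Nat.casesOn n
      (fun μ => (∫ y, (BoundedContinuousFunction.const M (1 : ℝ)) y ∂(μ : Measure M))
        / (1 + μ.mass) - 0)
      (fun n μ => (∫ y, f n y ∂(μ : Measure M)) / (1 + μ.mass) - 0), fun n => ?_, fun μ ν h => ?_⟩
    hB hBD (fun t ht => hB.norm_scaledDens_sub_mem _ (fun g hg b hb =>
      hB.mem_approximable (ratio_mem_pathBall g hg le_rfl hb)) ht) fun n => ?_
  · rw [Measure.map_id] at hmain
    simp only [Function.extend_id] at hmain
    exact hmain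
  · cases n with
    | zero => exact (hBD _ (ratio_mem_pathBall _ hone le_rfl (by simp))).1
    | succ n => exact (hBD _ (ratio_mem_pathBall _ (hf n) le_rfl (by simp))).1
  · have hm : (μ.1.mass : ℝ) = ν.1.mass := by
      have h0 : (∫ y, (BoundedContinuousFunction.const M (1 : ℝ)) y ∂(μ.1 : Measure M))
        / (1 + μ.1.mass) - 0 = (∫ y, (BoundedContinuousFunction.const M (1 : ℝ)) y
          ∂(ν.1 : Measure M)) / (1 + ν.1.mass) - 0 := h 0
      simp only [BoundedContinuousFunction.const_apply, integral_const, smul_eq_mul, mul_one,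
        sub_zero, ← coe_mass_eq_real] at h0
      rw [div_eq_div_iff (by positivity) (by positivity)] at h0
      linarith
    refine Mac.eq_of_norming hfn fun n => ?_
    have h0 : (∫ y, f n y ∂(μ.1 : Measure M)) / (1 + μ.1.mass) - 0 =
      (∫ y, f n y ∂(ν.1 : Measure M)) / (1 + ν.1.mass) - 0 := h (n + 1)
    simp only [sub_zero, hm] at h0
    exact (div_left_inj' (by positivity)).1 h0
  -- `massRatio n` is the normalized integral of the constant `1` with `K = n + 1` and `b = 0`.
  · have h1 := hB.mem_approximable (Λ := LamM Λ0) (ratio_mem_pathBall _ hone (K := n + 1)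
      (by simp) (b := 0) (by simp))
    simp only [BoundedContinuousFunction.const_apply, integral_const, smul_eq_mul, mul_one,
        sub_zero, ← coe_mass_eq_real] at h1
    simpa only [Mac.massRatio, Mac.norm_dens, id] using h1

end MacForm

/-! ### Cutoff functions near the zero mass. -/

section Cutoff

/-- A smooth cutoff function which vanishes near the origin. -/
noncomputable def cutoff (n : ℕ) (t : ℝ) : ℝ := Real.smoothTransition (((n : ℝ) + 1) * t - 1)

theorem contDiff_cutoff (n : ℕ) : ContDiff ℝ 1 (cutoff n) :=
  (Real.smoothTransition.contDiff (n := 1)).comp ((contDiff_const.mul contDiff_id).sub contDiff_const)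

theorem cutoff_mem (n : ℕ) (t : ℝ) : 0 ≤ cutoff n t ∧ cutoff n t ≤ 1 :=
  ⟨Real.smoothTransition.nonneg _, Real.smoothTransition.le_one _⟩

theorem cutoff_eq_zero {n : ℕ} {t : ℝ} (h : ((n : ℝ) + 1) * t ≤ 1) : cutoff n t = 0 :=
  Real.smoothTransition.zero_of_nonpos (by linarith)

theorem cutoff_eq_one {n : ℕ} {t : ℝ} (h : 2 ≤ ((n : ℝ) + 1) * t) : cutoff n t = 1 :=
  Real.smoothTransition.one_of_one_le (by linarith)

theorem deriv_cutoff_eq_zero_of_lt {n : ℕ} {t : ℝ} (h : ((n : ℝ) + 1) * t < 1) :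
    deriv (cutoff n) t = 0 := by
  have h1 : cutoff n =ᶠ[𝓝 t] fun _ => (0 : ℝ) := by
    have h2 : ContinuousAt (fun t : ℝ => ((n : ℝ) + 1) * t) t := by fun_prop
    filter_upwards [h2.eventually (gt_mem_nhds h)] with s hs
    exact cutoff_eq_zero hs.le
  rw [h1.deriv_eq, deriv_const]

theorem deriv_cutoff_eq_zero_of_gt {n : ℕ} {t : ℝ} (h : 2 < ((n : ℝ) + 1) * t) :
    deriv (cutoff n) t = 0 := by
  have h1 : cutoff n =ᶠ[𝓝 t] fun _ => (1 : ℝ) := by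
    have h2 : ContinuousAt (fun t : ℝ => ((n : ℝ) + 1) * t) t := by fun_prop
    filter_upwards [h2.eventually (lt_mem_nhds h)] with s hs
    exact cutoff_eq_one hs.le
  rw [h1.deriv_eq, deriv_const]

/-- The derivative is of order `n + 1` but lives where `1 ≤ (n + 1)t ≤ 2`, so `t` times it is
bounded uniformly in `n`. This scale-invariant bound controls the error of the cutoff. -/
theorem exists_deriv_cutoff_bound : ∃ K : ℝ, 0 ≤ K ∧ ∀ n t,
    |deriv (cutoff n) t| ≤ ((n : ℝ) + 1) * K ∧ |t * deriv (cutoff n) t| ≤ 2 * K := by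
  have hσ : ContDiff ℝ 1 Real.smoothTransition := Real.smoothTransition.contDiff (n := 1)
  obtain ⟨K, hK⟩ := (isCompact_Icc (a := (0 : ℝ)) (b := 1)).exists_bound_of_continuousOn
    (hσ.continuous_deriv le_rfl).continuousOn
  have hK0 : 0 ≤ K := (norm_nonneg _).trans (hK 0 (by simp))
  have hd : ∀ n t, deriv (cutoff n) t
      = deriv Real.smoothTransition (((n : ℝ) + 1) * t - 1) * ((n : ℝ) + 1) := fun n t => by
    have h1 := (hσ.differentiable one_ne_zero (((n : ℝ) + 1) * t - 1)).hasDerivAt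
    have h2 : HasDerivAt (fun t : ℝ => ((n : ℝ) + 1) * t - 1) ((n : ℝ) + 1) t := by
      simpa using ((hasDerivAt_id t).const_mul ((n : ℝ) + 1)).sub_const 1
    exact (h1.comp t h2).deriv
  refine ⟨K, hK0, fun n t => ?_⟩
  have hn : (0 : ℝ) < (n : ℝ) + 1 := by positivity
  by_cases h : 1 ≤ ((n : ℝ) + 1) * t ∧ ((n : ℝ) + 1) * t ≤ 2
  · have h1 := hK (((n : ℝ) + 1) * t - 1) ⟨by linarith, by linarith⟩
    rw [Real.norm_eq_abs] at h1
    have ht : 0 ≤ t := by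
      by_contra! h'
      nlinarith
    have h2 : |deriv (cutoff n) t| ≤ ((n : ℝ) + 1) * K := by
      rw [hd, abs_mul, abs_of_pos hn, mul_comm]
      exact mul_le_mul_of_nonneg_left h1 hn.le
    refine ⟨h2, ?_⟩
    rw [abs_mul, abs_of_nonneg ht]
    have h3 := mul_le_mul_of_nonneg_left h2 ht
    nlinarith
  · have h1 : deriv (cutoff n) t = 0 := by
      rw [not_and_or, not_le, not_le] at h
      exact h.elim deriv_cutoff_eq_zero_of_lt deriv_cutoff_eq_zero_of_gt
    rw [h1, mul_zero, abs_zero]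
    exact ⟨by positivity, by positivity⟩

end Cutoff

/-! ### Extending functions of probability measures to finite measures. -/

section Extension

variable {M : Type*} [MeasurableSpace M] [TopologicalSpace M] [OpensMeasurableSpace M] [Nonempty M]

/-- The extension of a function of probability measures, cut off near the zero measure. -/
noncomputable def extendFun (n : ℕ) (u : ProbabilityMeasure M → ℝ) (μ : FiniteMeasure M) : ℝ :=
  cutoff n μ.mass * u μ.normalize

/-- The extrinsic derivative of `extendFun`. -/
noncomputable def extendDeriv (n : ℕ) (u : ProbabilityMeasure M → ℝ)
    (D : ProbabilityMeasure M → M → ℝ) (μ : FiniteMeasure M) (x : M) : ℝ :=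
  cutoff n μ.mass / μ.mass * D μ.normalize x + deriv (cutoff n) μ.mass * u μ.normalize

/-- Normalization is only used away from the zero measure, since `α` vanishes for masses below `a`.
Continuity of `α` is asked only from `a` on, which admits `cutoff n t / t`. -/
theorem continuous_mul_normalize {Z : Type*} [TopologicalSpace Z] {α : ℝ → ℝ} {a : ℝ} (ha : 0 < a)
    (h0 : ∀ t < a, α t = 0) (h1 : ∀ t, a ≤ t → ContinuousAt α t) {g : ProbabilityMeasure M → Z → ℝ}
    (hg : Continuous fun p : ProbabilityMeasure M × Z => g p.1 p.2) :
    Continuous fun p : FiniteMeasure M × Z => α p.1.mass * g p.1.normalize p.2 := by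
  have hm : Continuous fun p : FiniteMeasure M × Z => (p.1.mass : ℝ) := by fun_prop
  rw [continuous_iff_continuousAt]
  intro p
  rcases lt_or_ge (p.1.mass : ℝ) a with h | h
  · refine (continuousAt_const (y := (0 : ℝ))).congr ?_
    filter_upwards [hm.continuousAt.eventually (gt_mem_nhds h)] with q hq
    rw [h0 _ hq, zero_mul]
  · have hne : p.1 ≠ 0 := by
      rw [← FiniteMeasure.mass_nonzero_iff]
      intro h'
      rw [h', NNReal.coe_zero] at h
      linarith
    have h2 : Tendsto (fun q : FiniteMeasure M × Z => q.1.normalize) (𝓝 p) (𝓝 p.1.normalize) :=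
      FiniteMeasure.tendsto_normalize_of_tendsto continuous_fst.continuousAt hne
    have h3 : ContinuousAt (fun q : FiniteMeasure M × Z => g q.1.normalize q.2) p :=
      (hg.tendsto (p.1.normalize, p.2)).comp (h2.prodMk_nhds continuous_snd.continuousAt)
    exact (ContinuousAt.comp (f := fun q : FiniteMeasure M × Z => (q.1.mass : ℝ)) (h1 _ h)
      hm.continuousAt).mul h3

theorem continuous_mul_normalize_left {α : ℝ → ℝ} {a : ℝ} (ha : 0 < a)
    (h0 : ∀ t < a, α t = 0) (h1 : ∀ t, a ≤ t → ContinuousAt α t) {g : ProbabilityMeasure M → ℝ}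
    (hg : Continuous g) : Continuous fun μ : FiniteMeasure M => α μ.mass * g μ.normalize := by
  have h2 : Continuous fun p : FiniteMeasure M × Unit => α p.1.mass * g p.1.normalize :=
    continuous_mul_normalize (g := fun μ _ => g μ) ha h0 h1 (hg.comp continuous_fst)
  exact h2.comp (continuous_id.prodMk continuous_const : Continuous fun μ : FiniteMeasure M =>
    (μ, ()))

/-- Adding `εδ_x` to a measure of mass `m` moves its normalization along the convex path with
parameter `s = ε/(m + ε)`. Hence a derivative along mixtures yields one along additions, with the
factor `1/m`. -/
theorem normalize_add_smul_dirac {μ : FiniteMeasure M} (hμ : μ ≠ 0) (x : M) (ε : ℝ≥0)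
    {s : unitInterval} (hs : (s : ℝ) = ε / (μ.mass + ε)) :
    (μ + ε • diracFinite x).normalize = mixDirac μ.normalize x s := by
  have hm : μ.mass ≠ 0 := μ.mass_nonzero_iff.2 hμ
  have hmass : (μ + ε • diracFinite x).mass = μ.mass + ε := by
    have h1 : (diracFinite x : FiniteMeasure M).mass = 1 := by
      simp [FiniteMeasure.mass, diracFinite]
    have h2 := congrFun (FiniteMeasure.coeFn_add μ (ε • diracFinite x)) Set.univ
    rw [FiniteMeasure.coeFn_smul] at h2
    change (μ + ε • diracFinite x).mass = μ.mass + ε • (diracFinite x).mass at h2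
    rw [h2, h1, smul_eq_mul, mul_one]
  have hne : μ + ε • diracFinite x ≠ 0 := by
    rw [← FiniteMeasure.mass_nonzero_iff, hmass]
    positivity
  refine Subtype.ext ?_
  have h1 : (1 - s : ℝ) = ((μ.mass / (μ.mass + ε) : ℝ≥0) : ℝ) := by
    have : (μ.mass : ℝ) + ε ≠ 0 := by positivity
    rw [hs]
    push_cast
    field_simp
    ring
  have h2 : (s : ℝ) = ((ε / (μ.mass + ε) : ℝ≥0) : ℝ) := by rw [hs]; push_cast; rfl
  change (((μ + ε • diracFinite x).normalize : ProbabilityMeasure M) : Measure M) =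
    ENNReal.ofReal (1 - s) • (μ.normalize : Measure M) + ENNReal.ofReal s • Measure.dirac x
  rw [FiniteMeasure.toMeasure_normalize_eq_of_nonzero _ hne,
    FiniteMeasure.toMeasure_normalize_eq_of_nonzero _ hμ, h1, h2, ENNReal.ofReal_coe_nnreal,
    ENNReal.ofReal_coe_nnreal, hmass, FiniteMeasure.toMeasure_add, FiniteMeasure.toMeasure_smul]
  change (μ.mass + ε)⁻¹ • ((μ : Measure M) + ε • Measure.dirac x) =
    (μ.mass / (μ.mass + ε)) • (μ.mass⁻¹ • (μ : Measure M)) + (ε / (μ.mass + ε)) • Measure.dirac x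
  rw [smul_add, smul_smul, smul_smul]
  congr 2
  · field_simp
  · field_simp

theorem HasPathDeriv.extend {u : ProbabilityMeasure M → ℝ} {D : ProbabilityMeasure M → M → ℝ}
    (h : HasConvExtrinsicDeriv u D) (n : ℕ) :
    HasExtrinsicDeriv (extendFun n u) (extendDeriv n u D) := by
  have hn : (0 : ℝ) < (n : ℝ) + 1 := by positivity
  have ha : (0 : ℝ) < 1 / ((n : ℝ) + 1) := by positivity
  have hlt : ∀ t < 1 / ((n : ℝ) + 1), ((n : ℝ) + 1) * t < 1 := fun t ht => by
    rwa [lt_div_iff₀ hn, mul_comm] at ht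
  have hχ := contDiff_cutoff n
  obtain ⟨C, hC⟩ := h.bdd
  obtain ⟨K, hK0, hK⟩ := exists_deriv_cutoff_bound
  refine ⟨?_, fun μ x => ?_, ?_, ?_⟩
  · exact continuous_mul_normalize_left ha (fun t ht => cutoff_eq_zero (hlt t ht).le)
      (fun t _ => hχ.continuous.continuousAt) h.cont
  · rcases lt_or_ge (μ.mass : ℝ) (1 / ((n : ℝ) + 1)) with hμ | hμ
    · have h1 : extendDeriv n u D μ x = 0 := by
        rw [extendDeriv, cutoff_eq_zero (hlt _ hμ).le, deriv_cutoff_eq_zero_of_lt (hlt _ hμ)]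
        simp
      rw [h1]
      refine (tendsto_const_nhds (x := (0 : ℝ))).congr' ?_
      have h2 : Tendsto (fun ε : ℝ≥0 => (μ.mass : ℝ) + ε) (𝓝[>] 0) (𝓝 (μ.mass + (0 : ℝ≥0))) :=
        (Continuous.tendsto (by fun_prop) 0).mono_left nhdsWithin_le_nhds
      rw [NNReal.coe_zero, add_zero] at h2
      filter_upwards [h2.eventually (gt_mem_nhds hμ)] with ε hε
      rw [extendFun, extendFun, mass_add_smul_dirac, cutoff_eq_zero (hlt _ hε).le,
        cutoff_eq_zero (hlt _ hμ).le]
      simp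
    · have hm : 0 < (μ.mass : ℝ) := ha.trans_le hμ
      have hne : μ ≠ 0 := by
        rw [← FiniteMeasure.mass_nonzero_iff]
        intro h'
        rw [h', NNReal.coe_zero] at hm
        exact hm.false
      let s : ℝ≥0 → unitInterval := fun ε => ⟨ε / (μ.mass + ε), by positivity,
        div_le_one_of_le₀ (by simp) (by positivity)⟩
      have hs : Tendsto s (𝓝[>] 0) (𝓝[>] 0) := by
        refine tendsto_nhdsWithin_iff.2 ⟨?_, ?_⟩
        · have hsc : Continuous s := by
            refine Continuous.subtype_mk ?_ _
            exact NNReal.continuous_coe.div (continuous_const.add NNReal.continuous_coe)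
              fun ε => by positivity
          refine (hsc.tendsto' 0 0 ?_).mono_left nhdsWithin_le_nhds
          exact Subtype.ext (by simp [s])
        · filter_upwards [self_mem_nhdsWithin] with ε hε
          have hε' : (0 : ℝ) < ε := by exact_mod_cast hε
          have : (0 : ℝ) < s ε := div_pos hε' (by positivity)
          exact this
      have hc0 : Tendsto (fun ε : ℝ≥0 => (ε : ℝ)) (𝓝[>] 0) (𝓝 0) :=
        tendsto_coe_nnreal.mono_right nhdsWithin_le_nhds
      have h1 : Tendsto (fun ε : ℝ≥0 => cutoff n (μ.mass + ε)) (𝓝[>] 0) (𝓝 (cutoff n μ.mass)) := by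
        have := (hχ.continuous.tendsto (μ.mass + 0)).comp (hc0.const_add (μ.mass : ℝ))
        rwa [add_zero] at this
      have h2 : Tendsto (fun ε : ℝ≥0 => ((μ.mass : ℝ) + ε)⁻¹) (𝓝[>] 0) (𝓝 (μ.mass : ℝ)⁻¹) := by
        have := (hc0.const_add (μ.mass : ℝ)).inv₀ (by simpa using hm.ne')
        rwa [add_zero] at this
      have h3 := (h.quot μ.normalize x).comp hs
      have h4 : Tendsto (fun ε : ℝ≥0 => (cutoff n (μ.mass + ε) - cutoff n μ.mass) / ε) (𝓝[>] 0)
          (𝓝 (deriv (cutoff n) μ.mass)) := by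
        have h5 := (hχ.differentiable one_ne_zero (μ.mass : ℝ)).hasDerivAt
        have h6 : HasDerivAt (fun r : ℝ => cutoff n (μ.mass + r)) (deriv (cutoff n) μ.mass) 0 :=
          HasDerivAt.comp_const_add (f := cutoff n) (μ.mass : ℝ) 0 (by simpa using h5)
        exact tendsto_quot_of_hasDerivAt tendsto_coe_nnreal h6 (Eventually.of_forall fun ε => rfl)
          (by simp)
      -- The quotient of the product is `χ(m + ε)` times the quotient of `u` times `s/ε = 1/(m +
      -- ε)`, plus the quotient of `χ` times `u`.
      have h7 := ((h1.mul h2).mul h3).add (h4.mul_const (u μ.normalize))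
      rw [← div_eq_mul_inv] at h7
      refine h7.congr' ?_
      filter_upwards [self_mem_nhdsWithin] with ε hε
      have hε' : (0 : ℝ) < ε := by exact_mod_cast hε
      rw [extendFun, extendFun, mass_add_smul_dirac, normalize_add_smul_dirac hne x ε (s := s ε) rfl]
      have hsε : ((s ε : unitInterval) : ℝ) = ε / (μ.mass + ε) := rfl
      have hmε : (μ.mass : ℝ) + ε ≠ 0 := by positivity
      simp only [Function.comp_apply]
      rw [hsε]
      field_simp
      ring
  · refine Continuous.add ?_ ?_
    · have h0 : ∀ t < 1 / ((n : ℝ) + 1), cutoff n t / t = 0 := fun t ht => by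
        rw [cutoff_eq_zero (hlt t ht).le, zero_div]
      have h1 : ∀ t, 1 / ((n : ℝ) + 1) ≤ t → ContinuousAt (fun t => cutoff n t / t) t :=
        fun t ht => hχ.continuous.continuousAt.div continuousAt_id (ha.trans_le ht).ne'
      exact continuous_mul_normalize ha h0 h1 h.contD
    · exact continuous_mul_normalize (g := fun μ _ => u μ) ha
        (fun t ht => deriv_cutoff_eq_zero_of_lt (hlt t ht))
        (fun t _ => (hχ.continuous_deriv le_rfl).continuousAt) (h.cont.comp continuous_fst)
  · refine ⟨C + (((n : ℝ) + 1) * C + ((n : ℝ) + 1) * K * C), fun μ x => ?_⟩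
    have hC1 : |u μ.normalize| ≤ C := (le_add_of_nonneg_right (abs_nonneg _)).trans (hC _ x)
    have hC2 : |D μ.normalize x| ≤ C := (le_add_of_nonneg_left (abs_nonneg _)).trans (hC _ x)
    have hC0 : 0 ≤ C := (abs_nonneg _).trans hC1
    obtain ⟨hc0, hc1⟩ := cutoff_mem n μ.mass
    have h1 : |cutoff n μ.mass / μ.mass| ≤ (n : ℝ) + 1 := by
      rcases lt_or_ge (μ.mass : ℝ) (1 / ((n : ℝ) + 1)) with hμ | hμ
      · rw [cutoff_eq_zero (hlt _ hμ).le, zero_div, abs_zero]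
        exact hn.le
      · have hm : 0 < (μ.mass : ℝ) := ha.trans_le hμ
        rw [div_le_iff₀ hn] at hμ
        rw [abs_of_nonneg (by positivity), div_le_iff₀ hm]
        linarith
    refine add_le_add ?_ ((abs_add_le _ _).trans (add_le_add ?_ ?_))
    · rw [extendFun, abs_mul, abs_of_nonneg hc0]
      calc _ ≤ 1 * C := mul_le_mul hc1 hC1 (abs_nonneg _) zero_le_one
        _ = C := one_mul C
    · rw [abs_mul]
      exact mul_le_mul h1 hC2 (abs_nonneg _) hn.le
    · rw [abs_mul]
      exact mul_le_mul (hK n _).1 hC1 (abs_nonneg _) (by positivity)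

end Extension

/-- The right side minus the left side is the nonnegative quadratic form at `x - y`. -/
theorem inner_add_le_of_isPositive {L : Type*} [NormedAddCommGroup L] [InnerProductSpace ℝ L]
    [CompleteSpace L] {T : L →L[ℝ] L} (hT : T.IsPositive) (x y : L) :
    inner ℝ (T (x + y)) (x + y) ≤ 2 * inner ℝ (T x) x + 2 * inner ℝ (T y) y := by
  have h := hT.inner_nonneg_left (x - y)
  simp only [map_add, map_sub, inner_add_left, inner_add_right, inner_sub_left,
    inner_sub_right] at h ⊢
  linarith

theorem inner_le_opNorm {L : Type*} [NormedAddCommGroup L] [InnerProductSpace ℝ L]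
    (T : L →L[ℝ] L) {x : L} {r : ℝ} (hx : ‖x‖ ≤ r) : inner ℝ (T x) x ≤ ‖T‖ * r ^ 2 := by
  calc _ ≤ ‖T x‖ * ‖x‖ := real_inner_le_norm _ _
    _ ≤ (‖T‖ * ‖x‖) * ‖x‖ := mul_le_mul_of_nonneg_right (T.le_opNorm x) (norm_nonneg _)
    _ = ‖T‖ * ‖x‖ ^ 2 := by ring
    _ ≤ ‖T‖ * r ^ 2 := mul_le_mul_of_nonneg_left (pow_le_pow_left₀ (norm_nonneg _) hx 2)
      (norm_nonneg _)

/-! ### Probability measures: Lipschitz bounds and lifts to `H`. -/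

section PacForm

variable {M : Type*} [TopologicalSpace M] [MeasurableSpace M] [BorelSpace M]

/-- `PCE1b` as an algebra. -/
def PCE1b.subalgebra (M : Type*) [TopologicalSpace M] [MeasurableSpace M] [BorelSpace M] :
    Subalgebra ℝ (ProbabilityMeasure M → ℝ) where
  carrier := PCE1b M
  mul_mem' := fun hu hv => ((hasConvExtrinsicDeriv_of_mem hu).mul tendsto_coe_unitInterval
    (hasConvExtrinsicDeriv_of_mem hv)).mem_PCE1b
  add_mem' := fun hu hv =>
    ((hasConvExtrinsicDeriv_of_mem hu).add (hasConvExtrinsicDeriv_of_mem hv)).mem_PCE1b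
  algebraMap_mem' := fun a => HasPathDeriv.mem_PCE1b (HasPathDeriv.const a)

variable [PolishSpace M] [Nonempty M] {lam : Measure M} [SigmaFinite lam]

theorem mass_PsiM (h : H lam) : ((PsiM h).1.mass : ℝ) = ‖h‖ ^ 2 := by
  rw [← Mac.norm_dens, Mac.dens_PsiM, norm_sqL1]

theorem normalize_PsiM (h : H0 lam) : (PsiM h.1).1.normalize = (PsiP h).1 := by
  have h0 : (PsiM h.1).1 ≠ 0 := by
    rw [← FiniteMeasure.mass_nonzero_iff, ← NNReal.coe_ne_zero, mass_PsiM]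
    exact pow_ne_zero 2 (norm_ne_zero_iff.2 h.2)
  refine Subtype.ext ?_
  change ((PsiM h.1).1.normalize : Measure M) = (ENNReal.ofReal (∫ x, h.1 x ^ 2 ∂lam))⁻¹ • sqMeasure h.1
  rw [FiniteMeasure.toMeasure_normalize_eq_of_nonzero _ h0, ← norm_sq_H, ← mass_PsiM,
    ENNReal.ofReal_coe_nnreal, ← ENNReal.coe_inv (FiniteMeasure.mass_nonzero_iff _ |>.2 h0)]
  rfl

/-- Functions with a convexity extrinsic derivative are Lipschitz in total variation. -/
theorem exists_abs_pac_sub_le (lam : Measure M) [SigmaFinite lam] : ∃ κ : ℝ, 1 ≤ κ ∧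
    ∀ (u : ProbabilityMeasure M → ℝ) (D : ProbabilityMeasure M → M → ℝ),
    HasConvExtrinsicDeriv u D → ∀ C : ℝ, 0 ≤ C → (∀ μ, |u μ| ≤ C) → (∀ μ x, |D μ x| ≤ C) →
    ∀ μ ν : Pac lam, |u μ.1 - u ν.1| ≤ 2 * (κ * C) * dist μ ν := by
  obtain ⟨K, hK0, hK⟩ := exists_deriv_cutoff_bound
  -- For `n = 1` the extension agrees with `u` at mass one, as `cutoff 1 1 = 1`. Its derivative is
  -- bounded through `|χ(m)/m| ≤ 2` and `|χ'| ≤ 2K`.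
  refine ⟨2 + 2 * K, by linarith, fun u D h C hC0 hu hD μ ν => ?_⟩
  have hself : ∀ μ : Pac lam, extendFun 1 u μ.toMac.1 = u μ.1 := fun μ => by
    have h1 : (μ.toMac.1.mass : ℝ) = 1 := by rw [← Mac.norm_dens, Pac.dens_toMac, Pac.norm_dens]
    have h2 : μ.toMac.1.normalize = μ.1 := ProbabilityMeasure.toFiniteMeasure_normalize_eq_self μ.1
    rw [extendFun, h1, h2, cutoff_eq_one (by norm_num), one_mul]
  have hb : ∀ μ x, |extendDeriv 1 u D μ x| ≤ (2 + 2 * K) * C := fun μ x => by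
    have h1 : |cutoff 1 μ.mass / μ.mass| ≤ 2 := by
      rcases le_or_gt ((((1 : ℕ) : ℝ) + 1) * μ.mass) 1 with hμ | hμ
      · rw [cutoff_eq_zero hμ, zero_div, abs_zero]
        exact zero_le_two
      · push_cast at hμ
        have hm : 0 < (μ.mass : ℝ) := by linarith
        obtain ⟨hc0, hc1⟩ := cutoff_mem 1 μ.mass
        rw [abs_of_nonneg (by positivity), div_le_iff₀ hm]
        linarith
    have h2 := (hK 1 μ.mass).1
    push_cast at h2
    rw [extendDeriv]
    refine (abs_add_le _ _).trans ?_
    rw [abs_mul, abs_mul, add_mul]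
    refine add_le_add (mul_le_mul h1 (hD _ _) (abs_nonneg _) zero_le_two)
      (mul_le_mul (h2.trans (by linarith)) (hu _) (abs_nonneg _) (by positivity))
  have h1 := (h.extend 1).abs_mac_sub_le hb (by positivity) μ.toMac ν.toMac
  rwa [hself, hself, Pac.isometry_toMac.dist_eq] at h1

theorem norm_toL2_le_of_bound {ν : Measure M} [IsProbabilityMeasure ν] {f : M → ℝ} {C : ℝ}
    (hf : ∀ x, |f x| ≤ C) : ‖toL2 ν f‖ ≤ C := by
  have hC : 0 ≤ C := (abs_nonneg _).trans (hf (Classical.arbitrary M))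
  refine IsFormCore.norm_toL2_le hC ?_
  refine (eLpNorm_le_of_ae_bound (Eventually.of_forall hf)).trans ?_
  simp

theorem isFormCore_pac {Λ : Measure (Pac lam)} {A : CoeffP lam} (hA : AdmissibleP Λ A)
    {V : Pac lam → ℝ} (hV : 0 ≤ᵐ[Λ] V) (hVi : Integrable V Λ) {J : Measure (Pac lam × Pac lam)}
    (hJ : IsJumpP Λ J) :
    IsFormCore (Subalgebra.toSubmodule (PCE1b.subalgebra M)) Λ J V A
      (fun μ : Pac lam => μ.1) convExtrinsicDeriv := by
  refine isFormCore_of_hasPathDeriv tendsto_coe_unitInterval Pac.measurable_meas Pac.continuous_val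
    (fun u hu => hasConvExtrinsicDeriv_of_mem hu) (fun u E h => h.convExtrinsicDeriv_eq)
    (fun u hu => ?_) (fun u hu => ?_)
    (fun u hu φ hφ => ((hasConvExtrinsicDeriv_of_mem hu).comp tendsto_coe_unitInterval hφ).mem_PCE1b)
    hA.positive
    hA.integrable_norm hA.measurable hV hVi hJ.lintegral_lt_top hJ.absolutelyContinuous
  · obtain ⟨C, hC⟩ := (hasConvExtrinsicDeriv_of_mem hu).bddD
    exact ⟨C, fun μ => norm_toL2_le_of_bound (hC _)⟩
  · have h := hasConvExtrinsicDeriv_of_mem hu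
    obtain ⟨C, hC⟩ := h.bddD
    obtain ⟨C', hC'⟩ := h.bddu
    obtain ⟨κ, -, hκ⟩ := exists_abs_pac_sub_le lam
    exact ⟨_, hκ u _ h (max |C| |C'|) (by positivity)
      (fun μ => (hC' μ).trans ((le_abs_self _).trans (le_max_right _ _)))
      (fun μ x => (hC μ x).trans ((le_abs_self _).trans (le_max_left _ _)))⟩

/-- Multiplying the extrinsic derivative of the extension at `k²λ` by `t = ‖k‖²` gives `χ(t)` times
the derivative of `u` plus `tχ'(t)u`, bounded by `(1 + 2K)C`. Since the gradient is `2k` times that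
derivative, `‖k‖` times its norm is bounded. -/
theorem lift_mem_C1b0 {u : ProbabilityMeasure M → ℝ} (hu : u ∈ PCE1b M) (n : ℕ) :
    (fun h : H lam => extendFun n u (PsiM h).1) ∈ C1b0 lam := by
  have h := hasConvExtrinsicDeriv_of_mem hu
  have hn := h.extend n
  obtain ⟨B, hB⟩ := hn.bddu
  obtain ⟨C, hC⟩ := h.bdd
  obtain ⟨K, hK0, hK⟩ := exists_deriv_cutoff_bound
  refine ⟨hn.contDiff_lift, ⟨B, fun k => hB _⟩, 2 * ((1 + 2 * K) * C), fun k => ?_⟩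
  rw [hn.gradient_lift]
  by_cases hk : ‖k‖ = 0
  · have hC0 : 0 ≤ C := by
      refine le_trans ?_ (hC (PsiM k).1.normalize (Classical.arbitrary M))
      positivity
    rw [hk, zero_mul]
    positivity
  have hb : ∀ x, ‖k‖ ^ 2 * |extendDeriv n u (convExtrinsicDeriv u) (PsiM k).1 x|
      ≤ (1 + 2 * K) * C := fun x => by
    have hC1 : |u (PsiM k).1.normalize| ≤ C := (le_add_of_nonneg_right (abs_nonneg _)).trans (hC _ x)
    have hC2 : |convExtrinsicDeriv u (PsiM k).1.normalize x| ≤ C :=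
      (le_add_of_nonneg_left (abs_nonneg _)).trans (hC _ x)
    have hC0 := (abs_nonneg _).trans hC1
    obtain ⟨hc0, hc1⟩ := cutoff_mem n (‖k‖ ^ 2)
    have h1 : ‖k‖ ^ 2 * |extendDeriv n u (convExtrinsicDeriv u) (PsiM k).1 x| =
        |cutoff n (‖k‖ ^ 2) * convExtrinsicDeriv u (PsiM k).1.normalize x
          + (‖k‖ ^ 2 * deriv (cutoff n) (‖k‖ ^ 2)) * u (PsiM k).1.normalize| := by
      rw [← abs_of_nonneg (sq_nonneg ‖k‖), ← abs_mul, abs_of_nonneg (sq_nonneg ‖k‖), extendDeriv,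
        mass_PsiM]
      congr 1
      field_simp
    rw [h1]
    refine (abs_add_le _ _).trans ?_
    rw [abs_mul, abs_mul, add_mul]
    refine add_le_add (mul_le_mul ?_ hC2 (abs_nonneg _) zero_le_one)
      (mul_le_mul (hK n _).2 hC1 (abs_nonneg _) (by positivity))
    rwa [abs_of_nonneg hc0]
  have h2 : ‖‖k‖ ^ 2 • liftGrad (extendDeriv n u (convExtrinsicDeriv u)) k‖ ≤
      (2 * ((1 + 2 * K) * C)) * ‖k‖ := by
    refine Lp.norm_le_mul_norm_of_ae_le_mul ?_
    filter_upwards [hn.liftGrad_ae k, Lp.coeFn_smul (‖k‖ ^ 2)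
      (liftGrad (extendDeriv n u (convExtrinsicDeriv u)) k)] with x h3 h4
    rw [h4, Pi.smul_apply, h3, smul_eq_mul, Real.norm_eq_abs, Real.norm_eq_abs, abs_mul, abs_mul,
      abs_mul, abs_of_nonneg (sq_nonneg ‖k‖), abs_two]
    have h5 := mul_le_mul_of_nonneg_left (hb x) (abs_nonneg (k x))
    nlinarith
  rw [norm_smul, Real.norm_of_nonneg (sq_nonneg _), sq, mul_assoc, mul_comm] at h2
  exact le_of_mul_le_mul_right h2 (lt_of_le_of_ne (norm_nonneg _) (Ne.symm hk))

end PacForm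

/-! ### Lifted gradients and the size of the cutoff error. -/

section PacClosable

variable {M : Type*} [TopologicalSpace M] [MeasurableSpace M] [BorelSpace M] [PolishSpace M]
  [Nonempty M] {lam : Measure M} [SigmaFinite lam] {Λ0 : Measure (H lam)}

theorem measurableEmbedding_H0 : MeasurableEmbedding (Subtype.val : H0 lam → H lam) :=
  MeasurableEmbedding.subtype_coe (measurableSet_singleton (0 : H lam)).compl

instance [IsProbabilityMeasure Λ0] : IsFiniteMeasure (restrictH0 Λ0) := by
  refine ⟨?_⟩
  rw [restrictH0, measurableEmbedding_H0.comap_apply]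
  exact measure_lt_top _ _

instance [IsProbabilityMeasure Λ0] : IsFiniteMeasure (LamP Λ0) := by
  rw [LamP]
  infer_instance

/-- The origin is a null point, so restricting `Λ0` to `H0` loses nothing. -/
theorem eLpNorm_restrictH0 (hΛ0 : Λ0 {0} = 0) (f : H lam → ℝ) :
    eLpNorm f 2 Λ0 = eLpNorm (fun k : H0 lam => f k.1) 2 (restrictH0 Λ0) := by
  have h1 : (restrictH0 Λ0).map Subtype.val = Λ0 := by
    rw [restrictH0, measurableEmbedding_H0.map_comap, Measure.restrict_eq_self_of_ae_mem]
    have h2 : ∀ᵐ k ∂Λ0, k ∉ ({0} : Set (H lam)) := measure_eq_zero_iff_ae_notMem.1 hΛ0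
    filter_upwards [h2] with k hk
    exact ⟨⟨k, hk⟩, rfl⟩
  conv_lhs => rw [← h1]
  exact measurableEmbedding_H0.eLpNorm_map_measure

theorem PsiP_meas (k : H0 lam) :
    (PsiP k).meas = ENNReal.ofReal ((‖k.1‖ ^ 2)⁻¹) • sqMeasure k.1 := by
  have h0 : 0 < ‖k.1‖ := norm_pos_iff.2 k.2
  rw [ENNReal.ofReal_inv_of_pos (by positivity), norm_sq_H]
  rfl

/-- The form on `H` for a lifted function. -/
theorem form0P_lift (A : CoeffP lam) {U : FiniteMeasure M → ℝ} {E : FiniteMeasure M → M → ℝ}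
    (h : HasExtrinsicDeriv U E) :
    form0P Λ0 A (fun k => U (PsiM k).1) (fun k => U (PsiM k).1) =
      4 * ∫ k : H0 lam, inner ℝ
        (A (PsiP k) (toL2 (PsiP k).meas fun x => ‖k.1‖ ^ 2 * E (PsiM k.1).1 x))
        (toL2 (PsiP k).meas fun x => ‖k.1‖ ^ 2 * E (PsiM k.1).1 x) ∂(restrictH0 Λ0) := by
  rw [← integral_const_mul, form0P]
  refine integral_congr_ae (Eventually.of_forall fun k => ?_)
  have h0 : 0 < ‖k.1‖ := norm_pos_iff.2 k.2
  obtain ⟨C, hC⟩ := h.bddD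
  have hE : MemLp (E (PsiM k.1).1) 2 (PsiP k).meas :=
    MemLp.of_bound (h.continuous_right _).measurable.aestronglyMeasurable C
      (Eventually.of_forall (hC _))
  -- Here `4/κ = 4‖k‖²`. With the weight `‖k‖²` of the form this is `4‖k‖⁴`, shared by the two
  -- gradients as `‖k‖²` each.
  have h1 := inner_liftOp k.1 (κ := (‖k.1‖ ^ 2)⁻¹) (by positivity) (PsiP_meas k) (A (PsiP k)) hE hE
    (h.liftGrad_ae k.1) (h.liftGrad_ae k.1)
  have h2 : (fun x => ‖k.1‖ ^ 2 * E (PsiM k.1).1 x) = ‖k.1‖ ^ 2 • E (PsiM k.1).1 := rfl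
  simp only
  rw [h.gradient_lift, h1, h2, IsFormCore.toL2_smul _ hE, map_smul, real_inner_smul_left,
    real_inner_smul_right]
  field_simp

/-- The lift of the derivative of the extension of `u`. -/
noncomputable def cutGrad (n : ℕ) (u : ProbabilityMeasure M → ℝ) (k : H0 lam) (x : M) : ℝ :=
  cutoff n (‖k.1‖ ^ 2) * convExtrinsicDeriv u (PsiP k).1 x
    + (‖k.1‖ ^ 2 * deriv (cutoff n) (‖k.1‖ ^ 2)) * u (PsiP k).1

theorem mul_extendDeriv_eq_cutGrad (n : ℕ) (u : ProbabilityMeasure M → ℝ) (k : H0 lam) (x : M) :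
    ‖k.1‖ ^ 2 * extendDeriv n u (convExtrinsicDeriv u) (PsiM k.1).1 x = cutGrad n u k x := by
  have h0 : ‖k.1‖ ≠ 0 := norm_ne_zero_iff.2 k.2
  rw [extendDeriv, cutGrad, mass_PsiM, normalize_PsiM]
  field_simp

theorem continuous_cutGrad (n : ℕ) {u : ProbabilityMeasure M → ℝ} (hu : u ∈ PCE1b M) :
    Continuous fun p : H0 lam × M => cutGrad n u p.1 p.2 := by
  have hn : Continuous fun p : H0 lam × M => ‖p.1.1‖ ^ 2 := by fun_prop
  have hP : Continuous fun p : H0 lam × M => (PsiP p.1).1 :=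
    Pac.continuous_val.comp (continuous_PsiP.comp continuous_fst)
  have hχ := contDiff_cutoff n
  exact ((hχ.continuous.comp hn).mul (hu.2.2.1.comp (hP.prodMk continuous_snd))).add
    ((hn.mul ((hχ.continuous_deriv le_rfl).comp hn)).mul (hu.1.comp hP))

/-- The size of the error made by the cutoff. -/
noncomputable def cutError (n : ℕ) (t : ℝ) : ℝ :=
  |cutoff n t - 1| + |t * deriv (cutoff n) t|

theorem exists_cutError_le : ∃ K : ℝ, ∀ n t, cutError n t ≤ K := by
  obtain ⟨K, hK0, hK⟩ := exists_deriv_cutoff_bound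
  refine ⟨1 + 2 * K, fun n t => add_le_add ?_ (hK n t).2⟩
  obtain ⟨h0, h1⟩ := cutoff_mem n t
  rw [abs_le]
  constructor <;> linarith

/-- For fixed `t > 0` the cutoff is locally equal to one as soon as `(n + 1)t > 2`, so the error is
eventually zero. -/
theorem tendsto_cutError {t : ℝ} (ht : 0 < t) : Tendsto (fun n => cutError n t) atTop (𝓝 0) := by
  refine tendsto_const_nhds.congr' ?_
  obtain ⟨N, hN⟩ := exists_nat_gt (2 / t)
  filter_upwards [eventually_ge_atTop N] with n hn
  have h1 : 2 < ((n : ℝ) + 1) * t := by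
    rw [div_lt_iff₀ ht] at hN
    have : (N : ℝ) ≤ n := by exact_mod_cast hn
    nlinarith
  rw [cutError, cutoff_eq_one h1.le, deriv_cutoff_eq_zero_of_gt h1]
  simp

theorem memLp_cutGrad (n : ℕ) {u : ProbabilityMeasure M → ℝ} (hu : u ∈ PCE1b M) (k : H0 lam) :
    MemLp (cutGrad n u k) 2 (PsiP k).meas := by
  obtain ⟨C, hC⟩ := (hasConvExtrinsicDeriv_of_mem hu).bddD
  refine MemLp.of_bound
    ((continuous_cutGrad n hu).comp (Continuous.prodMk_right k)).measurable.aestronglyMeasurable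
    (|cutoff n (‖k.1‖ ^ 2)| * C + |(‖k.1‖ ^ 2 * deriv (cutoff n) (‖k.1‖ ^ 2)) * u (PsiP k).1|)
    (Eventually.of_forall fun x => ?_)
  refine (norm_add_le _ _).trans (add_le_add ?_ le_rfl)
  rw [norm_mul]
  exact mul_le_mul_of_nonneg_left (hC _ _) (norm_nonneg _)

theorem memLp_convExtrinsicDeriv {u : ProbabilityMeasure M → ℝ} (hu : u ∈ PCE1b M) (k : H0 lam) :
    MemLp (convExtrinsicDeriv u (PsiP k).1) 2 (PsiP k).meas := by
  obtain ⟨C, hC⟩ := (hasConvExtrinsicDeriv_of_mem hu).bddD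
  exact MemLp.of_bound (hu.2.2.1.comp (Continuous.prodMk_right _)).measurable.aestronglyMeasurable C
    (Eventually.of_forall (hC _))

/-- With `t = ‖k‖²`, the difference is `(χ(t) - 1)` times the derivative of `u` plus `tχ'(t)u`. It
is bounded pointwise, and the base measure has mass one. -/
theorem norm_toL2_cutGrad_sub_le {u : ProbabilityMeasure M → ℝ} (hu : u ∈ PCE1b M) {C : ℝ}
    (hC : ∀ μ x, |u μ| + |convExtrinsicDeriv u μ x| ≤ C) (n : ℕ) (k : H0 lam) :
    ‖toL2 (PsiP k).meas (cutGrad n u k) - toL2 (PsiP k).meas (convExtrinsicDeriv u (PsiP k).1)‖ ≤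
      cutError n (‖k.1‖ ^ 2) * C := by
  have h1 := memLp_cutGrad n hu k
  have h2 := memLp_convExtrinsicDeriv hu k
  have h3 : toL2 (PsiP k).meas (cutGrad n u k)
      - toL2 (PsiP k).meas (convExtrinsicDeriv u (PsiP k).1) =
      toL2 (PsiP k).meas (cutGrad n u k + (-1 : ℝ) • convExtrinsicDeriv u (PsiP k).1) := by
    rw [IsFormCore.toL2_add h1 (h2.const_smul _), IsFormCore.toL2_smul _ h2, neg_one_smul,
      sub_eq_add_neg]
  rw [h3]
  refine norm_toL2_le_of_bound fun x => ?_
  have hC1 : |u (PsiP k).1| ≤ C := (le_add_of_nonneg_right (abs_nonneg _)).trans (hC _ x)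
  have hC2 : |convExtrinsicDeriv u (PsiP k).1 x| ≤ C :=
    (le_add_of_nonneg_left (abs_nonneg _)).trans (hC _ x)
  have h4 : (cutGrad n u k + (-1 : ℝ) • convExtrinsicDeriv u (PsiP k).1) x =
      (cutoff n (‖k.1‖ ^ 2) - 1) * convExtrinsicDeriv u (PsiP k).1 x
        + (‖k.1‖ ^ 2 * deriv (cutoff n) (‖k.1‖ ^ 2)) * u (PsiP k).1 := by
    rw [Pi.add_apply, Pi.smul_apply, smul_eq_mul, cutGrad]
    ring
  rw [h4, cutError, add_mul]
  refine (abs_add_le _ _).trans (add_le_add ?_ ?_)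
  · rw [abs_mul]
    exact mul_le_mul_of_nonneg_left hC2 (abs_nonneg _)
  · rw [abs_mul]
    exact mul_le_mul_of_nonneg_left hC1 (abs_nonneg _)

theorem integrable_opNorm_PsiP {A : CoeffP lam} (hA : AdmissibleP (LamP Λ0) A) :
    Integrable (fun k => ‖A (PsiP k)‖) (restrictH0 Λ0) :=
  hA.integrable_norm.comp_measurable continuous_PsiP.measurable

theorem norm_toL2_cutGrad_le {u : ProbabilityMeasure M → ℝ} (hu : u ∈ PCE1b M) (n : ℕ) :
    ∃ L : ℝ, ∀ k : H0 lam, ‖toL2 (PsiP k).meas (cutGrad n u k)‖ ≤ L := by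
  obtain ⟨C, hC⟩ := hu.2.2.2
  obtain ⟨K, hK⟩ := exists_cutError_le
  refine ⟨C + K * C, fun k => ?_⟩
  have hC0 : 0 ≤ C := le_trans (by positivity) (hC (PsiP k).1 (Classical.arbitrary M))
  have h1 : ‖toL2 (PsiP k).meas (convExtrinsicDeriv u (PsiP k).1)‖ ≤ C :=
    norm_toL2_le_of_bound fun x => (le_add_of_nonneg_left (abs_nonneg _)).trans (hC _ x)
  have h2 := norm_toL2_cutGrad_sub_le hu hC n k
  have h3 := mul_le_mul_of_nonneg_right (hK n (‖k.1‖ ^ 2)) hC0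
  have h4 := norm_le_norm_add_norm_sub (toL2 (PsiP k).meas (convExtrinsicDeriv u (PsiP k).1))
    (toL2 (PsiP k).meas (cutGrad n u k))
  rw [norm_sub_rev] at h4
  linarith

/-- `cutGrad` depends on `‖k‖` and not only on `PsiP k`, so the measurability hypothesis on `A` does
not apply to it directly. It is, however, a combination of the derivative of `u` and the constant
`1` with coefficients depending on `k` alone, and linearity reduces to these two. -/
theorem map_toL2_cutGrad_ae {u : ProbabilityMeasure M → ℝ} (hu : u ∈ PCE1b M) (n : ℕ) (k : H0 lam)
    (T : Lp ℝ 2 (PsiP k).meas →L[ℝ] Lp ℝ 2 (PsiP k).meas) {G G1 : M → ℝ}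
    (hG : T (toL2 (PsiP k).meas (convExtrinsicDeriv u (PsiP k).1)) =ᵐ[(PsiP k).meas] G)
    (hG1 : T (toL2 (PsiP k).meas fun _ => (1 : ℝ)) =ᵐ[(PsiP k).meas] G1) :
    T (toL2 (PsiP k).meas (cutGrad n u k)) =ᵐ[(PsiP k).meas] fun x =>
      cutoff n (‖k.1‖ ^ 2) * G x
        + ((‖k.1‖ ^ 2 * deriv (cutoff n) (‖k.1‖ ^ 2)) * u (PsiP k).1) * G1 x := by
  have h1 : MemLp (fun _ : M => (1 : ℝ)) 2 (PsiP k).meas := memLp_const 1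
  have h2 := memLp_convExtrinsicDeriv hu k
  have h3 : cutGrad n u k = cutoff n (‖k.1‖ ^ 2) • convExtrinsicDeriv u (PsiP k).1
      + ((‖k.1‖ ^ 2 * deriv (cutoff n) (‖k.1‖ ^ 2)) * u (PsiP k).1) • fun _ : M => (1 : ℝ) := by
    ext x
    simp [cutGrad]
  rw [h3, IsFormCore.toL2_add (h2.const_smul _) (h1.const_smul _), IsFormCore.toL2_smul _ h2,
    IsFormCore.toL2_smul _ h1, map_add, map_smul, map_smul]
  generalize T (toL2 (PsiP k).meas (convExtrinsicDeriv u (PsiP k).1)) = y at hG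
  generalize T (toL2 (PsiP k).meas fun _ => (1 : ℝ)) = y1 at hG1
  generalize cutoff n (‖k.1‖ ^ 2) = a
  generalize (‖k.1‖ ^ 2 * deriv (cutoff n) (‖k.1‖ ^ 2)) * u (PsiP k).1 = b
  filter_upwards [hG, hG1, Lp.coeFn_add (a • y) (b • y1), Lp.coeFn_smul a y,
    Lp.coeFn_smul b y1] with x e1 e2 e3 e4 e5
  rw [e3, Pi.add_apply, e4, e5, Pi.smul_apply, Pi.smul_apply, smul_eq_mul, smul_eq_mul, e1, e2]

theorem continuous_comp_fst {X Y Z W : Type*} [TopologicalSpace X] [TopologicalSpace Y]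
    [TopologicalSpace Z] [TopologicalSpace W] {e : X → Y} (he : Continuous e) {g : Y → Z → W}
    (hg : Continuous fun p : Y × Z => g p.1 p.2) : Continuous fun p : X × Z => g (e p.1) p.2 :=
  hg.comp ((he.comp continuous_fst).prodMk continuous_snd)

theorem integrable_cutGrad_energy {A : CoeffP lam} (hA : AdmissibleP (LamP Λ0) A) (n : ℕ)
    {u : ProbabilityMeasure M → ℝ} (hu : u ∈ PCE1b M) :
    Integrable (fun k : H0 lam => inner ℝ (A (PsiP k) (toL2 (PsiP k).meas (cutGrad n u k)))
      (toL2 (PsiP k).meas (cutGrad n u k))) (restrictH0 Λ0) := by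
  obtain ⟨C, hC⟩ := hu.2.2.2
  obtain ⟨L, hL⟩ := norm_toL2_cutGrad_le (lam := lam) hu n
  have hc : Continuous fun p : Pac lam × M => convExtrinsicDeriv u p.1.1 p.2 :=
    continuous_comp_fst (e := fun μ : Pac lam => μ.1) Pac.continuous_val hu.2.2.1
  have hb : ∀ p : Pac lam × M, ‖convExtrinsicDeriv u p.1.1 p.2‖ ≤ C := fun p =>
    (le_add_of_nonneg_left (abs_nonneg _)).trans (hC p.1.1 p.2)
  let η : BoundedContinuousFunction (Pac lam × M) ℝ :=
    BoundedContinuousFunction.ofNormedAddCommGroup _ hc C hb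
  obtain ⟨G, hG, hAG⟩ := hA.measurable η
  obtain ⟨G1, hG1, hAG1⟩ := hA.measurable
    (BoundedContinuousFunction.const (Pac lam × M) (1 : ℝ))
  have hχ := contDiff_cutoff n
  have hnm : Measurable fun p : H0 lam × M => ‖p.1.1‖ ^ 2 :=
    (show Continuous fun p : H0 lam × M => ‖p.1.1‖ ^ 2 by fun_prop).measurable
  have hPm : Measurable fun p : H0 lam × M => (PsiP p.1, p.2) :=
    (continuous_PsiP.measurable.comp measurable_fst).prodMk measurable_snd
  have hum : Measurable fun p : H0 lam × M => u (PsiP p.1).1 :=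
    (hu.1.comp (Pac.continuous_val.comp continuous_PsiP)).measurable.comp measurable_fst
  have hGm : Measurable fun p : H0 lam × M => cutoff n (‖p.1.1‖ ^ 2) * G (PsiP p.1, p.2)
      + ((‖p.1.1‖ ^ 2 * deriv (cutoff n) (‖p.1.1‖ ^ 2)) * u (PsiP p.1).1) * G1 (PsiP p.1, p.2) :=
    ((hχ.continuous.measurable.comp hnm).mul (hG.comp hPm)).add (((hnm.mul
      ((hχ.continuous_deriv le_rfl).measurable.comp hnm)).mul hum).mul (hG1.comp hPm))
  exact integrable_inner_of_measurable (m := fun k : H0 lam => (PsiP k).meas)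
    (Pac.measurable_meas.comp continuous_PsiP.measurable) (integrable_opNorm_PsiP hA) hGm
    (fun k => map_toL2_cutGrad_ae hu n k (A (PsiP k)) (hAG (PsiP k)) (hAG1 (PsiP k)))
    (continuous_cutGrad n hu).measurable (memLp_cutGrad n hu) hL hL

theorem integrable_cutError [IsProbabilityMeasure Λ0] {A : CoeffP lam}
    (hA : AdmissibleP (LamP Λ0) A) (n : ℕ) (C : ℝ) :
    Integrable (fun k : H0 lam => ‖A (PsiP k)‖ * (cutError n (‖k.1‖ ^ 2) * C) ^ 2)
      (restrictH0 Λ0) := by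
  obtain ⟨K, hK⟩ := exists_cutError_le
  have hχ := contDiff_cutoff n
  have hc : Continuous fun k : H0 lam => (cutError n (‖k.1‖ ^ 2) * C) ^ 2 := by
    have hn : Continuous fun k : H0 lam => ‖k.1‖ ^ 2 := by fun_prop
    have h1 := hχ.continuous.comp hn
    have h2 := (hχ.continuous_deriv le_rfl).comp hn
    exact ((((h1.sub continuous_const).abs).add ((hn.mul h2).abs)).mul continuous_const).pow 2
  refine (integrable_opNorm_PsiP hA).mul_bdd (c := (K * |C|) ^ 2) hc.measurable.aestronglyMeasurable
    (Eventually.of_forall fun k => ?_)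
  have h0 : 0 ≤ cutError n (‖k.1‖ ^ 2) := by
    rw [cutError]
    positivity
  rw [norm_pow, norm_mul, Real.norm_of_nonneg h0, Real.norm_eq_abs]
  exact pow_le_pow_left₀ (by positivity) (mul_le_mul_of_nonneg_right (hK _ _) (abs_nonneg _)) 2

/-- Dominated convergence: the error vanishes pointwise off the origin and is uniformly bounded, and
the operator norm is integrable. -/
theorem exists_integral_cutError_lt [IsProbabilityMeasure Λ0] {A : CoeffP lam}
    (hA : AdmissibleP (LamP Λ0) A) (C : ℝ) {ε : ℝ} (hε : 0 < ε) :
    ∃ n, ∫ k : H0 lam, ‖A (PsiP k)‖ * (cutError n (‖k.1‖ ^ 2) * C) ^ 2 ∂(restrictH0 Λ0) < ε := by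
  obtain ⟨K, hK⟩ := exists_cutError_le
  have h1 : Tendsto (fun n => ∫ k : H0 lam, ‖A (PsiP k)‖ * (cutError n (‖k.1‖ ^ 2) * C) ^ 2
      ∂(restrictH0 Λ0)) atTop (𝓝 (∫ _ : H0 lam, (0 : ℝ) ∂(restrictH0 Λ0))) := by
    refine tendsto_integral_of_dominated_convergence (fun k => ‖A (PsiP k)‖ * (K * |C|) ^ 2)
      (fun n => (integrable_cutError hA n C).1) ((integrable_opNorm_PsiP hA).mul_const _)
      (fun n => Eventually.of_forall fun k => ?_) (Eventually.of_forall fun k => ?_)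
    · have h0 : 0 ≤ cutError n (‖k.1‖ ^ 2) := by
        rw [cutError]
        positivity
      rw [norm_mul, norm_norm, norm_pow, norm_mul, Real.norm_of_nonneg h0, Real.norm_eq_abs]
      exact mul_le_mul_of_nonneg_left (pow_le_pow_left₀ (by positivity)
        (mul_le_mul_of_nonneg_right (hK _ _) (abs_nonneg _)) 2) (norm_nonneg _)
    · have h2 : 0 < ‖k.1‖ := norm_pos_iff.2 k.2
      simpa using (((tendsto_cutError (pow_pos h2 2)).mul_const C).pow 2).const_mul ‖A (PsiP k)‖
  rw [integral_zero] at h1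
  exact ((tendsto_order.1 h1).2 ε hε).exists

end PacClosable

/-! ### Closability of the diffusion part over probability measures. -/

section PacClosability

variable {M : Type*} [TopologicalSpace M] [MeasurableSpace M] [BorelSpace M] [PolishSpace M]
  [Nonempty M] {lam : Measure M} [SigmaFinite lam] {Λ0 : Measure (H lam)}

theorem form0P_lift_extendFun (A : CoeffP lam) (n : ℕ) {u : ProbabilityMeasure M → ℝ}
    (hu : u ∈ PCE1b M) :
    form0P Λ0 A (fun h => extendFun n u (PsiM h).1) (fun h => extendFun n u (PsiM h).1) =
      4 * ∫ k : H0 lam, inner ℝ (A (PsiP k) (toL2 (PsiP k).meas (cutGrad n u k)))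
        (toL2 (PsiP k).meas (cutGrad n u k)) ∂(restrictH0 Λ0) := by
  rw [form0P_lift A ((hasConvExtrinsicDeriv_of_mem hu).extend n)]
  simp only [mul_extendDeriv_eq_cutGrad]

theorem form0P_lift_extendFun_sub (A : CoeffP lam) (n n' : ℕ) {u v : ProbabilityMeasure M → ℝ}
    (hu : u ∈ PCE1b M) (hv : v ∈ PCE1b M) :
    form0P Λ0 A ((fun h => extendFun n u (PsiM h).1) - fun h => extendFun n' v (PsiM h).1)
        ((fun h => extendFun n u (PsiM h).1) - fun h => extendFun n' v (PsiM h).1) =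
      4 * ∫ k : H0 lam, inner ℝ
        (A (PsiP k) (toL2 (PsiP k).meas (cutGrad n u k) - toL2 (PsiP k).meas (cutGrad n' v k)))
        (toL2 (PsiP k).meas (cutGrad n u k) - toL2 (PsiP k).meas (cutGrad n' v k))
        ∂(restrictH0 Λ0) := by
  have h := ((hasConvExtrinsicDeriv_of_mem hu).extend n).add
    (((hasConvExtrinsicDeriv_of_mem hv).extend n').smul (-1))
  have h1 : ((fun k : H lam => extendFun n u (PsiM k).1) - fun k => extendFun n' v (PsiM k).1) =
      fun k => extendFun n u (PsiM k).1 + -1 * extendFun n' v (PsiM k).1 := by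
    ext k
    simp [sub_eq_add_neg]
  rw [h1]
  refine (form0P_lift A h).trans ?_
  congr 1
  refine integral_congr_ae (Eventually.of_forall fun k => ?_)
  have h2 : toL2 (PsiP k).meas (cutGrad n u k) - toL2 (PsiP k).meas (cutGrad n' v k) =
      toL2 (PsiP k).meas (cutGrad n u k + (-1 : ℝ) • cutGrad n' v k) := by
    rw [IsFormCore.toL2_add (memLp_cutGrad n hu k) ((memLp_cutGrad n' hv k).const_smul _),
      IsFormCore.toL2_smul _ (memLp_cutGrad n' hv k), neg_one_smul, sub_eq_add_neg]
  have h3 : (fun x => ‖k.1‖ ^ 2 * (extendDeriv n u (convExtrinsicDeriv u) (PsiM k.1).1 x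
      + -1 * extendDeriv n' v (convExtrinsicDeriv v) (PsiM k.1).1 x)) =
      cutGrad n u k + (-1 : ℝ) • cutGrad n' v k := by
    ext x
    simp only [Pi.add_apply, Pi.smul_apply, ← mul_extendDeriv_eq_cutGrad, smul_eq_mul]
    ring
  simp only
  rw [h2, ← h3]

theorem diffForm_LamP {J : Measure (Pac lam × Pac lam)} {V : Pac lam → ℝ} {A : CoeffP lam}
    (S : IsFormCore (Subalgebra.toSubmodule (PCE1b.subalgebra M)) (LamP Λ0) J V A
      (fun μ : Pac lam => μ.1) convExtrinsicDeriv) {u : ProbabilityMeasure M → ℝ}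
    (hu : u ∈ PCE1b.subalgebra M) :
    diffForm (LamP Λ0) A (fun μ : Pac lam => μ.1) convExtrinsicDeriv u u =
      ∫ k : H0 lam, inner ℝ (A (PsiP k) (toL2 (PsiP k).meas (convExtrinsicDeriv u (PsiP k).1)))
        (toL2 (PsiP k).meas (convExtrinsicDeriv u (PsiP k).1)) ∂(restrictH0 Λ0) ∧
    Integrable (fun k : H0 lam =>
      inner ℝ (A (PsiP k) (toL2 (PsiP k).meas (convExtrinsicDeriv u (PsiP k).1)))
        (toL2 (PsiP k).meas (convExtrinsicDeriv u (PsiP k).1))) (restrictH0 Λ0) := by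
  have h1 := S.integrable_energy u hu u hu
  refine ⟨?_, h1.comp_measurable continuous_PsiP.measurable⟩
  rw [diffForm, LamP, integral_map continuous_PsiP.measurable.aemeasurable h1.1]
  rfl

/-- The form of `u` is controlled by the form of the lift and the cutoff error. -/
theorem diffForm_le_form0P [IsProbabilityMeasure Λ0] {J : Measure (Pac lam × Pac lam)}
    {V : Pac lam → ℝ} {A : CoeffP lam}
    (S : IsFormCore (Subalgebra.toSubmodule (PCE1b.subalgebra M)) (LamP Λ0) J V A
      (fun μ : Pac lam => μ.1) convExtrinsicDeriv) (hA : AdmissibleP (LamP Λ0) A)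
    {u : ProbabilityMeasure M → ℝ} (hu : u ∈ PCE1b.subalgebra M) {C : ℝ}
    (hC : ∀ μ x, |u μ| + |convExtrinsicDeriv u μ x| ≤ C) (n : ℕ) :
    diffForm (LamP Λ0) A (fun μ : Pac lam => μ.1) convExtrinsicDeriv u u ≤
      (1 / 2) * form0P Λ0 A (fun h => extendFun n u (PsiM h).1)
        (fun h => extendFun n u (PsiM h).1)
      + 2 * ∫ k : H0 lam, ‖A (PsiP k)‖ * (cutError n (‖k.1‖ ^ 2) * C) ^ 2 ∂(restrictH0 Λ0) := by
  obtain ⟨h1, h2⟩ := diffForm_LamP S hu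
  rw [h1, form0P_lift_extendFun A n hu, ← mul_assoc, ← integral_const_mul, ← integral_const_mul,
    ← integral_add ((integrable_cutGrad_energy hA n hu).const_mul _)
      ((integrable_cutError hA n C).const_mul _)]
  refine integral_mono h2 (((integrable_cutGrad_energy hA n hu).const_mul _).add
      ((integrable_cutError hA n C).const_mul _)) fun k => ?_
  -- The gradient is the cut gradient plus the error. The factor `2` of the inequality over the
  -- factor `4` of the lifted form gives `1/2`.
  have h3 := inner_add_le_of_isPositive (hA.positive (PsiP k))
    (toL2 (PsiP k).meas (cutGrad n u k))
    (toL2 (PsiP k).meas (convExtrinsicDeriv u (PsiP k).1) - toL2 (PsiP k).meas (cutGrad n u k))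
  have h4 := norm_toL2_cutGrad_sub_le hu hC n k
  rw [norm_sub_rev] at h4
  have h5 := inner_le_opNorm (A (PsiP k)) h4
  rw [add_sub_cancel] at h3
  simp only
  linarith

/-- The form of the difference of two lifts is controlled by the form of `u - v` and the cutoff
errors. -/
theorem form0P_le_diffForm [IsProbabilityMeasure Λ0] {J : Measure (Pac lam × Pac lam)}
    {V : Pac lam → ℝ} {A : CoeffP lam}
    (S : IsFormCore (Subalgebra.toSubmodule (PCE1b.subalgebra M)) (LamP Λ0) J V A
      (fun μ : Pac lam => μ.1) convExtrinsicDeriv) (hA : AdmissibleP (LamP Λ0) A)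
    {u v : ProbabilityMeasure M → ℝ} (hu : u ∈ PCE1b.subalgebra M) (hv : v ∈ PCE1b.subalgebra M)
    {C C' : ℝ} (hC : ∀ μ x, |u μ| + |convExtrinsicDeriv u μ x| ≤ C)
    (hC' : ∀ μ x, |v μ| + |convExtrinsicDeriv v μ x| ≤ C') (n n' : ℕ) :
    0 ≤ form0P Λ0 A ((fun h => extendFun n u (PsiM h).1) - fun h => extendFun n' v (PsiM h).1)
        ((fun h => extendFun n u (PsiM h).1) - fun h => extendFun n' v (PsiM h).1) ∧
    form0P Λ0 A ((fun h => extendFun n u (PsiM h).1) - fun h => extendFun n' v (PsiM h).1)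
        ((fun h => extendFun n u (PsiM h).1) - fun h => extendFun n' v (PsiM h).1) ≤
      8 * diffForm (LamP Λ0) A (fun μ : Pac lam => μ.1) convExtrinsicDeriv (u - v) (u - v)
      + 16 * ((∫ k : H0 lam, ‖A (PsiP k)‖ * (cutError n (‖k.1‖ ^ 2) * C) ^ 2 ∂(restrictH0 Λ0))
        + ∫ k : H0 lam, ‖A (PsiP k)‖ * (cutError n' (‖k.1‖ ^ 2) * C') ^ 2 ∂(restrictH0 Λ0)) := by
  obtain ⟨h1, h2⟩ := diffForm_LamP S ((PCE1b.subalgebra M).sub_mem hu hv)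
  have hi := integrable_cutError hA n C
  have hi' := integrable_cutError hA n' C'
  have hp : ∀ k : H0 lam, 0 ≤ inner ℝ
      (A (PsiP k) (toL2 (PsiP k).meas (cutGrad n u k) - toL2 (PsiP k).meas (cutGrad n' v k)))
      (toL2 (PsiP k).meas (cutGrad n u k) - toL2 (PsiP k).meas (cutGrad n' v k)) := fun k =>
    (hA.positive (PsiP k)).inner_nonneg_left _
  rw [form0P_lift_extendFun_sub A n n' hu hv]
  refine ⟨mul_nonneg (by norm_num) (integral_nonneg hp), ?_⟩
  have h3 := integral_mono_of_nonneg (Eventually.of_forall hp)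
    ((h2.const_mul 2).add ((hi.const_mul 4).add (hi'.const_mul 4))) (Eventually.of_forall fun k => by
      have hd : toL2 (PsiP k).meas (convExtrinsicDeriv (u - v) (PsiP k).1) =
          toL2 (PsiP k).meas (convExtrinsicDeriv u (PsiP k).1)
            - toL2 (PsiP k).meas (convExtrinsicDeriv v (PsiP k).1) := by
        have hs : u - v = u + (-1 : ℝ) • v := by rw [neg_one_smul, sub_eq_add_neg]
        have hv1 : (-1 : ℝ) • v ∈ Subalgebra.toSubmodule (PCE1b.subalgebra M) :=
          Submodule.smul_mem _ _ hv
        have hv2 := memLp_convExtrinsicDeriv hv k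
        rw [hs, S.d_add u hu _ hv1, S.d_smul _ v hv, Pi.add_apply, Pi.smul_apply,
          IsFormCore.toL2_add (memLp_convExtrinsicDeriv hu k) (hv2.const_smul _),
          IsFormCore.toL2_smul _ hv2, neg_one_smul, sub_eq_add_neg]
      have e1 := inner_le_opNorm (A (PsiP k)) (norm_toL2_cutGrad_sub_le hu hC n k)
      have h5 := norm_toL2_cutGrad_sub_le hv hC' n' k
      rw [norm_sub_rev] at h5
      have e2 := inner_le_opNorm (A (PsiP k)) h5
      simp only [Pi.add_apply]
      rw [hd]
      generalize toL2 (PsiP k).meas (cutGrad n u k) = a at *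
      generalize toL2 (PsiP k).meas (cutGrad n' v k) = b at *
      generalize toL2 (PsiP k).meas (convExtrinsicDeriv u (PsiP k).1) = x at *
      generalize toL2 (PsiP k).meas (convExtrinsicDeriv v (PsiP k).1) = y at *
      -- From `a - b = (x - y) + ((a - x) + (y - b))`, two applications give the factors `2`, `4`,
      -- `4`; the form on `H` multiplies them by `4`, whence `8` and `16`.
      have e3 := inner_add_le_of_isPositive (hA.positive (PsiP k)) (x - y) ((a - x) + (y - b))
      have e4 := inner_add_le_of_isPositive (hA.positive (PsiP k)) (a - x) (y - b)
      have e5 : x - y + ((a - x) + (y - b)) = a - b := by abel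
      rw [e5] at e3
      linarith)
  have h4 := h3.trans_eq (integral_add (h2.const_mul 2) ((hi.const_mul 4).add (hi'.const_mul 4)))
  have h5 := integral_add (hi.const_mul 4) (hi'.const_mul 4)
  rw [integral_const_mul, integral_const_mul] at h5
  rw [integral_const_mul, ← h1] at h4
  have h6 := h4.trans_eq (congrArg _ h5)
  linarith

theorem eLpNorm_lift_le (hΛ0 : Λ0 {0} = 0) {u : ProbabilityMeasure M → ℝ} (hu : u ∈ PCE1b M)
    (n : ℕ) : eLpNorm (fun h : H lam => extendFun n u (PsiM h).1) 2 Λ0 ≤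
      eLpNorm (fun μ : Pac lam => u μ.1) 2 (LamP Λ0) := by
  have hc : Continuous fun μ : Pac lam => u μ.1 := hu.1.comp Pac.continuous_val
  rw [eLpNorm_restrictH0 hΛ0, LamP, eLpNorm_map_measure hc.measurable.aestronglyMeasurable
    continuous_PsiP.measurable.aemeasurable]
  refine eLpNorm_mono fun k => ?_
  rw [extendFun, normalize_PsiM, norm_mul, Function.comp_apply]
  refine mul_le_of_le_one_left (norm_nonneg _) ?_
  rw [Real.norm_of_nonneg (cutoff_mem n _).1]
  exact (cutoff_mem n _).2

/-- The energies of the cut-off lifts and of the original functions bound each other up to cutoff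
errors tending to zero. The lifts are thus Cauchy and null in `L²`, closability on `H` sends their
energy to zero, and the original energy follows. -/
theorem isClosable_diffForm_pac [IsProbabilityMeasure Λ0] (hΛ0 : Λ0 {0} = 0)
    {J : Measure (Pac lam × Pac lam)} {V : Pac lam → ℝ} {A : CoeffP lam}
    (S : IsFormCore (Subalgebra.toSubmodule (PCE1b.subalgebra M)) (LamP Λ0) J V A
      (fun μ : Pac lam => μ.1) convExtrinsicDeriv) (hA : AdmissibleP (LamP Λ0) A)
    (hcl : IsClosable Λ0 (C1b0 lam) id (form0P Λ0 A)) :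
    IsClosable (LamP Λ0) (PCE1b.subalgebra M : Set (ProbabilityMeasure M → ℝ))
      (fun u (μ : Pac lam) => u μ.1)
      (diffForm (LamP Λ0) A (fun μ : Pac lam => μ.1) convExtrinsicDeriv) := by
  intro u hu h0 hc
  choose C hC using fun j => (hu j).2.2.2
  -- The cutoff level is chosen after the bound `C j` of the function `u j`, as these bounds need
  -- not be uniform in `j`.
  choose n hn using fun j : ℕ => exists_integral_cutError_lt hA (C j)
    (Nat.one_div_pos_of_nat (α := ℝ) (n := j))
  have hr : Tendsto (fun j => ∫ k : H0 lam, ‖A (PsiP k)‖ * (cutError (n j) (‖k.1‖ ^ 2) * C j) ^ 2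
      ∂(restrictH0 Λ0)) atTop (𝓝 0) :=
    squeeze_zero (fun j => integral_nonneg fun k => by positivity) (fun j => (hn j).le)
      tendsto_one_div_add_atTop_nhds_zero_nat
  have h1 := hcl (fun j h => extendFun (n j) (u j) (PsiM h).1) (fun j => lift_mem_C1b0 (hu j) (n j))
    ?_ ?_
  · refine squeeze_zero (fun j => integral_nonneg fun μ => (hA.positive μ).inner_nonneg_left _)
      (fun j => diffForm_le_form0P S hA (hu j) (hC j) (n j)) ?_
    have h2 := (h1.const_mul (1 / 2)).add (hr.const_mul 2)
    rw [mul_zero, mul_zero, add_zero] at h2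
    exact h2
  · exact tendsto_of_tendsto_of_tendsto_of_le_of_le tendsto_const_nhds h0 (fun j => zero_le)
      fun j => eLpNorm_lift_le hΛ0 (hu j) (n j)
  · refine squeeze_zero (fun p => (form0P_le_diffForm S hA (hu p.1) (hu p.2) (hC p.1) (hC p.2)
      (n p.1) (n p.2)).1) (fun p => (form0P_le_diffForm S hA (hu p.1) (hu p.2) (hC p.1) (hC p.2)
      (n p.1) (n p.2)).2) ?_
    have hr2 : Tendsto (fun p : ℕ × ℕ =>
        (∫ k : H0 lam, ‖A (PsiP k)‖ * (cutError (n p.1) (‖k.1‖ ^ 2) * C p.1) ^ 2 ∂(restrictH0 Λ0))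
        + ∫ k : H0 lam, ‖A (PsiP k)‖ * (cutError (n p.2) (‖k.1‖ ^ 2) * C p.2) ^ 2
          ∂(restrictH0 Λ0)) atTop (𝓝 (0 + 0)) := by
      rw [← prod_atTop_atTop_eq]
      exact (hr.comp tendsto_fst).add (hr.comp tendsto_snd)
    have h2 := (hc.const_mul 8).add (hr2.const_mul 16)
    rw [mul_zero, add_zero, mul_zero, add_zero] at h2
    exact h2

end PacClosability

/-! ### The assertion for probability measures, in both ambient spaces. -/

section PacQuasiRegular

variable {M : Type*} [TopologicalSpace M] [MeasurableSpace M] [BorelSpace M] [PolishSpace M]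
  [Nonempty M] {lam : Measure M} [SigmaFinite lam] {Λ0 : Measure (H lam)}

theorem integral_mixDirac (f : BoundedContinuousFunction M ℝ) (μ : ProbabilityMeasure M) (x : M)
    (ε : unitInterval) : ∫ y, f y ∂(mixDirac μ x ε : Measure M) =
      (1 - ε) * ∫ y, f y ∂(μ : Measure M) + ε * f x := by
  have h1 : (mixDirac μ x ε : Measure M) =
      ENNReal.ofReal (1 - ε) • (μ : Measure M) + ENNReal.ofReal ε • Measure.dirac x := rfl
  rw [h1, integral_add_measure ((f.integrable _).smul_measure ENNReal.ofReal_ne_top)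
    ((f.integrable _).smul_measure ENNReal.ofReal_ne_top), integral_smul_measure,
    integral_smul_measure, integral_dirac' _ _ f.continuous.stronglyMeasurable,
    ENNReal.toReal_ofReal (by linarith [ε.2.2]), ENNReal.toReal_ofReal ε.2.1]
  rfl

/-- The convexity extrinsic derivative of `μ ↦ a μ(f) - b`. -/
theorem hasConvExtrinsicDeriv_integral (f : BoundedContinuousFunction M ℝ) (hf : ∀ x, |f x| ≤ 1)
    (a b : ℝ) :
    HasConvExtrinsicDeriv (fun μ : ProbabilityMeasure M => a * (∫ y, f y ∂(μ : Measure M)) - b)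
      fun μ x => a * (f x - ∫ y, f y ∂(μ : Measure M)) := by
  have hci := ProbabilityMeasure.continuous_integral_boundedContinuousFunction f
  have hI : ∀ μ : ProbabilityMeasure M, |∫ y, f y ∂(μ : Measure M)| ≤ 1 := fun μ => by
    simpa using norm_integral_le_of_norm_le_const (μ := (μ : Measure M)) (f := f) (C := 1)
      (Eventually.of_forall hf)
  refine ⟨(hci.const_mul a).sub continuous_const, fun μ x => ?_, ?_, ?_⟩
  -- An integral is affine along mixtures, so the difference quotient is independent of `ε`.
  · refine tendsto_const_nhds.congr' ?_
    filter_upwards [self_mem_nhdsWithin] with ε hε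
    have h0 : (ε : ℝ) ≠ 0 := fun h => (ne_of_gt (show 0 < ε from hε)) (Subtype.ext h)
    rw [integral_mixDirac]
    field_simp
    ring
  · exact ((f.continuous.comp continuous_snd).sub (hci.comp continuous_fst)).const_mul a
  · refine ⟨|a| * 1 + |b| + |a| * (1 + 1), fun μ x => add_le_add ?_ ?_⟩
    · refine (abs_sub _ _).trans (add_le_add ?_ le_rfl)
      rw [abs_mul]
      exact mul_le_mul_of_nonneg_left (hI μ) (abs_nonneg a)
    · rw [abs_mul]
      exact mul_le_mul_of_nonneg_left ((abs_sub _ _).trans (add_le_add (hf x) (hI μ)))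
        (abs_nonneg a)

theorem integral_mem_pathBall (f : BoundedContinuousFunction M ℝ) (hf : ∀ x, |f x| ≤ 1) {a b : ℝ}
    (ha : |a| ≤ 1) (hb : |b| ≤ 1) :
    (fun μ : ProbabilityMeasure M => a * (∫ y, f y ∂(μ : Measure M)) - b) ∈
      pathBall (𝓝[>] (0 : unitInterval)) (fun ε => (ε : ℝ)) (mixDirac (M := M)) (fun _ => 1) 2 := by
  have hI : ∀ μ : ProbabilityMeasure M, |∫ y, f y ∂(μ : Measure M)| ≤ 1 := fun μ => by
    simpa using norm_integral_le_of_norm_le_const (μ := (μ : Measure M)) (f := f) (C := 1)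
      (Eventually.of_forall hf)
  refine ⟨_, hasConvExtrinsicDeriv_integral f hf a b, fun μ => ?_, fun μ x => ?_⟩
  · have h1 : |a * ∫ y, f y ∂(μ : Measure M)| ≤ 1 := by
      rw [abs_mul]
      exact mul_le_one₀ ha (abs_nonneg _) (hI μ)
    linarith [abs_sub (a * ∫ y, f y ∂(μ : Measure M)) b]
  · have h1 := (abs_sub (f x) (∫ y, f y ∂(μ : Measure M))).trans (add_le_add (hf x) (hI μ))
    rw [abs_mul, mul_one]
    calc _ ≤ 1 * (1 + 1 : ℝ) := mul_le_mul ha h1 (abs_nonneg _) zero_le_one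
      _ = 2 := by norm_num

theorem Pac.mass_toMac (μ : Pac lam) : (μ.toMac.1.mass : ℝ) = 1 := by
  rw [← Mac.norm_dens, Pac.dens_toMac, Pac.norm_dens]

theorem Pac.coe_toMac (μ : Pac lam) : (μ.toMac.1 : Measure M) = (μ.1 : Measure M) := rfl

/-- The ambient space `X'` is `Pac` with `i` the identity, or `Mac` with `i` the closed inclusion;
the two assertions for probability measures are these instances. -/
theorem hasQuasiRegularClosure_pac_of_isometry [IsProbabilityMeasure Λ0] (hΛ0 : Λ0 {0} = 0)
    {A : CoeffP lam} (hA : AdmissibleP (LamP Λ0) A)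
    (hcl : IsClosable Λ0 (C1b0 lam) id (form0P Λ0 A))
    {V : Pac lam → ℝ} (hV : 0 ≤ᵐ[LamP Λ0] V) (hVi : Integrable V (LamP Λ0))
    {J : Measure (Pac lam × Pac lam)} (hJ : IsJumpP (LamP Λ0) J)
    {X' : Type*} [MetricSpace X'] [CompleteSpace X'] [MeasurableSpace X'] [BorelSpace X']
    {i : Pac lam → X'} (hi : IsClosedEmbedding i) {k : X' → Mac lam} (hk : Isometry k)
    (hki : ∀ μ, k (i μ) = μ.toMac) :
    HasQuasiRegularClosure ((LamP Λ0).map i) (PCE1b M)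
      (fun u => Function.extend i (onPac lam u) 0) (formP (LamP Λ0) J V A) := by
  have S := isFormCore_pac hA hV hVi hJ
  obtain ⟨f, hf, hfn⟩ := exists_norming_seq lam
  obtain ⟨κ, hκ1, hκ⟩ := exists_abs_pac_sub_le lam
  have hone : ∀ x, |BoundedContinuousFunction.const M (1 : ℝ) x| ≤ 1 := fun x => by simp
  have hB := isLatticeLike_pathBall (X := Pac lam) (l := 𝓝[>] (0 : unitInterval))
    (c := fun ε => (ε : ℝ)) (path := mixDirac (M := M)) tendsto_coe_unitInterval (w := fun _ => 1)
    (fun _ => zero_le_one) two_pos Pac.continuous_val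
  -- The common constant is `κ * 2` rather than `2` because the Lipschitz bound over probability
  -- measures loses the factor `κ`.
  have hBD : ∀ u ∈ pathBall (𝓝[>] (0 : unitInterval)) (fun ε => (ε : ℝ)) (mixDirac (M := M))
      (fun _ => 1) 2, u ∈ PCE1b.subalgebra M ∧ (∀ μ : Pac lam, |u μ.1| ≤ κ * 2) ∧
      (∀ μ ν : Pac lam, |u μ.1 - u ν.1| ≤ 2 * (κ * 2) * dist μ ν) ∧
      ∀ μ : Pac lam, ‖toL2 μ.meas (convExtrinsicDeriv u μ.1)‖ ≤ κ * 2 := by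
    rintro u ⟨D, h, hu, hD⟩
    refine ⟨h.mem_PCE1b, fun μ => (hu _).trans (by linarith),
      hκ u D h 2 zero_le_two hu fun μ x => (hD μ x).trans_eq (mul_one 2), fun μ => ?_⟩
    rw [h.convExtrinsicDeriv_eq]
    exact norm_toL2_le_of_bound fun x => (hD _ x).trans (by linarith)
  refine S.hasQuasiRegularClosure_of_isometry (isClosable_diffForm_pac hΛ0 S hA hcl)
    hJ.lintegral_lt_top hA.integrable_norm (fun u hu => hu.1.comp Pac.continuous_val) hi hk
    ⟨fun n μ => 1 * (∫ y, f n y ∂(μ : Measure M)) - 0,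
      fun n => (hBD _ (integral_mem_pathBall _ (hf n) (by simp) (by simp))).1, fun μ ν h => ?_⟩
    hB hBD (fun t ht => hB.norm_scaledDens_sub_mem (fun μ => k (i μ)) (fun g hg b hb => ?_) ht)
    fun n => ?_
  · refine Pac.isometry_toMac.injective (Mac.eq_of_norming hfn fun n => ?_)
    have h1 := h n
    simp only [one_mul, sub_zero] at h1
    rw [Pac.coe_toMac, Pac.coe_toMac]
    exact h1
  -- At mass one the scaling factor `1/(1 + m)` is `1/2`, hence `a = 1/2`.
  · have h1 := hB.mem_approximable (Λ := LamP Λ0)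
      (integral_mem_pathBall g hg (a := 1 / 2) (b := b) (by norm_num [abs_of_pos]) hb)
    refine (congrArg (· ∈ Approximable (LamP Λ0) _ _) (funext fun μ => ?_)).mp h1
    rw [hki, Pac.mass_toMac, Pac.coe_toMac]
    ring
  -- At mass one `massRatio n` is the constant `1/(n + 2)`, obtained with `a = 0`.
  · have h1 := hB.mem_approximable (Λ := LamP Λ0) (integral_mem_pathBall _ hone (a := 0)
      (b := -((n : ℝ) + 1 + 1)⁻¹) (by simp) (by
        rw [abs_neg, abs_of_pos (by positivity)]
        exact inv_le_one_of_one_le₀ (by linarith [n.cast_nonneg (α := ℝ)])))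
    refine (congrArg (· ∈ Approximable (LamP Λ0) _ _) (funext fun μ => ?_)).mp h1
    rw [hki, Mac.massRatio, Mac.norm_dens, Pac.mass_toMac]
    simp

theorem hasQuasiRegularClosure_formP [IsProbabilityMeasure Λ0] (hΛ0 : Λ0 {0} = 0)
    {A : CoeffP lam} (hA : AdmissibleP (LamP Λ0) A)
    (hcl : IsClosable Λ0 (C1b0 lam) id (form0P Λ0 A))
    {V : Pac lam → ℝ} (hV : 0 ≤ᵐ[LamP Λ0] V) (hVi : Integrable V (LamP Λ0))
    {J : Measure (Pac lam × Pac lam)} (hJ : IsJumpP (LamP Λ0) J) :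
    HasQuasiRegularClosure (LamP Λ0) (PCE1b M) (onPac lam) (formP (LamP Λ0) J V A) ∧
    HasQuasiRegularClosure ((LamP Λ0).map Pac.toMac) (PCE1b M) (extendToMac lam)
      (formP (LamP Λ0) J V A) := by
  refine ⟨?_, hasQuasiRegularClosure_pac_of_isometry hΛ0 hA hcl hV hVi hJ
    Pac.isometry_toMac.isClosedEmbedding isometry_id fun _ => rfl⟩
  have hmain := hasQuasiRegularClosure_pac_of_isometry hΛ0 hA hcl hV hVi hJ
    IsClosedEmbedding.id Pac.isometry_toMac fun _ => rfl
  rw [Measure.map_id] at hmain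
  simp only [Function.extend_id] at hmain
  exact hmain

end PacQuasiRegular

end ExtrinsicForm

theorem corollary3p7 {M : Type*} [TopologicalSpace M] [PolishSpace M] [MeasurableSpace M]
    [BorelSpace M] (lam : Measure M) [SigmaFinite lam] (hlam : lam ≠ 0)
    (Λ0 : Measure (H lam)) [IsProbabilityMeasure Λ0] (hΛ0 : Λ0 {0} = 0) :
    (∀ A : CoeffM lam, AdmissibleM (LamM Λ0) A →
      IsClosable Λ0 (C1b lam) id (form0M Λ0 A) →
      ∀ V : Mac lam → ℝ, 0 ≤ᵐ[LamM Λ0] V → Integrable V (LamM Λ0) →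
      ∀ J : Measure (Mac lam × Mac lam), IsJumpM (LamM Λ0) J →
        HasQuasiRegularClosure (LamM Λ0) (CE1b2 lam) (onMac lam)
          (formM (LamM Λ0) J V A)) ∧
    (∀ A : CoeffP lam, AdmissibleP (LamP Λ0) A →
      IsClosable Λ0 (C1b0 lam) id (form0P Λ0 A) →
      ∀ V : Pac lam → ℝ, 0 ≤ᵐ[LamP Λ0] V → Integrable V (LamP Λ0) →
      ∀ J : Measure (Pac lam × Pac lam), IsJumpP (LamP Λ0) J →
        HasQuasiRegularClosure (LamP Λ0) (PCE1b M) (onPac lam)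
          (formP (LamP Λ0) J V A) ∧
        HasQuasiRegularClosure ((LamP Λ0).map Pac.toMac) (PCE1b M) (extendToMac lam)
          (formP (LamP Λ0) J V A)) := by
  -- A point of `M` is needed to read the bound on `|u|` from the bound on `|u| + |D|`, which is
  -- quantified over points, and to normalize the zero measure.
  have : Nonempty M := by
    by_contra h
    rw [not_nonempty_iff] at h
    exact hlam (Measure.eq_zero_of_isEmpty lam)
  exact ⟨fun A hA hcl V hV hVi J hJ => hasQuasiRegularClosure_formM hA hcl hV hVi hJ,
    fun A hA hcl V hV hVi J hJ => hasQuasiRegularClosure_formP hΛ0 hA hcl hV hVi hJ⟩
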